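/- **Setting.** Let $\mathfrak n=\Pi\mathfrak n_1\oplus\mathfrak n_2$ be a finite-dimensional two-step nilpotent super Lie algebra: a complex vector space $\mathfrak n_1$ (odd) with basis $d_\alpha$, an even central space $\mathfrak n_2$ with basis $e_\mu$, and a symmetric bilinear bracket $[d_\alpha,d_\beta]=2f^\mu_{\alpha\beta}e_\mu$, $f^\mu_{\alpha\beta}\in\mathbb C$. Let $V$ be the real span of the $e_\mu$, with coordinates $x^\mu$, let $N$ be the super Lie group of $\mathfrak n$, with $C^\infty(N)=C^\infty(V;\mathbb C)\otimes\mathbb C[\theta^\alpha]$ ($\theta^\alpha$ odd), and let $$\mathscr L(d_\alpha)=\partial_{\theta^\alpha}+f^\mu_{\alpha\beta}\theta^\beta\partial_{x^\mu},\quad \mathscr R(d_\alpha)=\partial_{\theta^\alpha}-f^\mu_{\alpha\beta}\theta^\beta\partial_{x^\mu},\quad \mathscr L(e_\mu)=\mathscr R(e_\mu)=\partial_{x^\mu}.$$ Let $\mathfrak g_0$ be a complex Lie algebra with a Lie map $\mathfrak g_0\to\mathfrak{aut}(\mathfrak n)$ to the even derivations of $\mathfrak n$ (for instance $\mathfrak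 g_0=\mathfrak{aut}(\mathfrak n)$), and $\mathfrak g=\mathfrak g_0\ltimes\mathfrak n$. All signs are governed by the total parity (cohomological degree plus intrinsic parity mod 2). A *strict $\mathfrak g$-multiplet* is an affine (i.e. trivialised) $\mathbb Z\times\mathbb Z/2$-graded vector bundle over $V$, of finite rank in each bidegree, whose space of sections carries a square-zero differential operator $D$ of bidegree $(1,+)$ and an action $\rho$ of the super Lie algebra $\mathfrak g$ by differential operators of cohomological degree $0$ supercommuting with $D$, such that $\mathfrak n_2$ acts by translations and $\mathfrak g_0$ acts by the linear vector fields on $V$ induced by its action on $\mathfrak n_2$ plus constant endomorphisms of the fibre. A strict morphism is a bidegree-preserving differential operator commuting with $D$ and $\rho$; it is a quasi-isomorphism if it is an isomorphism on cohomology. *The algebra $C^\bullet(\mathfrak n)$.* $C^\bullet(\mathfrak n)=\mathbb C[\lambda^\alpha]\otimes\wedge[v^\mu]$, with $\lambda^\alpha,v^\mu$ of cohomological degree $1$ and intrinsic parity odd, resp. even, $\mathrm d_{\mathrm{CE}}=\lambda^\alpha f^\mu_{\alpha\beta}\lambda^\beta\,\partial_{v^\mu}$, and the coadjoint action of $\mathfrak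 g_0$. *The pure spinor functor.* For a $\mathfrak g_0$-equivariant dgs $C^\bullet(\mathfrak n)$-module $(\Gamma,\mathrm d_\Gamma)$, finite-dimensional in each bidegree, $A^\bullet(\Gamma)=(C^\infty(N)\otimes_{\mathbb C}\Gamma,\ \mathcal D)$ with $\mathcal D=\lambda^\alpha\mathscr R(d_\alpha)+v^\mu\mathscr R(e_\mu)+\mathrm d_\Gamma$, where $\mathfrak n$ acts by $\mathscr L$ on $C^\infty(N)$ and $\mathfrak g_0$ acts on both factors (on $C^\infty(N)$ by the induced linear vector fields). *The de Rham complex.* $\Omega^\bullet(N)=C^\infty(N)[\mathrm d\theta^\alpha,\mathrm dx^\mu]$ ($\mathrm d\theta^\alpha$ of even, $\mathrm dx^\mu$ of odd total parity), with $\mathrm d_{\mathrm{dR}}=\mathrm d\theta^\alpha\partial_{\theta^\alpha}+\mathrm dx^\mu\partial_{x^\mu}$, graded by form degree and intrinsic parity; $\mathfrak g$ acts by Lie derivatives along the vector fields by which it acts on $C^\infty(N)$ ($\mathfrak n$ through $\mathscr L$). **Lemma.** $C^\bullet(\mathfrak n)$ is a $\mathfrak g_0$-equivariant dgs module over itself (finite-dimensional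 in each bidegree), $A^\bullet(C^\bullet(\mathfrak n))$ and $\Omega^\bullet(N)$ are strict $\mathfrak g$-multiplets, and the change of coordinates $(x,\lambda,\theta,v)\mapsto(x,\lambda,\theta,v+\lambda f\theta)$, i.e. the map $$\Phi_{\mathfrak n}\colon A^\bullet(C^\bullet(\mathfrak n))=C^\infty(N)\otimes C^\bullet(\mathfrak n)\longrightarrow\Omega^\bullet(N),\qquad F\otimes c\longmapsto F\cdot\psi(c),$$ where $\psi\colon C^\bullet(\mathfrak n)\to\Omega^\bullet(N)$ is the algebra homomorphism with $\psi(\lambda^\alpha)=\mathrm d\theta^\alpha$ and $\psi(v^\mu)=\mathrm dx^\mu+\mathrm d\theta^\alpha f^\mu_{\alpha\beta}\theta^\beta$, is a strict morphism of $\mathfrak g$-multiplets and a quasi-isomorphism; it is in fact bijective. It is natural in $\mathfrak n$: for every homomorphism $\mathfrak n\to\mathfrak n'$ (given by a complex linear map $\mathfrak n_1\to\mathfrak n_1'$ and a real linear map $V\to V'$ compatible with the brackets), $\Phi$ commutes with the pullbacks of functions, cochains and differential forms. -/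

import Mathlib

open scoped TensorProduct ContDiff

noncomputable section

namespace PureSpinor

attribute [local instance 100] LieRing.ofAssociativeRing

/-! ## Two-step nilpotent super Lie algebras and algebras of super Poincaré type -/

/-- A two-step nilpotent super Lie algebra `𝔫 = Π𝔫₁ ⊕ 𝔫₂` (central extension of the odd abelian
algebra `Π𝔫₁` by the even space `𝔫₂`), with bases `d_α` (`α : ι`) of `𝔫₁` and `e_μ` (`μ : κ`)
of `𝔫₂`. Its only bracket is a symmetric bilinear map `𝔫₁ × 𝔫₁ → 𝔫₂`. Coefficients are complex;
the spacetime is the real span `V = κ → ℝ` of the `e_μ`. -/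
structure TwoStep (ι κ : Type) where
  br : (ι → ℂ) →ₗ[ℂ] (ι → ℂ) →ₗ[ℂ] (κ → ℂ)
  symm : ∀ s t, br s t = br t s

variable {ι κ : Type} [Fintype ι] [DecidableEq ι] [Fintype κ] [DecidableEq κ]

/-- The constants `f^μ_{αβ}`, normalised by `[d_α, d_β] = 2 f^μ_{αβ} e_μ`. -/
def TwoStep.f (n : TwoStep ι κ) (μ : κ) (α β : ι) : ℂ :=
  (1 / 2 : ℂ) * n.br (Pi.single α 1) (Pi.single β 1) μ

/-- The Lie algebra `𝔞𝔲𝔱(𝔫)` of even derivations of `𝔫`. -/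
def TwoStep.aut (n : TwoStep ι κ) : LieSubalgebra ℂ (Module.End ℂ ((ι → ℂ) × (κ → ℂ))) where
  carrier := {a | (∀ s, (a (s, 0)).2 = 0) ∧ (∀ w, (a (0, w)).1 = 0) ∧
    ∀ s t, (a (0, n.br s t)).2 = n.br (a (s, 0)).1 t + n.br s (a (t, 0)).1}
  zero_mem' := by simp
  add_mem' := by
    rintro a b ⟨h1, h2, h3⟩ ⟨k1, k2, k3⟩
    refine ⟨fun s => by simp [h1, k1], fun w => by simp [h2, k2], fun s t => ?_⟩
    simp only [LinearMap.add_apply, Prod.snd_add, Prod.fst_add, h3, k3, map_add]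
    abel
  smul_mem' := by
    rintro c a ⟨h1, h2, h3⟩
    refine ⟨fun s => by simp [h1], fun w => by simp [h2], fun s t => ?_⟩
    simp [h3]
  lie_mem' := by
    rintro a b ⟨h1, h2, h3⟩ ⟨k1, k2, k3⟩
    have ha1 : ∀ s, a (s, 0) = ((a (s, 0)).1, 0) := fun s => Prod.ext rfl (h1 s)
    have hb1 : ∀ s, b (s, 0) = ((b (s, 0)).1, 0) := fun s => Prod.ext rfl (k1 s)
    have ha2 : ∀ w, a (0, w) = (0, (a (0, w)).2) := fun w => Prod.ext (h2 w) rfl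
    have hb2 : ∀ w, b (0, w) = (0, (b (0, w)).2) := fun w => Prod.ext (k2 w) rfl
    refine ⟨fun s => ?_, fun w => ?_, fun s t => ?_⟩
    · simp only [Ring.lie_def, LinearMap.sub_apply, Module.End.mul_apply, Prod.snd_sub]
      rw [hb1 s, ha1 s, h1, k1, sub_zero]
    · simp only [Ring.lie_def, LinearMap.sub_apply, Module.End.mul_apply, Prod.fst_sub]
      rw [hb2 w, ha2 w, h2, k2, sub_zero]
    · simp only [Ring.lie_def, LinearMap.sub_apply, Module.End.mul_apply, Prod.fst_sub,
        Prod.snd_sub]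
      rw [hb2 (n.br s t), ha2 (n.br s t), h3, k3]
      have e1 : ∀ x y : κ → ℂ, (a (0, x + y)).2 = (a (0, x)).2 + (a (0, y)).2 := fun x y => by
        rw [← Prod.snd_add, ← map_add, Prod.mk_add_mk, add_zero]
      have e2 : ∀ x y : κ → ℂ, (b (0, x + y)).2 = (b (0, x)).2 + (b (0, y)).2 := fun x y => by
        rw [← Prod.snd_add, ← map_add, Prod.mk_add_mk, add_zero]
      rw [e1, e2, h3, h3, k3, k3, hb1 s, hb1 t, ha1 s, ha1 t]
      simp only [map_sub, LinearMap.sub_apply]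
      abel

section Action

variable {n : TwoStep ι κ} {G : Type*} [LieRing G] [LieAlgebra ℂ G]

/-- The action of `𝔤₀` on `𝔫₁` through `r : 𝔤₀ → 𝔞𝔲𝔱(𝔫)`. -/
def actOne (r : G →ₗ⁅ℂ⁆ n.aut) : G →ₗ[ℂ] Module.End ℂ (ι → ℂ) where
  toFun a := LinearMap.fst ℂ _ _ ∘ₗ (r a).1 ∘ₗ LinearMap.inl ℂ _ _
  map_add' a b := by ext; simp
  map_smul' c a := by ext; simp

/-- The action of `𝔤₀` on `𝔫₂` through `r : 𝔤₀ → 𝔞𝔲𝔱(𝔫)`. -/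
def actTwo (r : G →ₗ⁅ℂ⁆ n.aut) : G →ₗ[ℂ] Module.End ℂ (κ → ℂ) where
  toFun a := LinearMap.snd ℂ _ _ ∘ₗ (r a).1 ∘ₗ LinearMap.inr ℂ _ _
  map_add' a b := by ext; simp
  map_smul' c a := by ext; simp

/-- Matrix entries of the action on `𝔫₁`: `a · d_β = ∑ α, A^α_β d_α`. -/
def entryOne (r : G →ₗ⁅ℂ⁆ n.aut) (α β : ι) : G →ₗ[ℂ] ℂ :=
  LinearMap.proj α ∘ₗ (actOne r).flip (Pi.single β 1)

/-- Matrix entries of the action on `𝔫₂`: `a · e_ν = ∑ μ, B^μ_ν e_μ`. -/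
def entryTwo (r : G →ₗ⁅ℂ⁆ n.aut) (μ ν : κ) : G →ₗ[ℂ] ℂ :=
  LinearMap.proj μ ∘ₗ (actTwo r).flip (Pi.single ν 1)

end Action

/-- The underlying space of the super Lie algebra `𝔤 = 𝔤₀ ⊕ Π𝔫₁ ⊕ 𝔫₂` of super Poincaré type. -/
abbrev SP (G : Type*) (ι κ : Type) := G × (ι → ℂ) × (κ → ℂ)

/-- The even part `𝔤₀ ⊕ 𝔫₂` and the odd part `𝔫₁` of `𝔤`. -/
def SP.par (G : Type*) [LieRing G] [LieAlgebra ℂ G] (ι κ : Type) (p : ZMod 2) :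
    Submodule ℂ (SP G ι κ) :=
  if p = 0 then Submodule.prod ⊤ (Submodule.prod ⊥ ⊤) else Submodule.prod ⊥ (Submodule.prod ⊤ ⊥)

/-- The super Lie bracket of `𝔤 = 𝔤₀ ⋉ 𝔫`. -/
def SP.bracket {n : TwoStep ι κ} {G : Type*} [LieRing G] [LieAlgebra ℂ G]
    (r : G →ₗ⁅ℂ⁆ n.aut) (x y : SP G ι κ) : SP G ι κ :=
  (⁅x.1, y.1⁆, actOne r x.1 y.2.1 - actOne r y.1 x.2.1,
    actTwo r x.1 y.2.2 - actTwo r y.1 x.2.2 + n.br x.2.1 y.2.1)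

/-- The sign `(-1)^{pq}`. -/
def koszul (p q : ZMod 2) : ℂ := if p * q = 0 then 1 else -1

/-! ## Smooth functions on spacetime `V = ℝ^κ` and differential operators -/

/-- Smooth complex-valued functions on `V = κ → ℝ`, as a subalgebra of all functions. -/
def smoothSubalgebra (κ : Type) [Fintype κ] : Subalgebra ℂ ((κ → ℝ) → ℂ) where
  carrier := {h | ContDiff ℝ ∞ h}
  mul_mem' {a b} ha hb := by
    change ContDiff ℝ ∞ (a * b)
    exact ContDiff.mul (show ContDiff ℝ ∞ a from ha) (show ContDiff ℝ ∞ b from hb)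
  add_mem' {a b} ha hb := by
    change ContDiff ℝ ∞ (a + b)
    exact ContDiff.add (show ContDiff ℝ ∞ a from ha) (show ContDiff ℝ ∞ b from hb)
  algebraMap_mem' c := by
    change ContDiff ℝ ∞ (fun _ => c)
    exact contDiff_const

/-- The algebra `C^∞(V)` of smooth complex-valued functions on `V = κ → ℝ`. -/
def Smooth (κ : Type) [Fintype κ] : Type := smoothSubalgebra κ

instance (κ : Type) [Fintype κ] : CommRing (Smooth κ) :=
  inferInstanceAs (CommRing (smoothSubalgebra κ))

instance (κ : Type) [Fintype κ] : Algebra ℂ (Smooth κ) :=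
  inferInstanceAs (Algebra ℂ (smoothSubalgebra κ))

theorem contDiff_smooth {κ : Type} [Fintype κ] (h : Smooth κ) : ContDiff ℝ ∞ h.1 := h.2

/-- The partial derivative `∂/∂x^μ`. -/
def Smooth.partial (μ : κ) : Smooth κ →ₗ[ℂ] Smooth κ where
  toFun h := ⟨fun x => fderiv ℝ h.1 x (Pi.single μ 1),
    ((contDiff_smooth h).fderiv_right (m := ∞) (by simp)).clm_apply contDiff_const⟩
  map_add' a b := by
    refine Subtype.ext (funext fun x => ?_)
    have ha : DifferentiableAt ℝ a.1 x := ((contDiff_smooth a).differentiable (by simp)) x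
    have hb : DifferentiableAt ℝ b.1 x := ((contDiff_smooth b).differentiable (by simp)) x
    change fderiv ℝ (a.1 + b.1) x _ = _
    rw [fderiv_add ha hb]
    rfl
  map_smul' c a := by
    refine Subtype.ext (funext fun x => ?_)
    have ha : DifferentiableAt ℝ a.1 x := ((contDiff_smooth a).differentiable (by simp)) x
    change fderiv ℝ (c • a.1) x _ = _
    rw [fderiv_const_smul ha]
    rfl

/-- The coordinate function `x^μ`. -/
def Smooth.coord (μ : κ) : Smooth κ :=
  ⟨fun x => (x μ : ℂ), show ContDiff ℝ ∞ _ from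
    Complex.ofRealCLM.contDiff.comp (ContinuousLinearMap.proj (R := ℝ) (φ := fun _ => ℝ) μ).contDiff⟩

/-- `P` is a differential operator of order at most `k` between `C^∞(V)`-modules: iterated
commutators with `k + 1` functions vanish. -/
def IsDiffOpOfOrder (κ : Type) [Fintype κ] {E F : Type*} [AddCommGroup E] [Module ℂ E]
    [Module (Smooth κ) E] [SMulCommClass (Smooth κ) ℂ E]
    [AddCommGroup F] [Module ℂ F] [Module (Smooth κ) F] [SMulCommClass (Smooth κ) ℂ F] :
    ℕ → (E →ₗ[ℂ] F) → Prop
  | 0, P => ∀ (h : Smooth κ) (e : E), P (h • e) = h • P e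
  | k + 1, P => ∀ h : Smooth κ, IsDiffOpOfOrder κ k
      (P ∘ₗ DistribSMul.toLinearMap ℂ E h - DistribSMul.toLinearMap ℂ F h ∘ₗ P)

/-! ## Local `𝔤`-modules, multiplets and their morphisms -/

/-- The data of a strict local dgs `𝔤`-module on an affine dgs vector bundle over `V`: the space
`carrier` of sections, the sections `gr k p` of the homogeneous subbundles (cohomological degree
`k`, parity `p`), the space `const` of constant sections of the affine bundle, the differential
and the action of `𝔤`. The laws are stated in `IsStrictLocalModule` and `IsStrictMultiplet`. -/
structure LocalModuleData (G : Type*) [LieRing G] [LieAlgebra ℂ G] (ι κ : Type) [Fintype κ] where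
  carrier : Type*
  [grp : AddCommGroup carrier]
  [modC : Module ℂ carrier]
  [modS : Module (Smooth κ) carrier]
  [tower : IsScalarTower ℂ (Smooth κ) carrier]
  [comm : SMulCommClass (Smooth κ) ℂ carrier]
  gr : ℤ → ZMod 2 → Submodule (Smooth κ) carrier
  const : Submodule ℂ carrier
  D : Module.End ℂ carrier
  ρ : SP G ι κ →ₗ[ℂ] Module.End ℂ carrier

attribute [instance] LocalModuleData.grp LocalModuleData.modC LocalModuleData.modS
  LocalModuleData.tower LocalModuleData.comm

section Multiplets

variable {n : TwoStep ι κ} {G : Type*} [LieRing G] [LieAlgebra ℂ G] (r : G →ₗ⁅ℂ⁆ n.aut)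

/-- Strict local dgs `𝔤`-modules: dgs vector bundles `(E, D)` with a map of dgs Lie algebras from
`𝔤` to the differential operators. All signs are governed by the total parity. -/
structure IsStrictLocalModule (M : LocalModuleData G ι κ) : Prop where
  internal : DirectSum.IsInternal fun k : ℤ × ZMod 2 => M.gr k.1 k.2
  finite : ∀ k p, Module.Finite (Smooth κ) (M.gr k p)
  projective : ∀ k p, Module.Projective (Smooth κ) (M.gr k p)
  D_diffOp : ∃ o, IsDiffOpOfOrder κ o M.D
  D_degree : ∀ k p, ∀ e ∈ M.gr k p, M.D e ∈ M.gr (k + 1) p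
  D_square : M.D * M.D = 0
  ρ_diffOp : ∀ x, ∃ o, IsDiffOpOfOrder κ o (M.ρ x)
  ρ_degree : ∀ p, ∀ x ∈ SP.par G ι κ p, ∀ k q, ∀ e ∈ M.gr k q, M.ρ x e ∈ M.gr k (q + p)
  ρ_bracket : ∀ p q, ∀ x ∈ SP.par G ι κ p, ∀ y ∈ SP.par G ι κ q,
    M.ρ (SP.bracket r x y) = M.ρ x * M.ρ y - koszul p q • (M.ρ y * M.ρ x)
  ρ_D : ∀ p, ∀ x ∈ SP.par G ι κ p, M.D * M.ρ x = koszul 1 p • (M.ρ x * M.D)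

/-- Strict `𝔤`-multiplets: the bundle is affine, i.e. trivialised over `V` by its constant sections
compatibly with the grading, and the part `𝔤₀ ⊕ 𝔫₂` of `𝔤` that acts on `V` by affine
transformations acts on sections geometrically: translations act by differentiation in the affine
trivialisation, and `a ∈ 𝔤₀` acts by the linear vector field on `V` given by its action on `𝔫₂`
together with a constant endomorphism of the fibre. -/
structure IsStrictMultiplet (M : LocalModuleData G ι κ) : Prop
    extends IsStrictLocalModule r M where
  affine : IsBaseChange (Smooth κ) M.const.subtype
  affine_gr : ∀ k p, M.gr k p =
    Submodule.span (Smooth κ) {e | e ∈ M.const ∧ e ∈ M.gr k p}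
  translations : ∀ (w : κ → ℂ) (h : Smooth κ), ∀ e ∈ M.const,
    M.ρ (0, 0, w) (h • e) = (∑ μ, w μ • Smooth.partial μ h) • e
  linear_const : ∀ a : G, ∀ e ∈ M.const, M.ρ (a, 0, 0) e ∈ M.const
  linear : ∀ (a : G) (h : Smooth κ), ∀ e ∈ M.const,
    M.ρ (a, 0, 0) (h • e) =
      (-∑ μ, ∑ ν, entryTwo r μ ν a • (Smooth.coord ν * Smooth.partial μ h)) • e +
        h • M.ρ (a, 0, 0) e

/-- Strict morphisms of strict local `𝔤`-modules. -/
structure IsStrictMorphism (M N : LocalModuleData G ι κ) (Φ : M.carrier →ₗ[ℂ] N.carrier) :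
    Prop where
  diffOp : ∃ o, IsDiffOpOfOrder κ o Φ
  degree : ∀ k p, ∀ e ∈ M.gr k p, Φ e ∈ N.gr k p
  comm_D : Φ ∘ₗ M.D = N.D ∘ₗ Φ
  comm_ρ : ∀ x, Φ ∘ₗ M.ρ x = N.ρ x ∘ₗ Φ

end Multiplets

/-- The cohomology `ker D / im D` (of an operator `D` with `D² = 0`). -/
abbrev Cohomology {E : Type*} [AddCommGroup E] [Module ℂ E] (D : Module.End ℂ E) :=
  LinearMap.ker D ⧸ (LinearMap.range D).submoduleOf (LinearMap.ker D)

/-- The map induced in cohomology by a cochain map. -/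
def cohomologyMap {E F : Type*} [AddCommGroup E] [Module ℂ E] [AddCommGroup F] [Module ℂ F]
    (D : Module.End ℂ E) (D' : Module.End ℂ F) (Φ : E →ₗ[ℂ] F) (h : Φ ∘ₗ D = D' ∘ₗ Φ) :
    Cohomology D →ₗ[ℂ] Cohomology D' :=
  Submodule.mapQ _ _
    (Φ.restrict (p := LinearMap.ker D) (q := LinearMap.ker D') (fun e he => by
      have := LinearMap.congr_fun h e
      simp only [LinearMap.comp_apply, LinearMap.mem_ker] at this he ⊢
      rw [← this, he, map_zero]))
    (by
      rintro ⟨e, he⟩ ⟨u, hu⟩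
      refine ⟨Φ u, ?_⟩
      have := LinearMap.congr_fun h u
      simp only [LinearMap.comp_apply] at this
      rw [← this, hu]
      rfl)

/-- `Φ` is a cochain map inducing an isomorphism in cohomology. -/
def IsQuasiIso {E F : Type*} [AddCommGroup E] [Module ℂ E] [AddCommGroup F] [Module ℂ F]
    (D : Module.End ℂ E) (D' : Module.End ℂ F) (Φ : E →ₗ[ℂ] F) : Prop :=
  ∃ h : Φ ∘ₗ D = D' ∘ₗ Φ, Function.Bijective (cohomologyMap D D' Φ h)

/-! ## The super Lie group `N`: functions and vector fields -/

/-- `C^∞(N) = C^∞(V) ⊗ ℂ[θ^α]`. -/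
abbrev SuperFun (ι κ : Type) [Fintype κ] := Smooth κ ⊗[ℂ] ExteriorAlgebra ℂ (ι → ℂ)

namespace SuperFun

/-- The odd coordinate `θ^α`. -/
def θ (α : ι) : SuperFun ι κ := 1 ⊗ₜ ExteriorAlgebra.ι ℂ (Pi.single α 1)

/-- The even coordinate `x^μ`. -/
def x (μ : κ) : SuperFun ι κ := Smooth.coord μ ⊗ₜ 1

/-- `∂/∂x^μ`. -/
def dx (μ : κ) : Module.End ℂ (SuperFun ι κ) := (Smooth.partial μ).rTensor _

/-- The odd (left) derivation `∂/∂θ^α`. -/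
def dθ (α : ι) : Module.End ℂ (SuperFun ι κ) :=
  (CliffordAlgebra.contractLeft (Q := (0 : QuadraticForm ℂ (ι → ℂ))) (LinearMap.proj α)).lTensor _

/-- The sign operator `F ↦ (-1)^{|F|} F`. -/
def sign : Module.End ℂ (SuperFun ι κ) :=
  (CliffordAlgebra.involute (Q := (0 : QuadraticForm ℂ (ι → ℂ)))).toLinearMap.lTensor _

/-- The functions of parity `p`. -/
def par (ι κ : Type) [Fintype κ] (p : ZMod 2) : Submodule (Smooth κ) (SuperFun ι κ) :=
  Submodule.span (Smooth κ)
    {F | ∃ w ∈ CliffordAlgebra.evenOdd (0 : QuadraticForm ℂ (ι → ℂ)) p,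
      F = (1 : Smooth κ) ⊗ₜ[ℂ] (w : ExteriorAlgebra ℂ (ι → ℂ))}

end SuperFun

/-- A vector field `X = ∑ X^μ ∂/∂x^μ + ∑ X^α ∂/∂θ^α` on `N`, given by its components. -/
abbrev VField (ι κ : Type) [Fintype κ] := (κ → SuperFun ι κ) × (ι → SuperFun ι κ)

/-- The derivation of `C^∞(N)` given by a vector field. -/
def VField.act : VField ι κ →ₗ[ℂ] Module.End ℂ (SuperFun ι κ) where
  toFun X := ∑ μ, LinearMap.mulLeft ℂ (X.1 μ) ∘ₗ SuperFun.dx μ +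
    ∑ α, LinearMap.mulLeft ℂ (X.2 α) ∘ₗ SuperFun.dθ α
  map_add' X Y := by
    refine LinearMap.ext fun F => ?_
    simp [LinearMap.sum_apply, add_mul, Finset.sum_add_distrib]
    abel
  map_smul' c X := by
    refine LinearMap.ext fun F => ?_
    simp [LinearMap.sum_apply, Finset.smul_sum]

/-- For `σ = 1` this is the left translation field `𝓛(s) = s^α (∂/∂θ^α + f^μ_{αβ} θ^β ∂/∂x^μ)`, for
`σ = -1` the right translation field `𝓡(s) = s^α (∂/∂θ^α - f^μ_{αβ} θ^β ∂/∂x^μ)`. -/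
def oddField (n : TwoStep ι κ) (σ : ℂ) : (ι → ℂ) →ₗ[ℂ] VField ι κ where
  toFun s := (fun μ => ∑ α, ∑ β, (s α * (σ * n.f μ α β)) • SuperFun.θ β,
    fun α => s α • (1 : SuperFun ι κ))
  map_add' s t := by
    ext <;> simp [add_mul, add_smul, Finset.sum_add_distrib]
  map_smul' c s := by
    ext <;> simp [mul_assoc, mul_smul, Finset.smul_sum]

/-- The translation field `𝓛(w) = 𝓡(w) = w^μ ∂/∂x^μ` of `w ∈ 𝔫₂`. -/
def transField (ι : Type) [Fintype ι] [DecidableEq ι] : (κ → ℂ) →ₗ[ℂ] VField ι κ where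
  toFun w := (fun μ => w μ • (1 : SuperFun ι κ), 0)
  map_add' s t := by ext <;> simp [add_smul]
  map_smul' c s := by ext <;> simp [mul_smul]

section Fields

variable {n : TwoStep ι κ} {G : Type*} [LieRing G] [LieAlgebra ℂ G] (r : G →ₗ⁅ℂ⁆ n.aut)

/-- The linear field `-B^μ_ν x^ν ∂/∂x^μ - A^α_β θ^β ∂/∂θ^α` by which `a ∈ 𝔤₀`, acting on `𝔫₁` by
`A` and on `𝔫₂` by `B`, acts on functions on `N`. -/
def linField : G →ₗ[ℂ] VField ι κ where
  toFun a := (fun μ => -∑ ν, entryTwo r μ ν a • SuperFun.x ν,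
    fun α => -∑ β, entryOne r α β a • SuperFun.θ β)
  map_add' a b := by
    ext <;> simp only [map_add, add_smul, Finset.sum_add_distrib, Pi.add_apply, Prod.mk_add_mk] <;>
      abel
  map_smul' c a := by
    ext <;> simp only [map_smul, smul_eq_mul, mul_smul, ← Finset.smul_sum, RingHom.id_apply,
      Prod.smul_fst, Prod.smul_snd, Pi.smul_apply, smul_neg]

/-- The even vector field on `N` by which the even part of `x ∈ 𝔤` acts. -/
def evenLeft : SP G ι κ →ₗ[ℂ] VField ι κ :=
  linField r ∘ₗ LinearMap.fst ℂ _ _ +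
    transField ι ∘ₗ LinearMap.snd ℂ _ _ ∘ₗ LinearMap.snd ℂ _ _

/-- The odd vector field on `N` by which the odd part of `x ∈ 𝔤` acts. -/
def oddLeft (n : TwoStep ι κ) (G : Type*) [LieRing G] [LieAlgebra ℂ G] :
    SP G ι κ →ₗ[ℂ] VField ι κ :=
  oddField n 1 ∘ₗ LinearMap.fst ℂ _ _ ∘ₗ LinearMap.snd ℂ _ _

end Fields

/-! ## The Chevalley–Eilenberg algebra and its modules -/

/-- The graded commutative algebra `C^•(𝔫) = ℂ[λ^α] ⊗ ∧(v^μ)`. -/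
abbrev CE (ι κ : Type) := MvPolynomial ι ℂ ⊗[ℂ] ExteriorAlgebra ℂ (κ → ℂ)

namespace CE

/-- The generator `λ^α` (cohomological degree one, odd intrinsic parity). -/
def lam (α : ι) : CE ι κ := MvPolynomial.X α ⊗ₜ 1

/-- The generator `v^μ` (cohomological degree one, even intrinsic parity). -/
def v (μ : κ) : CE ι κ := 1 ⊗ₜ ExteriorAlgebra.ι ℂ (Pi.single μ 1)

/-- `∂/∂λ^α`. -/
def dlam (α : ι) : Module.End ℂ (CE ι κ) := (MvPolynomial.pderiv α).toLinearMap.rTensor _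

/-- `∂/∂v^μ`. -/
def dv (μ : κ) : Module.End ℂ (CE ι κ) :=
  (CliffordAlgebra.contractLeft (Q := (0 : QuadraticForm ℂ (κ → ℂ))) (LinearMap.proj μ)).lTensor _

/-- The sign operator given by the total parity. -/
def sign : Module.End ℂ (CE ι κ) :=
  (CliffordAlgebra.involute (Q := (0 : QuadraticForm ℂ (κ → ℂ)))).toLinearMap.lTensor _

/-- The Chevalley–Eilenberg differential `λ^α f^μ_{αβ} λ^β ∂/∂v^μ`. -/
def d (n : TwoStep ι κ) : Module.End ℂ (CE ι κ) :=
  ∑ μ, LinearMap.mulLeft ℂ (∑ α, ∑ β, n.f μ α β • (lam α * lam β)) ∘ₗ dv μ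

/-- The part of cohomological degree `k` and parity `p`. -/
def gr (ι κ : Type) (k : ℤ) (p : ZMod 2) : Submodule ℂ (CE ι κ) :=
  Submodule.span ℂ {c | ∃ i j : ℕ, (i : ℤ) + j = k ∧ (i : ZMod 2) = p ∧
    ∃ P ∈ MvPolynomial.homogeneousSubmodule ι ℂ i, ∃ w ∈ ⋀[ℂ]^j (κ → ℂ), c = P ⊗ₜ[ℂ] w}

/-- The coadjoint action of `𝔤₀` by derivations. -/
def rep {n : TwoStep ι κ} {G : Type*} [LieRing G] [LieAlgebra ℂ G] (r : G →ₗ⁅ℂ⁆ n.aut) :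
    G →ₗ[ℂ] Module.End ℂ (CE ι κ) where
  toFun a := -(∑ α, ∑ β, entryOne r α β a • (LinearMap.mulLeft ℂ (lam β) ∘ₗ dlam α)) -
    ∑ μ, ∑ ν, entryTwo r μ ν a • (LinearMap.mulLeft ℂ (v ν) ∘ₗ dv μ)
  map_add' a b := by
    simp only [map_add, add_smul, Finset.sum_add_distrib]
    abel
  map_smul' c a := by
    simp only [map_smul, smul_eq_mul, mul_smul, ← Finset.smul_sum, RingHom.id_apply]
    refine LinearMap.ext fun F => ?_
    simp only [LinearMap.sub_apply, LinearMap.neg_apply, LinearMap.smul_apply, smul_sub, smul_neg]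

end CE

/-- The data of a `𝔤₀`-equivariant dgs module over `C^•(𝔫)`; the laws are in `IsCEModule`. -/
structure CEModuleData (G : Type*) [LieRing G] [LieAlgebra ℂ G] (ι κ : Type) where
  carrier : Type*
  [grp : AddCommGroup carrier]
  [modC : Module ℂ carrier]
  gr : ℤ → ZMod 2 → Submodule ℂ carrier
  d : Module.End ℂ carrier
  act : CE ι κ →ₐ[ℂ] Module.End ℂ carrier
  rep : G →ₗ[ℂ] Module.End ℂ carrier

attribute [instance] CEModuleData.grp CEModuleData.modC

section Functor

variable {n : TwoStep ι κ} {G : Type*} [LieRing G] [LieAlgebra ℂ G] (r : G →ₗ⁅ℂ⁆ n.aut)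

/-- The laws of a `𝔤₀`-equivariant dgs module over `C^•(𝔫)`. -/
structure IsCEModule (Γ : CEModuleData G ι κ) : Prop where
  internal : DirectSum.IsInternal fun k : ℤ × ZMod 2 => Γ.gr k.1 k.2
  finite : ∀ k p, FiniteDimensional ℂ (Γ.gr k p)
  d_degree : ∀ k p, ∀ γ ∈ Γ.gr k p, Γ.d γ ∈ Γ.gr (k + 1) p
  d_square : Γ.d * Γ.d = 0
  act_degree : ∀ k p k' p', ∀ c ∈ CE.gr ι κ k p, ∀ γ ∈ Γ.gr k' p',
    Γ.act c γ ∈ Γ.gr (k + k') (p + p')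
  act_d : ∀ c, Γ.act (CE.d n c) = Γ.d * Γ.act c - Γ.act (CE.sign c) * Γ.d
  rep_degree : ∀ a k p, ∀ γ ∈ Γ.gr k p, Γ.rep a γ ∈ Γ.gr k p
  rep_bracket : ∀ a b, Γ.rep ⁅a, b⁆ = Γ.rep a * Γ.rep b - Γ.rep b * Γ.rep a
  rep_d : ∀ a, Γ.d * Γ.rep a = Γ.rep a * Γ.d
  rep_act : ∀ a c, Γ.rep a * Γ.act c = Γ.act (CE.rep r a c) + Γ.act c * Γ.rep a

/-- `C^•(𝔫)` as a module over itself. -/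
def ceSelf : CEModuleData G ι κ where
  carrier := CE ι κ
  gr := CE.gr ι κ
  d := CE.d n
  act := Algebra.lmul ℂ (CE ι κ)
  rep := CE.rep r

/-- The differential `𝓓 = λ^α 𝓡(d_α) + v^μ 𝓡(e_μ) + d_Γ` on `C^∞(N) ⊗ Γ`. The sign operators are
the Koszul signs of moving the odd operators `v^μ` and `d_Γ` past functions on `N`. -/
def pureSpinorD (n : TwoStep ι κ) (Γ : CEModuleData G ι κ) :
    Module.End ℂ (SuperFun ι κ ⊗[ℂ] Γ.carrier) :=
  ∑ α, TensorProduct.map (VField.act (oddField n (-1) (Pi.single α 1))) (Γ.act (CE.lam α)) +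
    ∑ μ, TensorProduct.map (SuperFun.sign * VField.act (transField ι (Pi.single μ 1)))
      (Γ.act (CE.v μ)) +
    TensorProduct.map SuperFun.sign Γ.d

/-- The pure spinor functor on objects: `A^•(Γ) = (C^∞(N) ⊗ Γ, 𝓓)`, with `𝔫` acting by left
translations on `C^∞(N)` and `𝔤₀` acting on both factors. -/
def pureSpinor (Γ : CEModuleData G ι κ) : LocalModuleData G ι κ where
  carrier := SuperFun ι κ ⊗[ℂ] Γ.carrier
  gr k p := Submodule.span (Smooth κ) {z | ∃ q q' : ZMod 2, q + q' = p ∧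
    ∃ F ∈ SuperFun.par ι κ q, ∃ γ ∈ Γ.gr k q', z = F ⊗ₜ[ℂ] γ}
  const := Submodule.span ℂ {z | ∃ (w : ExteriorAlgebra ℂ (ι → ℂ)) (γ : Γ.carrier),
    z = ((1 : Smooth κ) ⊗ₜ[ℂ] w) ⊗ₜ[ℂ] γ}
  D := pureSpinorD n Γ
  ρ := LinearMap.rTensorHom Γ.carrier ∘ₗ VField.act ∘ₗ (evenLeft r + oddLeft n G) +
    LinearMap.lTensorHom (SuperFun ι κ) ∘ₗ Γ.rep ∘ₗ LinearMap.fst ℂ _ _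

end Functor

/-! ## The de Rham complex of `N` -/

/-- The even part `C^∞(V)[dθ^α]` (with respect to total parity) of the generators of `Ω^•(N)`. -/
def EvenForms (ι κ : Type) [Fintype κ] : Type := Smooth κ ⊗[ℂ] MvPolynomial ι ℂ

instance (ι κ : Type) [Fintype κ] : CommRing (EvenForms ι κ) :=
  inferInstanceAs (CommRing (Smooth κ ⊗[ℂ] MvPolynomial ι ℂ))

instance (ι κ : Type) [Fintype κ] : Algebra ℂ (EvenForms ι κ) :=
  inferInstanceAs (Algebra ℂ (Smooth κ ⊗[ℂ] MvPolynomial ι ℂ))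

instance (ι κ : Type) [Fintype κ] : Algebra (Smooth κ) (EvenForms ι κ) :=
  inferInstanceAs (Algebra (Smooth κ) (Smooth κ ⊗[ℂ] MvPolynomial ι ℂ))

instance (ι κ : Type) [Fintype κ] : IsScalarTower ℂ (Smooth κ) (EvenForms ι κ) :=
  inferInstanceAs (IsScalarTower ℂ (Smooth κ) (Smooth κ ⊗[ℂ] MvPolynomial ι ℂ))

namespace EvenForms

/-- The inclusion of `C^∞(V)`. -/
def inclSmooth : Smooth κ →ₐ[ℂ] EvenForms ι κ :=
  (Algebra.TensorProduct.includeLeft : Smooth κ →ₐ[ℂ] Smooth κ ⊗[ℂ] MvPolynomial ι ℂ)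

/-- The inclusion of the polynomials in the `dθ^α`. -/
def inclPoly : MvPolynomial ι ℂ →ₐ[ℂ] EvenForms ι κ :=
  (Algebra.TensorProduct.includeRight : MvPolynomial ι ℂ →ₐ[ℂ] Smooth κ ⊗[ℂ] MvPolynomial ι ℂ)

/-- The tensor product of two linear maps. -/
def map {ι' κ' : Type} [Fintype κ'] (S : Smooth κ →ₗ[ℂ] Smooth κ')
    (T : MvPolynomial ι ℂ →ₗ[ℂ] MvPolynomial ι' ℂ) : EvenForms ι κ →ₗ[ℂ] EvenForms ι' κ' :=
  TensorProduct.map S T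

/-- The tensor product of two homomorphisms of algebras. -/
def mapAlg {ι' κ' : Type} [Fintype κ'] (S : Smooth κ →ₐ[ℂ] Smooth κ')
    (T : MvPolynomial ι ℂ →ₐ[ℂ] MvPolynomial ι' ℂ) : EvenForms ι κ →ₐ[ℂ] EvenForms ι' κ' :=
  (Algebra.TensorProduct.map S T :
    Smooth κ ⊗[ℂ] MvPolynomial ι ℂ →ₐ[ℂ] Smooth κ' ⊗[ℂ] MvPolynomial ι' ℂ)

end EvenForms

/-- The algebra of differential forms on `N`, freely generated over `C^∞(N)` by the (total parity
even) `dθ^α` and the (total parity odd) `dx^μ`: the tensor product of the even part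
`C^∞(V)[dθ^α]` with the exterior algebra on all the odd generators `θ^α`, `dx^μ`. -/
abbrev Forms (ι κ : Type) [Fintype κ] :=
  EvenForms ι κ ⊗[ℂ] ExteriorAlgebra ℂ ((ι → ℂ) × (κ → ℂ))

namespace Forms

/-- Functions as differential forms of degree zero. -/
def ofFun : SuperFun ι κ →ₐ[ℂ] Forms ι κ :=
  Algebra.TensorProduct.map EvenForms.inclSmooth
    (ExteriorAlgebra.map (LinearMap.inl ℂ (ι → ℂ) (κ → ℂ)))

/-- Polynomials in the `dθ^α`. -/
def ofPoly : MvPolynomial ι ℂ →ₐ[ℂ] Forms ι κ :=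
  Algebra.TensorProduct.includeLeft.comp EvenForms.inclPoly

/-- Exterior polynomials in the `dx^μ`. -/
def ofExt : ExteriorAlgebra ℂ (κ → ℂ) →ₐ[ℂ] Forms ι κ :=
  Algebra.TensorProduct.includeRight.comp
    (ExteriorAlgebra.map (LinearMap.inr ℂ (ι → ℂ) (κ → ℂ)))

/-- The one-form `dθ^α`. -/
def dθ (α : ι) : Forms ι κ := ofPoly (MvPolynomial.X α)

/-- The one-form `dx^μ`. -/
def dx (μ : κ) : Forms ι κ := ofExt (ExteriorAlgebra.ι ℂ (Pi.single μ 1))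

/-- The derivation `∂/∂x^μ` (vanishing on all other generators). -/
def partialX (μ : κ) : Module.End ℂ (Forms ι κ) := (EvenForms.map (Smooth.partial μ) .id).rTensor _

/-- The odd derivation `∂/∂θ^α` (vanishing on all other generators). -/
def partialθ (α : ι) : Module.End ℂ (Forms ι κ) :=
  (CliffordAlgebra.contractLeft (Q := (0 : QuadraticForm ℂ ((ι → ℂ) × (κ → ℂ))))
    (LinearMap.proj α ∘ₗ LinearMap.fst ℂ _ _)).lTensor _

/-- The derivation `∂/∂(dθ^α)` (vanishing on all other generators). -/
def partialDθ (α : ι) : Module.End ℂ (Forms ι κ) :=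
  (EvenForms.map .id (MvPolynomial.pderiv α).toLinearMap).rTensor _

/-- The odd derivation `∂/∂(dx^μ)` (vanishing on all other generators). -/
def partialDx (μ : κ) : Module.End ℂ (Forms ι κ) :=
  (CliffordAlgebra.contractLeft (Q := (0 : QuadraticForm ℂ ((ι → ℂ) × (κ → ℂ))))
    (LinearMap.proj μ ∘ₗ LinearMap.snd ℂ _ _)).lTensor _

/-- The de Rham differential `dθ^α ∂/∂θ^α + dx^μ ∂/∂x^μ`. -/
def d : Module.End ℂ (Forms ι κ) :=
  ∑ α, LinearMap.mulLeft ℂ (dθ α) ∘ₗ partialθ α + ∑ μ, LinearMap.mulLeft ℂ (dx μ) ∘ₗ partialX μ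

/-- The Lie derivative along a homogeneous vector field `X` with `σ = (-1)^{|X|}`: the derivation
of the same parity as `X` that extends `X` and satisfies `L_X d = (-1)^{|X|} d L_X`, i.e.
`L_X (dz) = (-1)^{|X|} d(X z)` for each coordinate `z`. -/
def lieDeriv (σ : ℂ) : VField ι κ →ₗ[ℂ] Module.End ℂ (Forms ι κ) where
  toFun X :=
    ∑ μ, (LinearMap.mulLeft ℂ (ofFun (X.1 μ)) ∘ₗ partialX μ +
      σ • LinearMap.mulLeft ℂ (d (ofFun (X.1 μ))) ∘ₗ partialDx μ) +
    ∑ α, (LinearMap.mulLeft ℂ (ofFun (X.2 α)) ∘ₗ partialθ α +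
      σ • LinearMap.mulLeft ℂ (d (ofFun (X.2 α))) ∘ₗ partialDθ α)
  map_add' X Y := by
    refine LinearMap.ext fun F => ?_
    simp only [Prod.fst_add, Prod.snd_add, Pi.add_apply, map_add, LinearMap.add_apply,
      LinearMap.sum_apply, LinearMap.smul_apply, LinearMap.comp_apply, LinearMap.mulLeft_apply,
      add_mul, smul_add, Finset.sum_add_distrib]
    abel
  map_smul' c X := by
    refine LinearMap.ext fun F => ?_
    simp only [Prod.smul_fst, Prod.smul_snd, Pi.smul_apply, map_smul, LinearMap.add_apply,
      LinearMap.sum_apply, LinearMap.smul_apply, LinearMap.comp_apply, LinearMap.mulLeft_apply,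
      smul_mul_assoc, smul_add, Finset.smul_sum, RingHom.id_apply, smul_comm σ c]

/-- The forms of degree `k` and parity `p`. -/
def gr (ι κ : Type) [Fintype κ] (k : ℤ) (p : ZMod 2) : Submodule (Smooth κ) (Forms ι κ) :=
  Submodule.span (Smooth κ) {z | ∃ (i j : ℕ) (q : ZMod 2), (i : ℤ) + j = k ∧ q + i = p ∧
    ∃ F ∈ SuperFun.par ι κ q, ∃ P ∈ MvPolynomial.homogeneousSubmodule ι ℂ i,
    ∃ w ∈ ⋀[ℂ]^j (κ → ℂ), z = ofFun F * ofPoly P * ofExt w}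

end Forms

/-- The de Rham complex `Ω^•(N)`, on which `𝔤` acts by Lie derivatives along the vector fields by
which it acts on `N`; in particular `𝔫` acts through left translations. -/
def deRham {n : TwoStep ι κ} {G : Type*} [LieRing G] [LieAlgebra ℂ G] (r : G →ₗ⁅ℂ⁆ n.aut) :
    LocalModuleData G ι κ where
  carrier := Forms ι κ
  gr := Forms.gr ι κ
  const := Submodule.span ℂ {z | ∃ (P : MvPolynomial ι ℂ)
    (w : ExteriorAlgebra ℂ ((ι → ℂ) × (κ → ℂ))), z = EvenForms.inclPoly P ⊗ₜ[ℂ] w}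
  D := Forms.d
  ρ := Forms.lieDeriv 1 ∘ₗ evenLeft r + Forms.lieDeriv (-1) ∘ₗ oddLeft n G

/-! ## The change of coordinates `v ↦ v + λ f θ` -/

namespace Forms

/-- The one-form `dx^μ + λ f^μ θ = dx^μ + dθ^α f^μ_{αβ} θ^β`. -/
def shifted (n : TwoStep ι κ) (μ : κ) : Forms ι κ :=
  dx μ + ∑ α, ∑ β, n.f μ α β • (dθ α * ofFun (SuperFun.θ β))

/-- The span of the total parity odd generators over the central subalgebra `C^∞(V)[dθ]`. -/
def oddSpan (ι κ : Type) [Fintype κ] :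
    Submodule (EvenForms ι κ) (Forms ι κ) :=
  Submodule.span _ {z | ∃ m, z = 1 ⊗ₜ ExteriorAlgebra.ι ℂ m}

theorem oddSpan_anticomm {ι κ : Type} [Fintype κ] {a b : Forms ι κ} (ha : a ∈ oddSpan ι κ)
    (hb : b ∈ oddSpan ι κ) :
    a * b + b * a = 0 := by
  induction ha, hb using Submodule.span_induction₂ with
  | mem_mem x y hx hy =>
    obtain ⟨m, rfl⟩ := hx
    obtain ⟨m', rfl⟩ := hy
    simp only [Algebra.TensorProduct.tmul_mul_tmul, mul_one, ← TensorProduct.tmul_add,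
      ExteriorAlgebra.ι_add_mul_swap, TensorProduct.tmul_zero]
  | zero_left y _ => simp
  | zero_right x _ => simp
  | add_left x y z _ _ _ h1 h2 =>
    rw [add_mul, mul_add, add_add_add_comm, h1, h2, add_zero]
  | add_right x y z _ _ _ h1 h2 =>
    rw [add_mul, mul_add, add_add_add_comm, h1, h2, add_zero]
  | smul_left c x y _ _ h => rw [smul_mul_assoc, mul_smul_comm, ← smul_add, h, smul_zero]
  | smul_right c x y _ _ h => rw [smul_mul_assoc, mul_smul_comm, ← smul_add, h, smul_zero]

theorem oddSpan_sq {ι κ : Type} [Fintype κ] {a : Forms ι κ} (ha : a ∈ oddSpan ι κ) : a * a = 0 := by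
  have h := oddSpan_anticomm ha ha
  rw [← two_smul ℂ] at h
  exact (smul_eq_zero.mp h).resolve_left two_ne_zero

theorem shifted_mem (n : TwoStep ι κ) (μ : κ) : shifted n μ ∈ oddSpan ι κ := by
  refine Submodule.add_mem _ (Submodule.subset_span ⟨(0, Pi.single μ 1), ?_⟩)
    (Submodule.sum_mem _ fun α _ => Submodule.sum_mem _ fun β _ => ?_)
  · simp [dx, ofExt]
  · refine Submodule.smul_of_tower_mem _ _ ?_
    have h : dθ (κ := κ) α * ofFun (SuperFun.θ β) =
        (EvenForms.inclPoly (MvPolynomial.X α) : EvenForms ι κ) • ((1 : EvenForms ι κ) ⊗ₜ[ℂ]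
          ExteriorAlgebra.ι ℂ ((Pi.single β 1, 0) : (ι → ℂ) × (κ → ℂ))) := by
      simp [dθ, ofPoly, ofFun, SuperFun.θ, TensorProduct.smul_tmul']
    rw [h]
    exact Submodule.smul_mem _ _ (Submodule.subset_span ⟨_, rfl⟩)

theorem ofPoly_commute {ι κ : Type} [Fintype κ] (P : MvPolynomial ι ℂ) (z : Forms ι κ) :
    Commute (ofPoly P) z :=
  Algebra.commutes (EvenForms.inclPoly P : EvenForms ι κ) z

/-- The homomorphism `C^•(𝔫) → Ω^•(N)` of algebras with `λ^α ↦ dθ^α` and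
`v^μ ↦ dx^μ + λ f^μ θ`. -/
def ofCE (n : TwoStep ι κ) : CE ι κ →ₐ[ℂ] Forms ι κ :=
  Algebra.TensorProduct.lift ofPoly
    (ExteriorAlgebra.lift ℂ ⟨Fintype.linearCombination ℂ (shifted n), fun w => oddSpan_sq (by
      rw [Fintype.linearCombination_apply]
      exact Submodule.sum_mem _ fun μ _ =>
        Submodule.smul_of_tower_mem _ _ (shifted_mem n μ))⟩)
    (fun P _ => ofPoly_commute P _)

end Forms

/-- The map `A^•(C^•(𝔫)) = C^∞(N) ⊗ C^•(𝔫) → Ω^•(N)` given in coordinates by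
`(x, λ, θ, v) ↦ (x, λ, θ, v + λ f θ)`, where `λ = dθ` and `v = dx` on the right. -/
def comparison (n : TwoStep ι κ) : SuperFun ι κ ⊗[ℂ] CE ι κ →ₗ[ℂ] Forms ι κ :=
  TensorProduct.lift
    ((LinearMap.mul ℂ (Forms ι κ)).compl₁₂ Forms.ofFun.toLinearMap (Forms.ofCE n).toLinearMap)

/-! ## Functoriality in `𝔫` -/

/-- A homomorphism of two-step nilpotent super Lie algebras (real on the spacetime part). -/
structure TwoStep.Hom {ι κ ι' κ' : Type} [Fintype κ] [DecidableEq κ]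
    (n : TwoStep ι κ) (n' : TwoStep ι' κ') where
  one : (ι → ℂ) →ₗ[ℂ] (ι' → ℂ)
  two : (κ → ℝ) →ₗ[ℝ] (κ' → ℝ)
  map_br : ∀ s t μ, n'.br (one s) (one t) μ =
    ∑ ν, (two (Pi.single ν 1) μ : ℂ) * n.br s t ν

section Pullback

variable {ι' κ' : Type} [Fintype ι'] [DecidableEq ι'] [Fintype κ'] [DecidableEq κ']
  {n : TwoStep ι κ} {n' : TwoStep ι' κ'} (m : n.Hom n')

/-- The dual map on odd linear coordinates: `θ'^α ↦ ∑ β, A^α_β θ^β`. -/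
def TwoStep.Hom.dualOne : (ι' → ℂ) →ₗ[ℂ] (ι → ℂ) :=
  Fintype.linearCombination ℂ fun α β => m.one (Pi.single β 1) α

/-- The dual map on even linear coordinates: `v'^μ ↦ ∑ ν, B^μ_ν v^ν`. -/
def TwoStep.Hom.dualTwo : (κ' → ℂ) →ₗ[ℂ] (κ → ℂ) :=
  Fintype.linearCombination ℂ fun μ ν => (m.two (Pi.single ν 1) μ : ℂ)

/-- Pullback of smooth functions on spacetime. -/
def TwoStep.Hom.pullSmooth : Smooth κ' →ₐ[ℂ] Smooth κ where
  toFun h := ⟨fun x => h.1 (m.two x),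
    (contDiff_smooth h).comp (LinearMap.toContinuousLinearMap m.two).contDiff⟩
  map_one' := rfl
  map_mul' _ _ := rfl
  map_zero' := rfl
  map_add' _ _ := rfl
  commutes' _ := rfl

/-- The substitution `λ'^α ↦ ∑ β, A^α_β λ^β`. -/
def TwoStep.Hom.pullPoly : MvPolynomial ι' ℂ →ₐ[ℂ] MvPolynomial ι ℂ :=
  MvPolynomial.aeval fun α => ∑ β, m.one (Pi.single β 1) α • MvPolynomial.X β

/-- Pullback of functions along the homomorphism `N → N'`. -/
def TwoStep.Hom.pullFun : SuperFun ι' κ' →ₐ[ℂ] SuperFun ι κ :=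
  Algebra.TensorProduct.map m.pullSmooth (ExteriorAlgebra.map m.dualOne)

/-- Pullback of Lie algebra cochains along `𝔫 → 𝔫'`. -/
def TwoStep.Hom.pullCE : CE ι' κ' →ₐ[ℂ] CE ι κ :=
  Algebra.TensorProduct.map m.pullPoly (ExteriorAlgebra.map m.dualTwo)

/-- Pullback of differential forms along `N → N'`. -/
def TwoStep.Hom.pullForms : Forms ι' κ' →ₐ[ℂ] Forms ι κ :=
  Algebra.TensorProduct.map (EvenForms.mapAlg m.pullSmooth m.pullPoly)
    (ExteriorAlgebra.map (m.dualOne.prodMap m.dualTwo))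

end Pullback

end PureSpinor

/-! The homomorphism `ofCE`, the map ψ of the statement, embeds the Chevalley–Eilenberg algebra into
the forms. The form dx + dθ f θ assigned to v is annihilated by the Lie derivatives along the odd
left translations (`lieAct_ofCE_odd`); its differential is dθ f dθ, which is the Chevalley–Eilenberg
differential of v (`d_ofCE`); and since 𝔤₀ acts by derivations of the bracket, 𝔤₀ acts on it by the
coadjoint action (`lieAct_ofCE_even`). Writing dx = ψ(v) - dθ f θ in the differential of a function
turns dθ ∂_θ + dx ∂_x into λ 𝓡(d) + v ∂_x. With the Leibniz rule, this gives compatibility with the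
differentials and the actions (`comparison_D`, `comparison_ρ`).

Bijectivity: Φ is its version for the zero bracket followed by the automorphism `shear` of the
forms, whose inverse is the shear for the opposite bracket. For the zero bracket, Φ reorders tensor
factors and identifies ∧(M) ⊗ ∧(N) with ∧(M × N).

Operator identities are checked on generators, since twisted derivations that agree on generators
agree. Coordinates do not generate C^∞(V) algebraically, so the operators on forms are also required
to obey the chain rule on functions (`IsGeometric`), a condition stable under supercommutators. If
moreover they supercommute with d (`IsLie`), then their values on x and θ determine them. This
yields d² = 0, [d, L_X] = 0 and the bracket relations of 𝔤, hence the operator laws of Ω(N).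

The remaining algebraic laws are transported. Those of the pure spinor complex are pulled back along
Φ (`IsStrictMultiplet.of_injective`), and d² = 0 and the compatibilities of the 𝔤₀-action on C(𝔫)
along the injective ψ. Gradings are treated as eigenspace decompositions of scaling operators with
eigenvalue 2^k (-1)^p, so a degree statement becomes a commutation relation. Naturality is again a
check on generators, where compatibility with the brackets enters through `f_hom`. -/

namespace PureSpinor

/-! ## Twisted derivations and superderivations -/

section Super

variable {A B C : Type*} [Ring A] [Algebra ℂ A] [Ring B] [Algebra ℂ B] [Ring C] [Algebra ℂ C]

/-- `D (a b) = D a · φ b + ψ a · D b`. -/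
def IsTwistedDer (φ ψ : A →ₐ[ℂ] B) (D : A →ₗ[ℂ] B) : Prop :=
  ∀ a b, D (a * b) = D a * φ b + ψ a * D b

namespace IsTwistedDer

variable {φ ψ : A →ₐ[ℂ] B} {D D' : A →ₗ[ℂ] B}

theorem zero : IsTwistedDer φ ψ 0 := fun a b => by simp

theorem add (h : IsTwistedDer φ ψ D) (h' : IsTwistedDer φ ψ D') : IsTwistedDer φ ψ (D + D') :=
  fun a b => by
    rw [LinearMap.add_apply, h, h', LinearMap.add_apply, LinearMap.add_apply]; noncomm_ring

theorem smul (h : IsTwistedDer φ ψ D) (c : ℂ) : IsTwistedDer φ ψ (c • D) := fun a b => by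
  rw [LinearMap.smul_apply, h, LinearMap.smul_apply, LinearMap.smul_apply, smul_add,
    smul_mul_assoc, mul_smul_comm]

theorem sum {J : Type*} (s : Finset J) {D : J → A →ₗ[ℂ] B} (h : ∀ j, IsTwistedDer φ ψ (D j)) :
    IsTwistedDer φ ψ (∑ j ∈ s, D j) := by
  classical
  induction s using Finset.induction_on with
  | empty => simpa using zero
  | insert j s hj ih => rw [Finset.sum_insert hj]; exact (h j).add ih

theorem comp_left (h : IsTwistedDer φ ψ D) (g : B →ₐ[ℂ] C) :
    IsTwistedDer (g.comp φ) (g.comp ψ) (g.toLinearMap ∘ₗ D) := fun a b => by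
  simp [h a b]

theorem comp_right (h : IsTwistedDer φ ψ D) (g : C →ₐ[ℂ] A) :
    IsTwistedDer (φ.comp g) (ψ.comp g) (D ∘ₗ g.toLinearMap) := fun a b => by
  simp [h (g a) (g b)]

/-- Multiplication by an element that intertwines the two twists. -/
theorem mulLeft {ψ' : A →ₐ[ℂ] B} (h : IsTwistedDer φ ψ D) (c : B)
    (hc : ∀ a, c * ψ a = ψ' a * c) : IsTwistedDer φ ψ' (LinearMap.mulLeft ℂ c ∘ₗ D) := fun a b => by
  simp only [LinearMap.comp_apply, LinearMap.mulLeft_apply, h a b, mul_add, ← mul_assoc, hc]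

theorem map_one (h : IsTwistedDer φ ψ D) : D 1 = 0 := by
  have := h 1 1
  simpa using this

/-- Both maps kill 1, and the twisted Leibniz rule expresses a value on a product through the values
on the factors. Allowing arbitrary twists makes this applicable to composites of derivations with
algebra homomorphisms, such as d ∘ ψ and ψ ∘ d. -/
theorem ext (h : IsTwistedDer φ ψ D) (h' : IsTwistedDer φ ψ D') {s : Set A}
    (hs : Algebra.adjoin ℂ s = ⊤) (H : ∀ a ∈ s, D a = D' a) : D = D' := by
  refine LinearMap.ext fun a => ?_
  have ha : a ∈ Algebra.adjoin ℂ s := hs ▸ Algebra.mem_top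
  induction ha using Algebra.adjoin_induction with
  | mem a ha => exact H a ha
  | algebraMap c => rw [Algebra.algebraMap_eq_smul_one, map_smul, map_smul, h.map_one, h'.map_one]
  | add a b _ _ ha hb => rw [map_add, map_add, ha, hb]
  | mul a b _ _ ha hb => rw [h, h', ha, hb]

end IsTwistedDer

/-- The sign twist of an operator of parity `p`. -/
def signPow (S : A →ₐ[ℂ] A) (p : ZMod 2) : A →ₐ[ℂ] A := if p = 0 then AlgHom.id ℂ A else S

@[simp] theorem signPow_zero (S : A →ₐ[ℂ] A) : signPow S 0 = AlgHom.id ℂ A := rfl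
@[simp] theorem signPow_one (S : A →ₐ[ℂ] A) : signPow S 1 = S := rfl

theorem zmodTwo_cases (p : ZMod 2) : p = 0 ∨ p = 1 := by
  fin_cases p
  · exact Or.inl rfl
  · exact Or.inr rfl

theorem koszul_one_zero : koszul 1 0 = 1 := rfl
theorem koszul_one_one : koszul 1 1 = -1 := rfl
theorem koszul_zero_left (p : ZMod 2) : koszul 0 p = 1 := by simp [koszul]
theorem koszul_zero_right (p : ZMod 2) : koszul p 0 = 1 := by simp [koszul]

theorem koszul_one_mul_self (p : ZMod 2) : koszul 1 p * koszul 1 p = 1 := by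
  rcases zmodTwo_cases p with rfl | rfl <;> simp [koszul]

theorem koszul_one_add (p q : ZMod 2) : koszul 1 (p + q) = koszul 1 p * koszul 1 q := by
  have h : (1 + 1 : ZMod 2) = 0 := rfl
  rcases zmodTwo_cases p with rfl | rfl <;> rcases zmodTwo_cases q with rfl | rfl <;>
    simp [koszul, h]

/-- Derivations of parity `p` of an algebra with sign automorphism `S`. -/
structure IsSuperDer (S : A →ₐ[ℂ] A) (p : ZMod 2) (P : A →ₗ[ℂ] A) : Prop where
  leibniz : IsTwistedDer (AlgHom.id ℂ A) (signPow S p) P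
  sign : ∀ a, S (P a) = koszul 1 p • P (S a)

/-- An algebra with sign automorphism `S` that is supercommutative and generated by `s`. -/
structure IsSuperComm (S : A →ₐ[ℂ] A) (s : Set A) : Prop where
  sq : ∀ a, S (S a) = a
  adjoin : Algebra.adjoin ℂ s = ⊤
  gen : ∀ g ∈ s, (S g = g ∧ ∀ a, g * a = a * g) ∨ (S g = -g ∧ ∀ g' ∈ s, g * g' = S g' * g)

namespace IsSuperComm

variable {S : A →ₐ[ℂ] A} {s : Set A}

/-- As `S` is multiplicative, moving `g` past a product of generators accumulates exactly the sign
of the product. -/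
theorem gen_mul (hS : IsSuperComm S s) {g : A} (hg : ∀ g' ∈ s, g * g' = S g' * g) (a : A) :
    g * a = S a * g := by
  have ha : a ∈ Algebra.adjoin ℂ s := hS.adjoin ▸ Algebra.mem_top
  induction ha using Algebra.adjoin_induction with
  | mem a ha => exact hg a ha
  | algebraMap c => rw [AlgHom.commutes, Algebra.commutes]
  | add a b _ _ ha hb => rw [map_add, mul_add, add_mul, ha, hb]
  | mul a b _ _ ha hb => rw [map_mul, ← mul_assoc, ha, mul_assoc, hb, mul_assoc]

/-- A bootstrap from `gen_mul`: for an odd generator on the right, the known rule with that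
generator on the left is applied to `z`, and the oddness of `z` supplies the sign. -/
theorem odd_mul (hS : IsSuperComm S s) {z : A} (hz : S z = -z) (a : A) : z * a = S a * z := by
  have ha : a ∈ Algebra.adjoin ℂ s := hS.adjoin ▸ Algebra.mem_top
  induction ha using Algebra.adjoin_induction with
  | mem g hg =>
    rcases hS.gen g hg with ⟨h1, h2⟩ | ⟨h1, h2⟩
    · rw [h1, h2]
    · rw [h1, neg_mul, hS.gen_mul h2 z, hz, neg_mul, neg_neg]
  | algebraMap c => rw [AlgHom.commutes, Algebra.commutes]
  | add a b _ _ ha hb => rw [map_add, mul_add, add_mul, ha, hb]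
  | mul a b _ _ ha hb => rw [map_mul, ← mul_assoc, ha, mul_assoc, hb, mul_assoc]

theorem even_mul (hS : IsSuperComm S s) {z : A} (hz : S z = z) (a : A) : z * a = a * z := by
  have ha : a ∈ Algebra.adjoin ℂ s := hS.adjoin ▸ Algebra.mem_top
  induction ha using Algebra.adjoin_induction with
  | mem g hg =>
    rcases hS.gen g hg with ⟨h1, h2⟩ | ⟨h1, h2⟩
    · rw [h2]
    · rw [hS.gen_mul h2 z, hz]
  | algebraMap c => rw [Algebra.commutes]
  | add a b _ _ ha hb => rw [mul_add, add_mul, ha, hb]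
  | mul a b _ _ ha hb => rw [← mul_assoc, ha, mul_assoc, hb, mul_assoc]

theorem hom_mul (hS : IsSuperComm S s) {p : ZMod 2} {z : A} (hz : S z = koszul 1 p • z) (a : A) :
    z * a = signPow S p a * z := by
  rcases zmodTwo_cases p with rfl | rfl
  · exact hS.even_mul (by simpa [koszul] using hz) a
  · exact hS.odd_mul (by simpa [koszul] using hz) a

theorem hom_mul_hom (hS : IsSuperComm S s) {p q : ZMod 2} {z w : A}
    (hz : S z = koszul 1 p • z) (hw : S w = koszul 1 q • w) : z * w = koszul p q • (w * z) := by
  rw [hS.hom_mul hz]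
  rcases zmodTwo_cases p with rfl | rfl
  · simp [koszul]
  · simp [hw]

end IsSuperComm

theorem signPow_hom {S : A →ₐ[ℂ] A} {p q : ZMod 2} {z : A} (hz : S z = koszul 1 q • z) :
    signPow S p z = koszul p q • z := by
  rcases zmodTwo_cases p with rfl | rfl
  · simp [koszul]
  · simpa using hz

namespace IsSuperDer

variable {S : A →ₐ[ℂ] A} {p q : ZMod 2} {P Q : Module.End ℂ A}

/-- The parity of a twisted derivation can be checked on generators. -/
theorem of_gen {s : Set A} (hs : Algebra.adjoin ℂ s = ⊤)
    (h : IsTwistedDer (AlgHom.id ℂ A) (signPow S p) P)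
    (H : ∀ a ∈ s, S (P a) = koszul 1 p • P (S a)) : IsSuperDer S p P := by
  refine ⟨h, fun a => ?_⟩
  have h1 := h.comp_left S
  have h2 := (h.comp_right S).smul (koszul 1 p)
  -- `S` commutes with its own powers, so both sides of the sign rule are derivations with the same
  -- pair of twists and can be compared on generators.
  have hc : S.comp (signPow S p) = (signPow S p).comp S := by
    rcases zmodTwo_cases p with rfl | rfl <;> rfl
  rw [hc] at h1
  exact LinearMap.congr_fun (h1.ext h2 hs H) a

theorem add (hP : IsSuperDer S p P) (hQ : IsSuperDer S p Q) : IsSuperDer S p (P + Q) :=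
  ⟨hP.leibniz.add hQ.leibniz, fun a => by simp [hP.sign, hQ.sign]⟩

theorem smul (hP : IsSuperDer S p P) (c : ℂ) : IsSuperDer S p (c • P) :=
  ⟨hP.leibniz.smul c, fun a => by simp [hP.sign, smul_comm c]⟩

theorem zero : IsSuperDer S p (0 : Module.End ℂ A) := ⟨.zero, fun a => by simp⟩

theorem sum {J : Type*} (s : Finset J) {D : J → Module.End ℂ A} (h : ∀ j, IsSuperDer S p (D j)) :
    IsSuperDer S p (∑ j ∈ s, D j) :=
  ⟨.sum s fun j => (h j).leibniz, fun a => by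
    simp [LinearMap.sum_apply, (h _).sign, Finset.smul_sum]⟩

/-- The product of a superderivation with a homogeneous element of a supercommutative algebra. -/
theorem mulLeft {s : Set A} (hS : IsSuperComm S s) (hP : IsSuperDer S p P) {c : A}
    (hc : S c = koszul 1 q • c) : IsSuperDer S (q + p) (LinearMap.mulLeft ℂ c ∘ₗ P) := by
  refine ⟨hP.leibniz.mulLeft c fun a => ?_, fun a => ?_⟩
  · rw [hS.hom_mul hc]
    congr 1
    -- The twists compose as `S`^q `S`^p = `S`^(q+p); only p = q = 1 needs that `S` is an
    -- involution.
    rcases zmodTwo_cases p with rfl | rfl <;> rcases zmodTwo_cases q with rfl | rfl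
    · rfl
    · rfl
    · rfl
    · exact hS.sq a
  · simp only [LinearMap.comp_apply, LinearMap.mulLeft_apply, map_mul, hP.sign, hc, koszul_one_add,
      smul_mul_smul_comm]

/-- The supercommutator of superderivations is a superderivation. -/
theorem bracket (hS : ∀ a, S (S a) = a) (hP : IsSuperDer S p P) (hQ : IsSuperDer S q Q) :
    IsSuperDer S (p + q) (P * Q - koszul p q • (Q * P)) := by
  refine ⟨fun a b => ?_, fun a => ?_⟩
  · have hP1 := hP.leibniz
    have hQ1 := hQ.leibniz
    have hP2 := hP.sign
    have hQ2 := hQ.sign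
    -- In each parity case the sign rules move `S` past `P` and `Q`, after which the mixed terms P a
    -- · Q b and Q a · P b cancel between the two compositions.
    rcases zmodTwo_cases p with rfl | rfl <;> rcases zmodTwo_cases q with rfl | rfl
    · simp only [IsTwistedDer, signPow_zero, AlgHom.id_apply] at hP1 hQ1
      simp [koszul, hP1, hQ1, mul_sub, sub_mul]
      abel
    · simp only [IsTwistedDer, signPow_zero, signPow_one, AlgHom.id_apply, koszul_one_zero,
        one_smul] at hP1 hQ1 hP2
      simp [koszul, hP1, hQ1, mul_sub, sub_mul, ← hP2]
      abel
    · simp only [IsTwistedDer, signPow_zero, signPow_one, AlgHom.id_apply, koszul_one_zero,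
        one_smul] at hP1 hQ1 hQ2
      simp [koszul, hP1, hQ1, mul_sub, sub_mul, ← hQ2]
      abel
    · have h11 : (1 + 1 : ZMod 2) = 0 := rfl
      simp only [IsTwistedDer, signPow_one, AlgHom.id_apply, koszul_one_one] at hP1 hQ1 hP2 hQ2
      simp [koszul, h11, hP1, hQ1, mul_add, add_mul, hP2, hQ2, hS]
      abel
  · simp only [LinearMap.sub_apply, Module.End.mul_apply, LinearMap.smul_apply, map_sub, map_smul,
      hP.sign, hQ.sign, koszul_one_add, smul_sub, smul_smul]
    congr 2; ring

theorem ext {s : Set A} (hs : Algebra.adjoin ℂ s = ⊤) (hP : IsSuperDer S p P)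
    (hQ : IsSuperDer S p Q) (H : ∀ a ∈ s, P a = Q a) : P = Q :=
  hP.leibniz.ext hQ.leibniz hs H

end IsSuperDer

end Super
end PureSpinor

namespace PureSpinor
set_option linter.unusedSectionVars false
variable {ι κ : Type} [Fintype ι] [DecidableEq ι] [Fintype κ] [DecidableEq κ]

/-! ## Derivations of tensor products -/

theorem isTwistedDer_lTensor {E L : Type*} [CommRing E] [Algebra ℂ E] [Ring L] [Algebra ℂ L]
    {ψ : L →ₐ[ℂ] L} {D : Module.End ℂ L} (h : IsTwistedDer (AlgHom.id ℂ L) ψ D) :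
    IsTwistedDer (AlgHom.id ℂ (E ⊗[ℂ] L)) (Algebra.TensorProduct.map (AlgHom.id ℂ E) ψ)
      (D.lTensor E) := by
  intro a b
  induction a using TensorProduct.induction_on with
  | zero => simp
  | add a a' ha ha' => simp only [add_mul, map_add, ha, ha']; abel
  | tmul e l =>
    induction b using TensorProduct.induction_on with
    | zero => simp
    | add b b' hb hb' => simp only [mul_add, map_add, hb, hb']; abel
    | tmul e' l' => simp [h l l', TensorProduct.tmul_add]

theorem isTwistedDer_rTensor {E L : Type*} [CommRing E] [Algebra ℂ E] [Ring L] [Algebra ℂ L]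
    {D : Module.End ℂ E} (h : ∀ a b, D (a * b) = D a * b + a * D b) :
    IsTwistedDer (AlgHom.id ℂ (E ⊗[ℂ] L)) (AlgHom.id ℂ (E ⊗[ℂ] L)) (D.rTensor L) := by
  intro a b
  induction a using TensorProduct.induction_on with
  | zero => simp
  | add a a' ha ha' => simp only [add_mul, map_add, ha, ha']; abel
  | tmul e l =>
    induction b using TensorProduct.induction_on with
    | zero => simp
    | add b b' hb hb' => simp only [mul_add, map_add, hb, hb']; abel
    | tmul e' l' => simp [h e e', TensorProduct.add_tmul]

theorem adjoin_range_exteriorι {M : Type*} [AddCommGroup M] [Module ℂ M] :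
    Algebra.adjoin ℂ (Set.range (ExteriorAlgebra.ι ℂ : M → ExteriorAlgebra ℂ M)) = ⊤ :=
  CliffordAlgebra.adjoin_range_ι

/-- Contractions are odd derivations. -/
theorem isTwistedDer_contractLeft {M : Type*} [AddCommGroup M] [Module ℂ M] (l : Module.Dual ℂ M) :
    IsTwistedDer (AlgHom.id ℂ (ExteriorAlgebra ℂ M))
      (CliffordAlgebra.involute (Q := (0 : QuadraticForm ℂ M)))
      (CliffordAlgebra.contractLeft (Q := (0 : QuadraticForm ℂ M)) l) := by
  intro a b
  induction a using CliffordAlgebra.left_induction with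
  | algebraMap r =>
    rw [AlgHom.commutes, CliffordAlgebra.contractLeft_algebraMap_mul,
      CliffordAlgebra.contractLeft_algebraMap, zero_mul, zero_add]
  | add x y hx hy => simp only [add_mul, map_add, hx, hy]; abel
  | ι_mul x m hx =>
    rw [mul_assoc, CliffordAlgebra.contractLeft_ι_mul, hx, CliffordAlgebra.contractLeft_ι_mul,
      map_mul, CliffordAlgebra.involute_ι]
    simp only [AlgHom.id_apply, mul_add, sub_mul, neg_mul, smul_mul_assoc, mul_assoc]
    abel

/-! ## Smooth functions -/

namespace Smooth

theorem partial_apply (μ : κ) (h : Smooth κ) (x : κ → ℝ) :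
    (Smooth.partial μ h).1 x = fderiv ℝ h.1 x (Pi.single μ 1) := rfl

theorem partial_mul (μ : κ) (a b : Smooth κ) :
    Smooth.partial μ (a * b) = Smooth.partial μ a * b + a * Smooth.partial μ b := by
  refine Subtype.ext (funext fun x => ?_)
  have ha : DifferentiableAt ℝ a.1 x := ((contDiff_smooth a).differentiable (by simp)) x
  have hb : DifferentiableAt ℝ b.1 x := ((contDiff_smooth b).differentiable (by simp)) x
  change fderiv ℝ (a.1 * b.1) x _ =
    fderiv ℝ a.1 x (Pi.single μ 1) * b.1 x + a.1 x * fderiv ℝ b.1 x (Pi.single μ 1)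
  rw [fderiv_mul ha hb]
  simp [mul_comm, add_comm]

/-- Symmetry of the second derivative. It is what cancels the second-order terms in supercommutators
of vector fields. -/
theorem partial_comm (μ ν : κ) (h : Smooth κ) :
    Smooth.partial μ (Smooth.partial ν h) = Smooth.partial ν (Smooth.partial μ h) := by
  refine Subtype.ext (funext fun x => ?_)
  have hd : ∀ y, DifferentiableAt ℝ (fderiv ℝ h.1) y := fun y =>
    (((contDiff_smooth h).fderiv_right (m := ∞) (by simp)).differentiable (by simp)) y
  have key : ∀ v w : κ → ℝ, fderiv ℝ (fun y => fderiv ℝ h.1 y v) x w =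
      fderiv ℝ (fderiv ℝ h.1) x w v := fun v w => by
    rw [fderiv_clm_apply (hd x) (differentiableAt_const v)]
    simp
  change fderiv ℝ (fun y => fderiv ℝ h.1 y (Pi.single ν 1)) x (Pi.single μ 1) =
    fderiv ℝ (fun y => fderiv ℝ h.1 y (Pi.single μ 1)) x (Pi.single ν 1)
  rw [key, key]
  have hs : IsSymmSndFDerivAt ℝ h.1 x :=
    ((contDiff_smooth h).contDiffAt).isSymmSndFDerivAt 
      (by simpa using WithTop.coe_le_coe.2 (le_top : (2 : ℕ∞) ≤ ⊤))
  exact hs _ _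

theorem partial_coord (μ ν : κ) : Smooth.partial μ (coord ν) = if μ = ν then 1 else 0 := by
  refine Subtype.ext (funext fun x => ?_)
  have h : HasFDerivAt (coord ν).1
      (Complex.ofRealCLM.comp (ContinuousLinearMap.proj (R := ℝ) (φ := fun _ => ℝ) ν)) x :=
    (Complex.ofRealCLM.comp
      (ContinuousLinearMap.proj (R := ℝ) (φ := fun _ : κ => ℝ) ν)).hasFDerivAt
  rw [partial_apply, h.fderiv]
  by_cases hμ : μ = ν
  · subst hμ; simp; rfl
  · simp [hμ, Ne.symm hμ]; rfl

theorem partial_algebraMap (μ : κ) (c : ℂ) : Smooth.partial μ (algebraMap ℂ (Smooth κ) c) = 0 := by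
  have h : Smooth.partial μ (1 : Smooth κ) = 0 := by
    have := partial_mul μ (1 : Smooth κ) 1
    simpa using this
  rw [Algebra.algebraMap_eq_smul_one, map_smul, h, smul_zero]

end Smooth

/-! ## Generators of the algebra of forms -/

namespace Forms

/-- Smooth functions on spacetime as forms. -/
def ofSmooth : Smooth κ →ₐ[ℂ] Forms ι κ :=
  Algebra.TensorProduct.includeLeft.comp EvenForms.inclSmooth

/-- Linear combinations of the odd generators `θ^α`, `dx^μ`. -/
def odd : (ι → ℂ) × (κ → ℂ) →ₗ[ℂ] Forms ι κ :=
  (Algebra.TensorProduct.includeRight : _ →ₐ[ℂ] Forms ι κ).toLinearMap ∘ₗ ExteriorAlgebra.ι ℂ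

theorem odd_apply (m : (ι → ℂ) × (κ → ℂ)) :
    odd m = (1 : EvenForms ι κ) ⊗ₜ[ℂ] ExteriorAlgebra.ι ℂ m := rfl

end Forms
end PureSpinor

namespace PureSpinor
set_option linter.unusedSectionVars false
variable {ι κ : Type} [Fintype ι] [DecidableEq ι] [Fintype κ] [DecidableEq κ]

/-- `EvenForms` is a plain definition rather than an abbreviation, so its pure tensors are handled
as products of the two inclusions; this identity underlies the induction principle that follows. -/
theorem EvenForms.inclSmooth_mul_inclPoly (h : Smooth κ) (P : MvPolynomial ι ℂ) :
    inclSmooth h * inclPoly P = (h ⊗ₜ[ℂ] P : Smooth κ ⊗[ℂ] MvPolynomial ι ℂ) := by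
  refine (Algebra.TensorProduct.tmul_mul_tmul h 1 1 P).trans ?_
  rw [mul_one, one_mul]

theorem EvenForms.induction_on {p : EvenForms ι κ → Prop} (e : EvenForms ι κ) (zero : p 0)
    (add : ∀ a b, p a → p b → p (a + b))
    (mul : ∀ h P, p (inclSmooth h * inclPoly P)) : p e :=
  TensorProduct.induction_on (motive := p) e zero
    (fun h P => inclSmooth_mul_inclPoly h P ▸ mul h P) add

namespace Forms

theorem ofSmooth_apply (h : Smooth κ) :
    (ofSmooth h : Forms ι κ) = EvenForms.inclSmooth h ⊗ₜ 1 := rfl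

theorem dθ_apply (α : ι) :
    (dθ α : Forms ι κ) = EvenForms.inclPoly (MvPolynomial.X α) ⊗ₜ 1 := rfl

theorem ofPoly_apply (P : MvPolynomial ι ℂ) :
    (ofPoly P : Forms ι κ) = EvenForms.inclPoly P ⊗ₜ 1 := rfl

theorem ofFun_tmul (h : Smooth κ) (w : ExteriorAlgebra ℂ (ι → ℂ)) :
    (ofFun (h ⊗ₜ w) : Forms ι κ) =
      EvenForms.inclSmooth h ⊗ₜ ExteriorAlgebra.map (LinearMap.inl ℂ (ι → ℂ) (κ → ℂ)) w := rfl

theorem ofExt_apply (w : ExteriorAlgebra ℂ (κ → ℂ)) :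
    (ofExt w : Forms ι κ) = 1 ⊗ₜ ExteriorAlgebra.map (LinearMap.inr ℂ (ι → ℂ) (κ → ℂ)) w := rfl

theorem ofFun_θ (α : ι) : (ofFun (SuperFun.θ α) : Forms ι κ) = odd (Pi.single α 1, 0) := by
  rw [SuperFun.θ, ofFun_tmul, map_one, ExteriorAlgebra.map_apply_ι]; rfl

theorem ofFun_x (μ : κ) : (ofFun (SuperFun.x μ) : Forms ι κ) = ofSmooth (Smooth.coord μ) := by
  rw [SuperFun.x, ofFun_tmul, map_one]; rfl

theorem dx_eq (μ : κ) : (dx μ : Forms ι κ) = odd (0, Pi.single μ 1) := by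
  rw [dx, ofExt_apply, ExteriorAlgebra.map_apply_ι]; rfl

theorem odd_eq_sum (m : (ι → ℂ) × (κ → ℂ)) : (odd m : Forms ι κ) =
    ∑ α, m.1 α • ofFun (SuperFun.θ α) + ∑ μ, m.2 μ • dx μ := by
  have h : m = ∑ α, m.1 α • ((Pi.single α 1, 0) : (ι → ℂ) × (κ → ℂ)) +
      ∑ μ, m.2 μ • ((0, Pi.single μ 1) : (ι → ℂ) × (κ → ℂ)) := by
    refine Prod.ext ?_ ?_
    · ext β; simp [Prod.fst_sum, Finset.sum_apply, Pi.single_apply]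
    · ext β; simp [Prod.snd_sum, Finset.sum_apply, Pi.single_apply]
  conv_lhs => rw [h]
  simp only [map_add, map_sum, map_smul, ofFun_θ, dx_eq]

/-- The algebra generators of the forms. -/
def gens (ι κ : Type) [Fintype ι] [DecidableEq ι] [Fintype κ] [DecidableEq κ] :
    Set (Forms ι κ) :=
  Set.range ofSmooth ∪ Set.range dθ ∪ Set.range (fun α => ofFun (SuperFun.θ α)) ∪ Set.range dx

theorem ofSmooth_mem_gens (h : Smooth κ) : ofSmooth h ∈ gens ι κ :=
  Or.inl (Or.inl (Or.inl ⟨h, rfl⟩))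

theorem forall_gens {p : Forms ι κ → Prop} (h1 : ∀ h, p (ofSmooth h)) (h2 : ∀ α, p (dθ α))
    (h3 : ∀ α, p (ofFun (SuperFun.θ α))) (h4 : ∀ μ, p (dx μ)) : ∀ a ∈ gens ι κ, p a := by
  rintro a (((⟨h, rfl⟩ | ⟨α, rfl⟩) | ⟨m, rfl⟩) | ⟨m, rfl⟩)
  exacts [h1 h, h2 α, h3 m, h4 m]

theorem ofPoly_mem {T : Subalgebra ℂ (Forms ι κ)} (hT : ∀ α, dθ α ∈ T) (P : MvPolynomial ι ℂ) :
    ofPoly P ∈ T := by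
  induction P using MvPolynomial.induction_on with
  | C c =>
    have : (ofPoly (MvPolynomial.C c) : Forms ι κ) = algebraMap ℂ _ c := ofPoly.commutes c
    rw [this]; exact T.algebraMap_mem c
  | add p q hp hq => rw [map_add]; exact T.add_mem hp hq
  | mul_X p α hp => rw [map_mul]; exact T.mul_mem hp (hT α)

theorem one_tmul_mem {T : Subalgebra ℂ (Forms ι κ)} (hT : ∀ m, odd m ∈ T)
    (w : ExteriorAlgebra ℂ ((ι → ℂ) × (κ → ℂ))) :
    ((1 : EvenForms ι κ) ⊗ₜ[ℂ] w : Forms ι κ) ∈ T := by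
  induction w using ExteriorAlgebra.induction with
  | algebraMap c =>
    have : ((1 : EvenForms ι κ) ⊗ₜ[ℂ] algebraMap ℂ _ c : Forms ι κ) = algebraMap ℂ _ c :=
      (Algebra.TensorProduct.includeRight : _ →ₐ[ℂ] Forms ι κ).commutes c
    rw [this]; exact T.algebraMap_mem c
  | ι m => exact hT m
  | mul a b ha hb =>
    have := T.mul_mem ha hb
    rwa [Algebra.TensorProduct.tmul_mul_tmul, one_mul] at this
  | add a b ha hb => rw [TensorProduct.tmul_add]; exact T.add_mem ha hb

/-- The generating set contains every smooth function, because the coordinates generate only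
polynomials. Reducing from functions to coordinates is left to `IsGeometric`. -/
theorem adjoin_gens : Algebra.adjoin ℂ (gens ι κ) = ⊤ := by
  set T := Algebra.adjoin ℂ (gens ι κ) with hT
  have hodd : ∀ m, odd m ∈ T := fun m => by
    rw [odd_eq_sum]
    exact add_mem
      (sum_mem fun α _ => T.smul_mem (Algebra.subset_adjoin (Or.inl (Or.inr ⟨α, rfl⟩))) _)
      (sum_mem fun α _ => T.smul_mem (Algebra.subset_adjoin (Or.inr ⟨α, rfl⟩)) _)
  have h1 : ∀ h : Smooth κ, (ofSmooth h : Forms ι κ) ∈ T := fun h =>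
    Algebra.subset_adjoin (ofSmooth_mem_gens h)
  have h2 : ∀ P : MvPolynomial ι ℂ, (ofPoly P : Forms ι κ) ∈ T :=
    ofPoly_mem fun α => Algebra.subset_adjoin (Or.inl (Or.inl (Or.inr ⟨α, rfl⟩)))
  have h3 := one_tmul_mem hodd
  have h4 : ∀ e : EvenForms ι κ, (e ⊗ₜ[ℂ] 1 : Forms ι κ) ∈ T := fun e => by
    induction e using EvenForms.induction_on with
    | zero => rw [TensorProduct.zero_tmul]; exact T.zero_mem
    | add a b ha hb => rw [TensorProduct.add_tmul]; exact T.add_mem ha hb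
    | mul h P =>
      have := T.mul_mem (h1 h) (h2 P)
      rwa [ofSmooth_apply, ofPoly_apply, Algebra.TensorProduct.tmul_mul_tmul, mul_one] at this
  rw [eq_top_iff]
  rintro z -
  induction z using TensorProduct.induction_on with
  | zero => exact T.zero_mem
  | add a b ha hb => exact T.add_mem ha hb
  | tmul e w =>
    have := T.mul_mem (h4 e) (h3 w)
    rwa [Algebra.TensorProduct.tmul_mul_tmul, one_mul, mul_one] at this

/-- The sign automorphism given by the total parity. -/
def sgn : Forms ι κ →ₐ[ℂ] Forms ι κ :=
  Algebra.TensorProduct.map (AlgHom.id ℂ _)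
    (CliffordAlgebra.involute (Q := (0 : QuadraticForm ℂ ((ι → ℂ) × (κ → ℂ)))))

theorem sgn_tmul (e : EvenForms ι κ) (w : ExteriorAlgebra ℂ ((ι → ℂ) × (κ → ℂ))) :
    sgn (e ⊗ₜ[ℂ] w : Forms ι κ) = e ⊗ₜ CliffordAlgebra.involute w := rfl

@[simp] theorem sgn_ofSmooth (h : Smooth κ) : sgn (ofSmooth h : Forms ι κ) = ofSmooth h := by
  rw [ofSmooth_apply, sgn_tmul, map_one]

@[simp] theorem sgn_dθ (α : ι) : sgn (dθ α : Forms ι κ) = dθ α := by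
  rw [dθ_apply, sgn_tmul, map_one]

@[simp] theorem sgn_odd (m : (ι → ℂ) × (κ → ℂ)) : sgn (odd m : Forms ι κ) = -odd m := by
  rw [odd_apply, sgn_tmul]
  rw [ExteriorAlgebra.ι, CliffordAlgebra.involute_ι, TensorProduct.tmul_neg]

@[simp] theorem sgn_θ (α : ι) :
    sgn (ofFun (SuperFun.θ α) : Forms ι κ) = -ofFun (SuperFun.θ α) := by
  rw [ofFun_θ, sgn_odd]

@[simp] theorem sgn_dx (μ : κ) : sgn (dx μ : Forms ι κ) = -dx μ := by
  rw [dx_eq, sgn_odd]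

theorem ofSmooth_central (h : Smooth κ) (a : Forms ι κ) : ofSmooth h * a = a * ofSmooth h :=
  Algebra.commutes (EvenForms.inclSmooth h : EvenForms ι κ) a

theorem odd_mul_odd (m m' : (ι → ℂ) × (κ → ℂ)) :
    (odd m * odd m' : Forms ι κ) = -(odd m' * odd m) := by
  rw [eq_neg_iff_add_eq_zero]
  exact oddSpan_anticomm (Submodule.subset_span ⟨m, rfl⟩) (Submodule.subset_span ⟨m', rfl⟩)

/-- Smooth functions and the dθ are central, and the remaining generators θ and dx lie in the odd
span, where products anticommute. -/
theorem isSuperComm : IsSuperComm (sgn (ι := ι) (κ := κ)) (gens ι κ) where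
  adjoin := adjoin_gens
  sq a := by
    induction a using TensorProduct.induction_on with
    | zero => simp
    | add a b ha hb => rw [map_add, map_add, ha, hb]
    | tmul e w => rw [sgn_tmul, sgn_tmul, CliffordAlgebra.involute_involute]
  gen := by
    have key : ∀ m : (ι → ℂ) × (κ → ℂ), ∀ g' ∈ gens ι κ, odd m * g' = sgn g' * odd m := by
      intro m
      refine forall_gens (fun h => ?_) (fun α => ?_) (fun α => ?_) (fun μ => ?_)
      · rw [sgn_ofSmooth, ofSmooth_central]
      · rw [sgn_dθ]; exact (ofPoly_commute _ _).symm
      · rw [ofFun_θ, sgn_odd, odd_mul_odd, neg_mul]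
      · rw [dx_eq, sgn_odd, odd_mul_odd, neg_mul]
    refine forall_gens (fun h => ?_) (fun α => ?_) (fun α => ?_) (fun μ => ?_)
    · exact Or.inl ⟨sgn_ofSmooth h, ofSmooth_central h⟩
    · exact Or.inl ⟨sgn_dθ α, ofPoly_commute _⟩
    · rw [ofFun_θ]; exact Or.inr ⟨sgn_odd _, key _⟩
    · rw [dx_eq]; exact Or.inr ⟨sgn_odd _, key _⟩

/-! ## The coordinate derivations of forms -/

section Partials

variable (μ ν : κ) (α β : ι)

@[simp] theorem partialX_ofSmooth (h : Smooth κ) :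
    partialX μ (ofSmooth h : Forms ι κ) = ofSmooth (Smooth.partial μ h) := rfl

@[simp] theorem partialX_tmul_one (w : ExteriorAlgebra ℂ ((ι → ℂ) × (κ → ℂ)))
    (P : MvPolynomial ι ℂ) :
    partialX μ (EvenForms.inclPoly P ⊗ₜ[ℂ] w : Forms ι κ) = 0 := by
  have h : EvenForms.map (Smooth.partial μ) .id (EvenForms.inclPoly P : EvenForms ι κ) = 0 := by
    refine (TensorProduct.map_tmul (Smooth.partial μ) .id (1 : Smooth κ) P).trans ?_
    have := Smooth.partial_algebraMap μ 1
    rw [map_one] at this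
    rw [this, TensorProduct.zero_tmul]
    rfl
  rw [partialX, LinearMap.rTensor_tmul, h, TensorProduct.zero_tmul]

@[simp] theorem partialX_odd (m : (ι → ℂ) × (κ → ℂ)) : partialX μ (odd m : Forms ι κ) = 0 := by
  rw [odd_apply, ← map_one EvenForms.inclPoly]
  exact partialX_tmul_one μ _ _

@[simp] theorem partialX_dθ : partialX μ (dθ α : Forms ι κ) = 0 := partialX_tmul_one μ _ _

@[simp] theorem partialθ_ofSmooth (h : Smooth κ) : partialθ α (ofSmooth h : Forms ι κ) = 0 := by
  rw [ofSmooth_apply, partialθ, LinearMap.lTensor_tmul, CliffordAlgebra.contractLeft_one,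
    TensorProduct.tmul_zero]

@[simp] theorem partialθ_dθ : partialθ α (dθ β : Forms ι κ) = 0 := by
  rw [dθ_apply, partialθ, LinearMap.lTensor_tmul, CliffordAlgebra.contractLeft_one,
    TensorProduct.tmul_zero]

@[simp] theorem partialθ_odd (m : (ι → ℂ) × (κ → ℂ)) :
    partialθ α (odd m : Forms ι κ) = (m.1 α) • 1 := by
  rw [odd_apply, partialθ, LinearMap.lTensor_tmul]
  rw [ExteriorAlgebra.ι, CliffordAlgebra.contractLeft_ι]
  rw [← Algebra.algebraMap_eq_smul_one]
  exact (Algebra.TensorProduct.includeRight : _ →ₐ[ℂ] Forms ι κ).commutes _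

@[simp] theorem partialDx_ofSmooth (h : Smooth κ) : partialDx μ (ofSmooth h : Forms ι κ) = 0 := by
  rw [ofSmooth_apply, partialDx, LinearMap.lTensor_tmul, CliffordAlgebra.contractLeft_one,
    TensorProduct.tmul_zero]

@[simp] theorem partialDx_dθ : partialDx μ (dθ β : Forms ι κ) = 0 := by
  rw [dθ_apply, partialDx, LinearMap.lTensor_tmul, CliffordAlgebra.contractLeft_one,
    TensorProduct.tmul_zero]

@[simp] theorem partialDx_odd (m : (ι → ℂ) × (κ → ℂ)) :
    partialDx μ (odd m : Forms ι κ) = (m.2 μ) • 1 := by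
  rw [odd_apply, partialDx, LinearMap.lTensor_tmul]
  rw [ExteriorAlgebra.ι, CliffordAlgebra.contractLeft_ι]
  rw [← Algebra.algebraMap_eq_smul_one]
  exact (Algebra.TensorProduct.includeRight : _ →ₐ[ℂ] Forms ι κ).commutes _

@[simp] theorem partialDθ_inclSmooth_tmul (h : Smooth κ)
    (w : ExteriorAlgebra ℂ ((ι → ℂ) × (κ → ℂ))) :
    partialDθ α (EvenForms.inclSmooth h ⊗ₜ[ℂ] w : Forms ι κ) = 0 := by
  have h : EvenForms.map .id (MvPolynomial.pderiv α).toLinearMap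
      (EvenForms.inclSmooth h : EvenForms ι κ) = 0 := by
    refine (TensorProduct.map_tmul .id (MvPolynomial.pderiv α).toLinearMap h
      (1 : MvPolynomial ι ℂ)).trans ?_
    have : (MvPolynomial.pderiv α).toLinearMap (1 : MvPolynomial ι ℂ) = 0 :=
      MvPolynomial.pderiv_one
    rw [this, TensorProduct.tmul_zero]
    rfl
  rw [partialDθ, LinearMap.rTensor_tmul, h, TensorProduct.zero_tmul]

@[simp] theorem partialDθ_ofSmooth (h : Smooth κ) : partialDθ α (ofSmooth h : Forms ι κ) = 0 :=
  partialDθ_inclSmooth_tmul α _ _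

@[simp] theorem partialDθ_odd (m : (ι → ℂ) × (κ → ℂ)) : partialDθ α (odd m : Forms ι κ) = 0 := by
  rw [odd_apply, ← map_one EvenForms.inclSmooth]
  exact partialDθ_inclSmooth_tmul α _ _

@[simp] theorem partialDθ_dθ :
    partialDθ α (dθ β : Forms ι κ) = (if α = β then 1 else 0 : ℂ) • 1 := by
  have h : EvenForms.map .id (MvPolynomial.pderiv α).toLinearMap
      (EvenForms.inclPoly (MvPolynomial.X β) : EvenForms ι κ) =
      algebraMap ℂ _ (if α = β then 1 else 0) := by
    refine (TensorProduct.map_tmul .id (MvPolynomial.pderiv α).toLinearMap (1 : Smooth κ)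
      (MvPolynomial.X β : MvPolynomial ι ℂ)).trans ?_
    have : (MvPolynomial.pderiv α).toLinearMap (MvPolynomial.X β : MvPolynomial ι ℂ) =
        algebraMap ℂ _ (if α = β then 1 else 0) := by
      refine (MvPolynomial.pderiv_X α β).trans ?_
      by_cases h : α = β
      · subst h; simp
      · simp [h, Ne.symm h]
    rw [this]
    exact EvenForms.inclPoly.commutes _
  rw [dθ_apply, partialDθ, LinearMap.rTensor_tmul, h]
  rw [← Algebra.algebraMap_eq_smul_one]
  exact (Algebra.TensorProduct.includeLeft : _ →ₐ[ℂ] Forms ι κ).commutes _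

theorem partialX_isTwistedDer :
    IsTwistedDer (AlgHom.id ℂ (Forms ι κ)) (AlgHom.id ℂ _) (partialX μ) :=
  isTwistedDer_rTensor
    (isTwistedDer_rTensor (E := Smooth κ) (L := MvPolynomial ι ℂ) (Smooth.partial_mul μ))

theorem partialDθ_isTwistedDer :
    IsTwistedDer (AlgHom.id ℂ (Forms ι κ)) (AlgHom.id ℂ _) (partialDθ α) := by
  refine isTwistedDer_rTensor ?_
  have h : IsTwistedDer (AlgHom.id ℂ (MvPolynomial ι ℂ)) (AlgHom.id ℂ _)
      (MvPolynomial.pderiv α).toLinearMap := fun a b => by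
    have := (MvPolynomial.pderiv α).leibniz a b
    simp only [smul_eq_mul] at this
    change MvPolynomial.pderiv α (a * b) =
      MvPolynomial.pderiv α a * b + a * MvPolynomial.pderiv α b
    rw [this]; ring
  intro a b
  have := isTwistedDer_lTensor (E := Smooth κ) h a b
  rwa [Algebra.TensorProduct.map_id] at this

theorem partialθ_isTwistedDer : IsTwistedDer (AlgHom.id ℂ (Forms ι κ)) sgn (partialθ α) :=
  isTwistedDer_lTensor (isTwistedDer_contractLeft _)

theorem partialDx_isTwistedDer : IsTwistedDer (AlgHom.id ℂ (Forms ι κ)) sgn (partialDx μ) :=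
  isTwistedDer_lTensor (isTwistedDer_contractLeft _)

theorem partialX_isSuperDer : IsSuperDer (sgn (ι := ι)) 0 (partialX μ) :=
  .of_gen adjoin_gens (partialX_isTwistedDer μ) (forall_gens
    (by simp [koszul]) (by simp) (by simp [ofFun_θ]) (by simp [dx_eq]))

theorem partialDθ_isSuperDer : IsSuperDer (sgn (κ := κ)) 0 (partialDθ α) :=
  .of_gen adjoin_gens (partialDθ_isTwistedDer α) (forall_gens
    (by simp) (by simp [koszul]) (by simp [ofFun_θ]) (by simp [dx_eq]))

theorem partialθ_isSuperDer : IsSuperDer (sgn (κ := κ)) 1 (partialθ α) :=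
  .of_gen adjoin_gens (partialθ_isTwistedDer α) (forall_gens
    (by simp) (by simp) (by simp [ofFun_θ, koszul]) (by simp [dx_eq, koszul]))

theorem partialDx_isSuperDer : IsSuperDer (sgn (ι := ι)) 1 (partialDx μ) :=
  .of_gen adjoin_gens (partialDx_isTwistedDer μ) (forall_gens
    (by simp) (by simp) (by simp [ofFun_θ, koszul]) (by simp [dx_eq, koszul]))

end Partials

end Forms
end PureSpinor

namespace PureSpinor
set_option linter.unusedSectionVars false
variable {ι κ : Type} [Fintype ι] [DecidableEq ι] [Fintype κ] [DecidableEq κ]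

namespace Forms

section Values

variable (μ ν : κ) (α β : ι)

@[simp] theorem partialX_θ : partialX μ (ofFun (SuperFun.θ α) : Forms ι κ) = 0 := by
  rw [ofFun_θ, partialX_odd]
@[simp] theorem partialX_dx : partialX μ (dx ν : Forms ι κ) = 0 := by rw [dx_eq, partialX_odd]
@[simp] theorem partialθ_θ :
    partialθ α (ofFun (SuperFun.θ β) : Forms ι κ) = (if α = β then 1 else 0 : ℂ) • 1 := by
  rw [ofFun_θ, partialθ_odd]; simp [Pi.single_apply]
@[simp] theorem partialθ_dx : partialθ α (dx ν : Forms ι κ) = 0 := by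
  rw [dx_eq, partialθ_odd]; simp
@[simp] theorem partialDx_θ : partialDx μ (ofFun (SuperFun.θ α) : Forms ι κ) = 0 := by
  rw [ofFun_θ, partialDx_odd]; simp
@[simp] theorem partialDx_dx :
    partialDx μ (dx ν : Forms ι κ) = (if μ = ν then 1 else 0 : ℂ) • 1 := by
  rw [dx_eq, partialDx_odd]; simp [Pi.single_apply]
@[simp] theorem partialDθ_θ : partialDθ α (ofFun (SuperFun.θ β) : Forms ι κ) = 0 := by
  rw [ofFun_θ, partialDθ_odd]
@[simp] theorem partialDθ_dx : partialDθ α (dx ν : Forms ι κ) = 0 := by rw [dx_eq, partialDθ_odd]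

end Values

/-! ## The de Rham differential -/

theorem d_ofSmooth (h : Smooth κ) :
    d (ofSmooth h : Forms ι κ) = ∑ μ, dx μ * ofSmooth (Smooth.partial μ h) := by
  simp [d, LinearMap.sum_apply]

theorem ofSmooth_partial_coord (μ ν : κ) :
    (ofSmooth (Smooth.partial μ (Smooth.coord ν)) : Forms ι κ) = if μ = ν then 1 else 0 := by
  rw [Smooth.partial_coord]; split_ifs <;> simp

theorem d_coord (μ : κ) : d (ofSmooth (Smooth.coord μ) : Forms ι κ) = dx μ := by
  simp [d_ofSmooth, ofSmooth_partial_coord]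

@[simp] theorem d_θ (α : ι) : d (ofFun (SuperFun.θ α) : Forms ι κ) = dθ α := by
  simp [d, LinearMap.sum_apply]

@[simp] theorem d_dθ (α : ι) : d (dθ α : Forms ι κ) = 0 := by
  simp [d, LinearMap.sum_apply]

@[simp] theorem d_dx (μ : κ) : d (dx μ : Forms ι κ) = 0 := by
  simp [d, LinearMap.sum_apply]

/-- Each summand multiplies a coordinate derivation by a one-form of the complementary parity: even
dθ with odd ∂_θ, odd dx with even ∂_x. -/
theorem d_isSuperDer : IsSuperDer (sgn (ι := ι) (κ := κ)) 1 d :=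
  .add (.sum _ fun α => IsSuperDer.mulLeft (q := 0) isSuperComm (partialθ_isSuperDer α)
      (by simp [koszul]))
    (.sum _ fun μ => IsSuperDer.mulLeft (q := 1) isSuperComm (partialX_isSuperDer μ)
      (by simp [koszul]))

/-- Operators that act on functions on spacetime as vector fields. -/
def IsGeometric (P : Module.End ℂ (Forms ι κ)) : Prop :=
  ∀ h, P (ofSmooth h) = ∑ μ, P (ofSmooth (Smooth.coord μ)) * ofSmooth (Smooth.partial μ h)

theorem d_isGeometric : IsGeometric (d (ι := ι) (κ := κ)) := fun h => by
  rw [d_ofSmooth]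
  simp only [d_coord]

theorem zero_isGeometric : IsGeometric (0 : Module.End ℂ (Forms ι κ)) := fun h => by simp

theorem koszul_comm (p q : ZMod 2) : koszul p q = koszul q p := by rw [koszul, koszul, mul_comm]

theorem koszul_mul_self (p q : ZMod 2) : koszul p q * koszul p q = 1 := by
  rw [koszul]; split_ifs <;> simp

variable {p q : ZMod 2} {P Q : Module.End ℂ (Forms ι κ)}

/-- A composite of two such operators is of second order on functions. In the supercommutator the
second-order parts cancel, because the values on coordinates supercommute and partial derivatives
commute, leaving the chain rule for the bracket. -/
theorem IsGeometric.bracket (hP : IsSuperDer sgn p P) (hP' : IsGeometric P)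
    (hQ : IsSuperDer sgn q Q) (hQ' : IsGeometric Q) :
    IsGeometric (P * Q - koszul p q • (Q * P)) := by
  intro h
  have hs : ∀ {p} {P : Module.End ℂ (Forms ι κ)}, IsSuperDer sgn p P → ∀ h,
      sgn (P (ofSmooth h)) = koszul 1 p • P (ofSmooth h) := fun hP h => by
    rw [hP.sign, sgn_ofSmooth]
  -- The expansion of a composite on a function into its first-order and second-order parts; the
  -- Koszul sign comes from moving `P` past the homogeneous value of `Q` on a coordinate.
  have key : ∀ {p q} {P Q : Module.End ℂ (Forms ι κ)}, IsSuperDer sgn p P → IsGeometric P →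
      IsSuperDer sgn q Q → IsGeometric Q → P (Q (ofSmooth h)) =
        ∑ μ, P (Q (ofSmooth (Smooth.coord μ))) * ofSmooth (Smooth.partial μ h) +
        koszul p q • ∑ μ, ∑ ν, Q (ofSmooth (Smooth.coord μ)) * P (ofSmooth (Smooth.coord ν)) *
          ofSmooth (Smooth.partial ν (Smooth.partial μ h)) := by
    intro p q P Q hP hP' hQ hQ'
    rw [hQ' h, map_sum, Finset.smul_sum, ← Finset.sum_add_distrib]
    refine Finset.sum_congr rfl fun μ _ => ?_
    rw [hP.leibniz, signPow_hom (hs hQ _), hP' (Smooth.partial μ h), Finset.mul_sum,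
      Finset.smul_sum]
    simp only [smul_mul_assoc, mul_assoc, AlgHom.id_apply]
  simp only [LinearMap.sub_apply, LinearMap.smul_apply, Module.End.mul_apply]
  rw [key hP hP' hQ hQ', key hQ hQ' hP hP', smul_add, smul_smul, koszul_comm q p, koszul_mul_self,
    one_smul, Finset.sum_comm (f := fun μ ν => P (ofSmooth (Smooth.coord μ)) *
      Q (ofSmooth (Smooth.coord ν)) * ofSmooth (Smooth.partial ν (Smooth.partial μ h)))]
  -- The second-order part of `P ∘ Q`, with the two coefficients exchanged, becomes that of `Q ∘ P`;
  -- the sign of the exchange absorbs the Koszul factor.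
  have : koszul p q • ∑ μ, ∑ ν, Q (ofSmooth (Smooth.coord μ)) * P (ofSmooth (Smooth.coord ν)) *
        ofSmooth (Smooth.partial ν (Smooth.partial μ h)) =
      ∑ μ, ∑ ν, P (ofSmooth (Smooth.coord ν)) * Q (ofSmooth (Smooth.coord μ)) *
        ofSmooth (Smooth.partial μ (Smooth.partial ν h)) := by
    simp only [Finset.smul_sum, isSuperComm.hom_mul_hom (hs hP _) (hs hQ _), smul_mul_assoc,
      Smooth.partial_comm]
  rw [this]
  simp only [sub_mul, Finset.sum_sub_distrib, Finset.smul_sum, smul_mul_assoc]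
  abel

/-- A geometric superderivation is determined by its values on coordinates and their
differentials. -/
theorem IsGeometric.ext (hP : IsSuperDer sgn p P) (hP' : IsGeometric P)
    (hQ : IsSuperDer sgn p Q) (hQ' : IsGeometric Q)
    (hx : ∀ μ, P (ofSmooth (Smooth.coord μ)) = Q (ofSmooth (Smooth.coord μ)))
    (hθ : ∀ α, P (ofFun (SuperFun.θ α)) = Q (ofFun (SuperFun.θ α)))
    (hdx : ∀ μ, P (dx μ) = Q (dx μ)) (hdθ : ∀ α, P (dθ α) = Q (dθ α)) : P = Q :=
  hP.ext adjoin_gens hQ (forall_gens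
    (fun h => by rw [hP' h, hQ' h]; simp only [hx]) hdθ hθ hdx)

/-- The operator 2 d² is the supercommutator of d with itself, hence a geometric superderivation,
and it vanishes on coordinates and on their differentials. Division by 2 concludes. -/
theorem d_mul_d : d * d = (0 : Module.End ℂ (Forms ι κ)) := by
  have h := d_isSuperDer.bracket isSuperComm.sq (d_isSuperDer (ι := ι) (κ := κ))
  have h' := d_isGeometric.bracket d_isSuperDer d_isSuperDer (d_isGeometric (ι := ι) (κ := κ))
  have := h'.ext h .zero zero_isGeometric (by simp [d_coord]) (by simp) (by simp) (by simp)
  refine LinearMap.ext fun a => ?_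
  have ha := LinearMap.congr_fun this a
  rw [koszul_one_one, LinearMap.sub_apply, LinearMap.smul_apply, neg_smul, one_smul,
    sub_neg_eq_add, ← two_smul ℂ] at ha
  exact (smul_eq_zero.mp ha).resolve_left two_ne_zero

theorem d_d (a : Forms ι κ) : d (d a) = 0 := LinearMap.congr_fun d_mul_d a

/-- Superderivations commuting with the differential, which act as vector fields on functions. -/
structure IsLie (p : ZMod 2) (P : Module.End ℂ (Forms ι κ)) : Prop where
  der : IsSuperDer sgn p P
  geom : IsGeometric P
  comm : d * P = koszul 1 p • (P * d)

theorem IsLie.bracket (hP : IsLie p P) (hQ : IsLie q Q) :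
    IsLie (p + q) (P * Q - koszul p q • (Q * P)) where
  der := hP.der.bracket isSuperComm.sq hQ.der
  geom := hP.geom.bracket hP.der hQ.der hQ.geom
  comm := by
    rw [mul_sub, ← mul_assoc, hP.comm, mul_smul_comm, ← mul_assoc, hQ.comm, smul_mul_assoc,
      smul_mul_assoc, mul_assoc, hQ.comm, mul_assoc, hP.comm, koszul_one_add, sub_mul]
    simp only [mul_smul_comm, smul_mul_assoc, smul_sub, smul_smul, mul_assoc]
    congr 2; ring

/-- Lie derivatives are determined by their values on the coordinates. -/
theorem IsLie.ext (hP : IsLie p P) (hQ : IsLie p Q)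
    (hx : ∀ μ, P (ofSmooth (Smooth.coord μ)) = Q (ofSmooth (Smooth.coord μ)))
    (hθ : ∀ α, P (ofFun (SuperFun.θ α)) = Q (ofFun (SuperFun.θ α))) : P = Q := by
  -- Both operators commute with d up to the same invertible sign, so agreement at `a` forces
  -- agreement at d `a`; values on dx and dθ are therefore redundant.
  have key : ∀ a, P a = Q a → P (d a) = Q (d a) := fun a ha => by
    have h1 := LinearMap.congr_fun hP.comm a
    have h2 := LinearMap.congr_fun hQ.comm a
    simp only [Module.End.mul_apply, LinearMap.smul_apply] at h1 h2
    rw [ha, h2] at h1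
    have := congrArg (koszul 1 p • ·) h1
    simpa only [smul_smul, koszul_one_mul_self, one_smul] using this.symm
  refine hP.geom.ext hP.der hQ.der hQ.geom hx hθ (fun μ => ?_) (fun α => ?_)
  · rw [← d_coord]; exact key _ (hx μ)
  · rw [← d_θ]; exact key _ (hθ α)

/-! ## Lie derivatives -/

section Lie

variable (σ : ℂ) (X : VField ι κ)

theorem lieDeriv_apply (a : Forms ι κ) : lieDeriv σ X a =
    ∑ μ, (ofFun (X.1 μ) * partialX μ a + σ • (d (ofFun (X.1 μ)) * partialDx μ a)) +
    ∑ α, (ofFun (X.2 α) * partialθ α a + σ • (d (ofFun (X.2 α)) * partialDθ α a)) := by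
  simp [lieDeriv, LinearMap.sum_apply]

theorem lieDeriv_ofSmooth (h : Smooth κ) : lieDeriv σ X (ofSmooth h : Forms ι κ) =
    ∑ μ, ofFun (X.1 μ) * ofSmooth (Smooth.partial μ h) := by
  simp [lieDeriv_apply]

@[simp] theorem lieDeriv_coord (μ : κ) :
    lieDeriv σ X (ofSmooth (Smooth.coord μ) : Forms ι κ) = ofFun (X.1 μ) := by
  simp [lieDeriv_ofSmooth, ofSmooth_partial_coord]

@[simp] theorem lieDeriv_θ (α : ι) :
    lieDeriv σ X (ofFun (SuperFun.θ α) : Forms ι κ) = ofFun (X.2 α) := by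
  simp [lieDeriv_apply]

@[simp] theorem lieDeriv_dθ (α : ι) :
    lieDeriv σ X (dθ α : Forms ι κ) = σ • d (ofFun (X.2 α)) := by
  simp [lieDeriv_apply]

@[simp] theorem lieDeriv_dx (μ : κ) :
    lieDeriv σ X (dx μ : Forms ι κ) = σ • d (ofFun (X.1 μ)) := by
  simp [lieDeriv_apply]

end Lie

/-- Vector fields of parity `p`. -/
def IsHomVField (p : ZMod 2) (X : VField ι κ) : Prop :=
  (∀ μ, sgn (ofFun (X.1 μ)) = koszul 1 p • ofFun (X.1 μ)) ∧
    ∀ α, sgn (ofFun (X.2 α)) = koszul 1 (p + 1) • ofFun (X.2 α)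

/-- A component along the odd ∂_θ has parity p + 1 and one along the even ∂_x has parity p. Applying
d shifts each by one, which is compensated by ∂/∂(dθ) being even and ∂/∂(dx) odd. -/
theorem IsHomVField.lieDeriv_isSuperDer {X : VField ι κ} (hX : IsHomVField p X) :
    IsSuperDer sgn p (lieDeriv (koszul 1 p) X) := by
  have hd : ∀ {q} {a : Forms ι κ}, sgn a = koszul 1 q • a →
      sgn (d a) = koszul 1 (q + 1) • d a := fun {q a} h => by
    rw [d_isSuperDer.sign, h, map_smul, smul_smul, koszul_one_add, mul_comm]
  have h2 : p + 1 + 1 = p := by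
    rw [add_assoc, show (1 + 1 : ZMod 2) = 0 from rfl, add_zero]
  refine .add (.sum _ fun μ => .add ?_ (.smul ?_ _)) (.sum _ fun α => .add ?_ (.smul ?_ _))
  · simpa using IsSuperDer.mulLeft isSuperComm (partialX_isSuperDer μ) (hX.1 μ)
  · simpa [h2] using IsSuperDer.mulLeft isSuperComm (partialDx_isSuperDer μ) (hd (hX.1 μ))
  · simpa [h2] using IsSuperDer.mulLeft isSuperComm (partialθ_isSuperDer α) (hX.2 α)
  · simpa [h2] using IsSuperDer.mulLeft isSuperComm (partialDθ_isSuperDer α) (hd (hX.2 α))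

/-- The supercommutator of d with L_X is geometric. It vanishes on coordinates by the prescription
L_X(dz) = ±d(Xz), and on dx and dθ because d² = 0. -/
theorem IsHomVField.isLie {X : VField ι κ} (hX : IsHomVField p X) :
    IsLie p (lieDeriv (koszul 1 p) X) := by
  have hg : IsGeometric (lieDeriv (koszul 1 p) X) := fun h => by
    rw [lieDeriv_ofSmooth]
    simp only [lieDeriv_coord]
  refine ⟨hX.lieDeriv_isSuperDer, hg, ?_⟩
  have h := d_isSuperDer.bracket isSuperComm.sq hX.lieDeriv_isSuperDer
  have h' := d_isGeometric.bracket d_isSuperDer hX.lieDeriv_isSuperDer hg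
  refine sub_eq_zero.mp (h'.ext h .zero zero_isGeometric ?_ ?_ ?_ ?_) <;> intro j
  · simp [d_coord, smul_smul, koszul_one_mul_self]
  · simp [smul_smul, koszul_one_mul_self]
  · simp [d_d]
  · simp [d_d]

end Forms
end PureSpinor

namespace PureSpinor
set_option linter.unusedSectionVars false
set_option linter.unusedSimpArgs false
variable {ι κ : Type} [Fintype ι] [DecidableEq ι] [Fintype κ] [DecidableEq κ]

/-! ## The action of `𝔤` on forms -/

section DerivationLaws

variable {n : TwoStep ι κ} {G : Type*} [LieRing G] [LieAlgebra ℂ G] (r : G →ₗ⁅ℂ⁆ n.aut)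

theorem actTwo_br (a : G) (s t : ι → ℂ) :
    actTwo r a (n.br s t) = n.br (actOne r a s) t + n.br s (actOne r a t) :=
  (r a).2.2.2 s t

theorem apply_inl (a : G) (s : ι → ℂ) : (r a).1 (s, 0) = (actOne r a s, 0) :=
  Prod.ext rfl ((r a).2.1 s)

theorem apply_inr (a : G) (w : κ → ℂ) : (r a).1 (0, w) = (0, actTwo r a w) :=
  Prod.ext ((r a).2.2.1 w) rfl

theorem coe_map_lie (a b : G) : (r ⁅a, b⁆).1 = (r a).1 * (r b).1 - (r b).1 * (r a).1 := by
  rw [LieHom.map_lie]; rfl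

theorem actOne_lie (a b : G) (s : ι → ℂ) :
    actOne r ⁅a, b⁆ s = actOne r a (actOne r b s) - actOne r b (actOne r a s) := by
  have h := congrArg Prod.fst (LinearMap.congr_fun (coe_map_lie r a b) (s, 0))
  simp only [LinearMap.sub_apply, Module.End.mul_apply, apply_inl, Prod.fst_sub] at h
  exact h

theorem actTwo_lie (a b : G) (w : κ → ℂ) :
    actTwo r ⁅a, b⁆ w = actTwo r a (actTwo r b w) - actTwo r b (actTwo r a w) := by
  have h := congrArg Prod.snd (LinearMap.congr_fun (coe_map_lie r a b) (0, w))
  simp only [LinearMap.sub_apply, Module.End.mul_apply, apply_inr, Prod.snd_sub] at h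
  exact h

end DerivationLaws

theorem dual_eq_sum {J : Type} [Fintype J] [DecidableEq J] (l : Module.Dual ℂ (J → ℂ)) :
    l = ∑ j, l (Pi.single j 1) • (LinearMap.proj j : Module.Dual ℂ (J → ℂ)) := by
  refine LinearMap.pi_ext' fun i => LinearMap.ext_ring ?_
  simp [Pi.single_apply]

theorem linearMap_sum_comp {J : Type*} (s : Finset J) {E F H : Type*} [AddCommGroup E] [Module ℂ E]
    [AddCommGroup F] [Module ℂ F] [AddCommGroup H] [Module ℂ H] (f : J → F →ₗ[ℂ] H)
    (g : E →ₗ[ℂ] F) : (∑ j ∈ s, f j) ∘ₗ g = ∑ j ∈ s, f j ∘ₗ g :=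
  LinearMap.ext fun e => by simp [LinearMap.sum_apply]

namespace Forms

/-- Linear functions of the coordinates `x^μ`. -/
def linX : Module.Dual ℂ (κ → ℂ) →ₗ[ℂ] Forms ι κ where
  toFun l := ∑ μ, l (Pi.single μ 1) • ofSmooth (Smooth.coord μ)
  map_add' l l' := by simp [add_smul, Finset.sum_add_distrib]
  map_smul' c l := by simp [mul_smul, Finset.smul_sum]

/-- Linear functions of the coordinates `θ^α`. -/
def linθ : Module.Dual ℂ (ι → ℂ) →ₗ[ℂ] Forms ι κ where
  toFun l := ∑ α, l (Pi.single α 1) • ofFun (SuperFun.θ α)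
  map_add' l l' := by simp [add_smul, Finset.sum_add_distrib]
  map_smul' c l := by simp [mul_smul, Finset.smul_sum]

theorem linX_apply (l : Module.Dual ℂ (κ → ℂ)) :
    (linX l : Forms ι κ) = ∑ μ, l (Pi.single μ 1) • ofSmooth (Smooth.coord μ) := rfl

theorem linθ_apply (l : Module.Dual ℂ (ι → ℂ)) :
    (linθ l : Forms ι κ) = ∑ α, l (Pi.single α 1) • ofFun (SuperFun.θ α) := rfl

theorem linX_proj (μ : κ) :
    (linX (LinearMap.proj μ) : Forms ι κ) = ofSmooth (Smooth.coord μ) := by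
  simp [linX_apply, Pi.single_apply]

theorem linθ_proj (α : ι) : (linθ (LinearMap.proj α) : Forms ι κ) = ofFun (SuperFun.θ α) := by
  simp [linθ_apply, Pi.single_apply]

theorem sgn_linX (l : Module.Dual ℂ (κ → ℂ)) : sgn (linX l : Forms ι κ) = linX l := by
  simp [linX_apply]

theorem sgn_linθ (l : Module.Dual ℂ (ι → ℂ)) : sgn (linθ l : Forms ι κ) = -linθ l := by
  simp [linθ_apply]

variable {n : TwoStep ι κ} {G : Type*} [LieRing G] [LieAlgebra ℂ G] (r : G →ₗ⁅ℂ⁆ n.aut)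

/-- The action of `𝔤` on forms by Lie derivatives. -/
def lieAct : SP G ι κ →ₗ[ℂ] Module.End ℂ (Forms ι κ) :=
  lieDeriv 1 ∘ₗ evenLeft r + lieDeriv (-1) ∘ₗ oddLeft n G

theorem lieAct_apply (x : SP G ι κ) :
    lieAct r x = lieDeriv 1 (evenLeft r x) + lieDeriv (-1) (oddLeft n G x) := rfl

theorem ofFun_evenLeft_fst (x : SP G ι κ) (μ : κ) : ofFun ((evenLeft r x).1 μ) =
    (-linX (LinearMap.proj μ ∘ₗ actTwo r x.1) + x.2.2 μ • 1 : Forms ι κ) := by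
  simp [evenLeft, linField, transField, linX_apply, ofFun_x, entryTwo]

theorem ofFun_evenLeft_snd (x : SP G ι κ) (α : ι) : ofFun ((evenLeft r x).2 α) =
    (-linθ (LinearMap.proj α ∘ₗ actOne r x.1) : Forms ι κ) := by
  simp [evenLeft, linField, transField, linθ_apply, entryOne]

theorem sum_f (s : ι → ℂ) (μ : κ) (β : ι) :
    ∑ α, s α * n.f μ α β = (1 / 2 : ℂ) * n.br s (Pi.single β 1) μ := by
  have hs : s = ∑ α, s α • (Pi.single α 1 : ι → ℂ) := by
    ext β; simp [Finset.sum_apply, Pi.single_apply]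
  conv_rhs => rw [hs]
  simp only [map_sum, map_smul, LinearMap.sum_apply, LinearMap.smul_apply, Finset.sum_apply,
    Pi.smul_apply, smul_eq_mul, TwoStep.f, Finset.mul_sum]
  exact Finset.sum_congr rfl fun α _ => by ring

theorem ofFun_oddField_fst (σ : ℂ) (s : ι → ℂ) (μ : κ) : ofFun ((oddField n σ s).1 μ) =
    (linθ ((σ / 2 : ℂ) • LinearMap.proj μ ∘ₗ n.br s) : Forms ι κ) := by
  have h : (oddField n σ s).1 μ = ∑ α, ∑ β, (s α * (σ * n.f μ α β)) • SuperFun.θ β := rfl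
  rw [h, Finset.sum_comm, map_sum, linθ_apply]
  refine Finset.sum_congr rfl fun β _ => ?_
  rw [← Finset.sum_smul, map_smul]
  congr 1
  have : ∀ α, s α * (σ * n.f μ α β) = σ * (s α * n.f μ α β) := fun α => by ring
  simp only [this, ← Finset.mul_sum, sum_f]
  simp; ring

theorem ofFun_oddField_snd (σ : ℂ) (s : ι → ℂ) (α : ι) :
    ofFun ((oddField n σ s).2 α) = (s α • 1 : Forms ι κ) := by
  simp [oddField]

/-- An arbitrary linear form is used instead of one coordinate since the action replaces `l` by its
composites with the representation and the bracket. The formulas thus close under iteration, and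
bracket relations become identities of linear forms. -/
theorem lieAct_linX (x : SP G ι κ) (l : Module.Dual ℂ (κ → ℂ)) :
    lieAct r x (linX l : Forms ι κ) = -linX (l ∘ₗ actTwo r x.1) + l x.2.2 • 1 +
      linθ ((1 / 2 : ℂ) • l ∘ₗ n.br x.2.1) := by
  have key : ∀ μ, lieAct r x (ofSmooth (Smooth.coord μ) : Forms ι κ) =
      -linX (LinearMap.proj μ ∘ₗ actTwo r x.1) +
        (LinearMap.proj μ : Module.Dual ℂ (κ → ℂ)) x.2.2 • 1 +
        linθ ((1 / 2 : ℂ) • LinearMap.proj μ ∘ₗ n.br x.2.1) := fun μ => by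
    rw [lieAct_apply, LinearMap.add_apply, lieDeriv_coord, lieDeriv_coord, ofFun_evenLeft_fst]
    exact congrArg _ (ofFun_oddField_fst 1 x.2.1 μ)
  rw [dual_eq_sum l]
  simp only [map_sum, map_smul, linX_proj, key, linearMap_sum_comp, LinearMap.smul_comp,
    LinearMap.sum_apply, LinearMap.smul_apply, Finset.smul_sum, smul_add, Finset.sum_add_distrib,
    smul_neg, Finset.sum_neg_distrib, Finset.sum_smul, smul_assoc, smul_comm (_ : ℂ) (1 / 2 : ℂ)]

theorem lieAct_linθ (x : SP G ι κ) (l : Module.Dual ℂ (ι → ℂ)) :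
    lieAct r x (linθ l : Forms ι κ) = -linθ (l ∘ₗ actOne r x.1) + l x.2.1 • 1 := by
  have key : ∀ α, lieAct r x (ofFun (SuperFun.θ α) : Forms ι κ) =
      -linθ (LinearMap.proj α ∘ₗ actOne r x.1) +
        (LinearMap.proj α : Module.Dual ℂ (ι → ℂ)) x.2.1 • 1 := fun α => by
    rw [lieAct_apply, LinearMap.add_apply, lieDeriv_θ, lieDeriv_θ, ofFun_evenLeft_snd]
    exact congrArg _ (ofFun_oddField_snd 1 x.2.1 α)
  rw [dual_eq_sum l]
  simp only [map_sum, map_smul, linθ_proj, key, linearMap_sum_comp, LinearMap.smul_comp,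
    LinearMap.sum_apply, LinearMap.smul_apply, smul_add, Finset.sum_add_distrib,
    smul_neg, Finset.sum_neg_distrib, Finset.sum_smul, smul_assoc]

theorem par_zero {x : SP G ι κ} (hx : x ∈ SP.par G ι κ 0) : x.2.1 = 0 := by
  simpa [SP.par, Submodule.mem_prod] using hx

theorem par_one {x : SP G ι κ} (hx : x ∈ SP.par G ι κ 1) : x.1 = 0 ∧ x.2.2 = 0 := by
  simpa [SP.par, Submodule.mem_prod] using hx

/-- For homogeneous `x` one of the two fields vanishes, and the sign attached to the surviving Lie
derivative is (-1)^p; it remains to read off the parities of the components. -/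
theorem lieAct_isLie {p : ZMod 2} {x : SP G ι κ} (hx : x ∈ SP.par G ι κ p) :
    IsLie p (lieAct r x) := by
  rcases zmodTwo_cases p with rfl | rfl
  · have h : lieAct r x = lieDeriv (koszul 1 0) (evenLeft r x) := by
      have : oddLeft n G x = 0 := by simp [oddLeft, par_zero hx]
      rw [lieAct_apply, this, map_zero, add_zero, koszul_one_zero]
    rw [h]
    refine IsHomVField.isLie ⟨fun μ => ?_, fun α => ?_⟩
    · rw [ofFun_evenLeft_fst, map_add, map_neg, sgn_linX, map_smul, map_one, koszul_one_zero,
        one_smul]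
    · rw [ofFun_evenLeft_snd, map_neg, sgn_linθ, zero_add, koszul_one_one, neg_smul, one_smul]
  · have h : lieAct r x = lieDeriv (koszul 1 1) (oddField n 1 x.2.1) := by
      have : evenLeft r x = 0 := by simp [evenLeft, par_one hx]
      rw [lieAct_apply, this, map_zero, zero_add, koszul_one_one]; rfl
    rw [h]
    refine IsHomVField.isLie ⟨fun μ => ?_, fun α => ?_⟩
    · rw [ofFun_oddField_fst, sgn_linθ, koszul_one_one, neg_smul, one_smul]
    · rw [ofFun_oddField_snd, show (1 + 1 : ZMod 2) = 0 from rfl, map_smul, map_one,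
        koszul_one_zero, one_smul]

theorem bracket_mem_par {p q : ZMod 2} {x y : SP G ι κ} (hx : x ∈ SP.par G ι κ p)
    (hy : y ∈ SP.par G ι κ q) : SP.bracket r x y ∈ SP.par G ι κ (p + q) := by
  have h : (1 + 1 : ZMod 2) = 0 := rfl
  rcases zmodTwo_cases p with rfl | rfl <;> rcases zmodTwo_cases q with rfl | rfl
  · simp [SP.par, Submodule.mem_prod, SP.bracket, par_zero hx, par_zero hy]
  · simp [SP.par, Submodule.mem_prod, SP.bracket, par_zero hx, par_one hy]
  · simp [SP.par, Submodule.mem_prod, SP.bracket, par_one hx, par_zero hy]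
  · simp [h, SP.par, Submodule.mem_prod, SP.bracket, par_one hx, par_one hy]

theorem lieAct_one {p : ZMod 2} {x : SP G ι κ} (hx : x ∈ SP.par G ι κ p) :
    lieAct r x (1 : Forms ι κ) = 0 :=
  (lieAct_isLie r hx).der.leibniz.map_one

/-- Both sides are Lie operators of the same parity, so only linear functions of x and θ need
comparison. There the relation reduces to the representation property, to the derivation property of
𝔤₀, and, for two odd elements, to the sum of two halves of the symmetric bracket. -/
theorem lieAct_bracket {p q : ZMod 2} {x y : SP G ι κ} (hx : x ∈ SP.par G ι κ p)
    (hy : y ∈ SP.par G ι κ q) : lieAct r (SP.bracket r x y) =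
      lieAct r x * lieAct r y - koszul p q • (lieAct r y * lieAct r x) := by
  refine (lieAct_isLie r (bracket_mem_par r hx hy)).ext
    ((lieAct_isLie r hx).bracket (lieAct_isLie r hy)) (fun μ => ?_) (fun α => ?_)
  · rw [← linX_proj]
    generalize (LinearMap.proj μ : Module.Dual ℂ (κ → ℂ)) = l
    simp only [LinearMap.sub_apply, LinearMap.smul_apply, Module.End.mul_apply]
    simp only [lieAct_linX, lieAct_linθ, map_add, map_neg, map_smul, lieAct_one r hx,
      lieAct_one r hy, smul_zero, SP.bracket]
    have e1 : l ∘ₗ actTwo r ⁅x.1, y.1⁆ =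
        (l ∘ₗ actTwo r x.1) ∘ₗ actTwo r y.1 - (l ∘ₗ actTwo r y.1) ∘ₗ actTwo r x.1 := by
      refine LinearMap.ext fun w => ?_
      simp [actTwo_lie]
    -- The derivation property, solved for the term in which 𝔤₀ acts on the first argument of the
    -- bracket.
    have e2 : ∀ a s, l ∘ₗ n.br (actOne r a s) =
        (l ∘ₗ actTwo r a) ∘ₗ n.br s - (l ∘ₗ n.br s) ∘ₗ actOne r a := fun a s => by
      refine LinearMap.ext fun t => ?_
      simp [actTwo_br]
    -- By symmetry the two contributions with coefficient 1/2 add up to the full bracket in the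
    -- odd-odd case.
    have e3 : n.br y.2.1 x.2.1 = n.br x.2.1 y.2.1 := n.symm _ _
    rw [e1, map_sub n.br, LinearMap.comp_sub, e2, e2]
    simp only [map_sub, LinearMap.comp_apply, e3]
    rcases zmodTwo_cases p with rfl | rfl <;> rcases zmodTwo_cases q with rfl | rfl
    · simp only [par_zero hx, par_zero hy, koszul_zero_left, map_zero, LinearMap.comp_zero,
        LinearMap.zero_comp, LinearMap.zero_apply]
      module
    · simp only [par_zero hx, par_one hy, koszul_zero_left, map_zero, LinearMap.comp_zero,
        LinearMap.zero_comp, LinearMap.zero_apply]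
      module
    · simp only [par_one hx, par_zero hy, koszul_zero_right, map_zero, LinearMap.comp_zero,
        LinearMap.zero_comp, LinearMap.zero_apply]
      module
    · simp only [par_one hx, par_one hy, koszul_one_one, map_zero, LinearMap.comp_zero,
        LinearMap.zero_comp, LinearMap.zero_apply]
      module
  · rw [← linθ_proj]
    generalize (LinearMap.proj α : Module.Dual ℂ (ι → ℂ)) = l
    simp only [LinearMap.sub_apply, LinearMap.smul_apply, Module.End.mul_apply]
    simp only [lieAct_linθ, map_add, map_neg, map_smul, lieAct_one r hx,
      lieAct_one r hy, smul_zero, SP.bracket]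
    have e1 : l ∘ₗ actOne r ⁅x.1, y.1⁆ =
        (l ∘ₗ actOne r x.1) ∘ₗ actOne r y.1 - (l ∘ₗ actOne r y.1) ∘ₗ actOne r x.1 := by
      refine LinearMap.ext fun w => ?_
      simp [actOne_lie]
    rw [e1]
    simp only [map_sub, LinearMap.comp_apply]
    rcases zmodTwo_cases p with rfl | rfl <;> rcases zmodTwo_cases q with rfl | rfl
    · simp only [par_zero hx, par_zero hy, koszul_zero_left, map_zero]
      module
    · simp only [par_zero hx, par_one hy, koszul_zero_left, map_zero, LinearMap.comp_zero,
        LinearMap.zero_comp, LinearMap.zero_apply]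
      module
    · simp only [par_one hx, par_zero hy, koszul_zero_right, map_zero, LinearMap.comp_zero,
        LinearMap.zero_comp, LinearMap.zero_apply]
      module
    · simp only [par_one hx, par_one hy, koszul_one_one, map_zero, LinearMap.comp_zero,
        LinearMap.zero_comp, LinearMap.zero_apply]
      module

end Forms
end PureSpinor

namespace PureSpinor
set_option linter.unusedSectionVars false
set_option linter.unusedSimpArgs false
variable {ι κ : Type} [Fintype ι] [DecidableEq ι] [Fintype κ] [DecidableEq κ]

/-! ## The algebra `C^•(𝔫)` -/

namespace CE

/-- The algebra generators of `C^•(𝔫)`. -/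
def gens (ι κ : Type) [DecidableEq κ] : Set (CE ι κ) := Set.range lam ∪ Set.range v

theorem forall_gens {p : CE ι κ → Prop} (h1 : ∀ α, p (lam α)) (h2 : ∀ μ, p (v μ)) :
    ∀ a ∈ gens ι κ, p a := by
  rintro a (⟨α, rfl⟩ | ⟨μ, rfl⟩)
  exacts [h1 α, h2 μ]

/-- Linear combinations of the generators `v^μ`. -/
def odd : (κ → ℂ) →ₗ[ℂ] CE ι κ :=
  (Algebra.TensorProduct.includeRight : _ →ₐ[ℂ] CE ι κ).toLinearMap ∘ₗ ExteriorAlgebra.ι ℂ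

theorem odd_eq_sum (m : κ → ℂ) : (odd m : CE ι κ) = ∑ μ, m μ • v μ := by
  have h : m = ∑ μ, m μ • (Pi.single μ 1 : κ → ℂ) := by
    ext β; simp [Finset.sum_apply, Pi.single_apply]
  conv_lhs => rw [h]
  simp only [map_sum, map_smul]; rfl

theorem adjoin_gens : Algebra.adjoin ℂ (gens ι κ) = ⊤ := by
  set T := Algebra.adjoin ℂ (gens ι κ) with hT
  have h2 : ∀ P : MvPolynomial ι ℂ, (P ⊗ₜ[ℂ] 1 : CE ι κ) ∈ T := fun P => by
    induction P using MvPolynomial.induction_on with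
    | C c => exact T.algebraMap_mem c
    | add p q hp hq => rw [TensorProduct.add_tmul]; exact T.add_mem hp hq
    | mul_X p α hp =>
      have := T.mul_mem hp (Algebra.subset_adjoin (Or.inl ⟨α, rfl⟩))
      rwa [lam, Algebra.TensorProduct.tmul_mul_tmul, mul_one] at this
  have h3 : ∀ w : ExteriorAlgebra ℂ (κ → ℂ), ((1 : MvPolynomial ι ℂ) ⊗ₜ[ℂ] w) ∈ T := fun w => by
    induction w using ExteriorAlgebra.induction with
    | algebraMap c =>
      have : ((1 : MvPolynomial ι ℂ) ⊗ₜ[ℂ] algebraMap ℂ _ c : CE ι κ) = algebraMap ℂ _ c :=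
        (Algebra.TensorProduct.includeRight : _ →ₐ[ℂ] CE ι κ).commutes c
      rw [this]; exact T.algebraMap_mem c
    | ι m =>
      change odd m ∈ T
      rw [odd_eq_sum]
      exact sum_mem fun μ _ => T.smul_mem (Algebra.subset_adjoin (Or.inr ⟨μ, rfl⟩)) _
    | mul a b ha hb =>
      have := T.mul_mem ha hb
      rwa [Algebra.TensorProduct.tmul_mul_tmul, one_mul] at this
    | add a b ha hb => rw [TensorProduct.tmul_add]; exact T.add_mem ha hb
  rw [eq_top_iff]
  rintro z -
  induction z using TensorProduct.induction_on with
  | zero => exact T.zero_mem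
  | add a b ha hb => exact T.add_mem ha hb
  | tmul e w =>
    have := T.mul_mem (h2 e) (h3 w)
    rwa [Algebra.TensorProduct.tmul_mul_tmul, one_mul, mul_one] at this

/-- The sign automorphism given by the total parity. -/
def sgn : CE ι κ →ₐ[ℂ] CE ι κ :=
  Algebra.TensorProduct.map (AlgHom.id ℂ _)
    (CliffordAlgebra.involute (Q := (0 : QuadraticForm ℂ (κ → ℂ))))

theorem sgn_tmul (e : MvPolynomial ι ℂ) (w : ExteriorAlgebra ℂ (κ → ℂ)) :
    sgn (e ⊗ₜ[ℂ] w : CE ι κ) = e ⊗ₜ CliffordAlgebra.involute w := rfl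

theorem sign_eq : (sign : Module.End ℂ (CE ι κ)) = sgn.toLinearMap := by
  refine TensorProduct.ext' fun P w => ?_
  rfl

@[simp] theorem sgn_lam (α : ι) : sgn (lam α : CE ι κ) = lam α := by
  rw [lam, sgn_tmul, map_one]

@[simp] theorem sgn_v (μ : κ) : sgn (v μ : CE ι κ) = -v μ := by
  rw [v, sgn_tmul]
  rw [ExteriorAlgebra.ι, CliffordAlgebra.involute_ι, TensorProduct.tmul_neg]

theorem lam_central (α : ι) (a : CE ι κ) : lam α * a = a * lam α :=
  Algebra.commutes (MvPolynomial.X α : MvPolynomial ι ℂ) a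

theorem isSuperComm : IsSuperComm (sgn (ι := ι) (κ := κ)) (gens ι κ) where
  adjoin := adjoin_gens
  sq a := by
    induction a using TensorProduct.induction_on with
    | zero => simp
    | add a b ha hb => rw [map_add, map_add, ha, hb]
    | tmul e w => rw [sgn_tmul, sgn_tmul, CliffordAlgebra.involute_involute]
  gen := by
    refine forall_gens (fun α => Or.inl ⟨sgn_lam α, lam_central α⟩) (fun μ => Or.inr ⟨sgn_v μ, ?_⟩)
    refine forall_gens (fun α => by rw [sgn_lam, lam_central]) (fun ν => ?_)
    rw [sgn_v]
    refine Eq.trans ?_ (neg_mul (v ν) (v μ)).symm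
    rw [v, v, Algebra.TensorProduct.tmul_mul_tmul, Algebra.TensorProduct.tmul_mul_tmul,
      ← TensorProduct.tmul_neg,
      eq_neg_of_add_eq_zero_left (ExteriorAlgebra.ι_add_mul_swap _ _)]

/-! ### Coordinate derivations of C(𝔫). -/

section Partials

variable (μ ν : κ) (α β : ι)

@[simp] theorem dlam_v : dlam α (v μ : CE ι κ) = 0 := by
  have : (MvPolynomial.pderiv α).toLinearMap (1 : MvPolynomial ι ℂ) = 0 :=
    MvPolynomial.pderiv_one
  rw [v, dlam, LinearMap.rTensor_tmul, this, TensorProduct.zero_tmul]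

@[simp] theorem dlam_lam : dlam α (lam β : CE ι κ) = (if α = β then 1 else 0 : ℂ) • 1 := by
  have : (MvPolynomial.pderiv α).toLinearMap (MvPolynomial.X β : MvPolynomial ι ℂ) =
      (if α = β then 1 else 0 : ℂ) • 1 := by
    refine (MvPolynomial.pderiv_X α β).trans ?_
    by_cases h : α = β
    · subst h; simp
    · simp [h, Ne.symm h]
  rw [lam, dlam, LinearMap.rTensor_tmul, this]
  rfl

@[simp] theorem dv_lam : dv μ (lam β : CE ι κ) = 0 := by
  rw [lam, dv, LinearMap.lTensor_tmul, CliffordAlgebra.contractLeft_one, TensorProduct.tmul_zero]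

@[simp] theorem dv_v : dv μ (v ν : CE ι κ) = (if μ = ν then 1 else 0 : ℂ) • 1 := by
  rw [v, dv, LinearMap.lTensor_tmul]
  rw [ExteriorAlgebra.ι, CliffordAlgebra.contractLeft_ι, ← Algebra.algebraMap_eq_smul_one]
  refine ((Algebra.TensorProduct.includeRight : _ →ₐ[ℂ] CE ι κ).commutes _).trans ?_
  simp only [LinearMap.proj_apply, Pi.single_apply]

theorem dv_isSuperDer : IsSuperDer (sgn (ι := ι)) 1 (dv μ) :=
  .of_gen adjoin_gens (isTwistedDer_lTensor (isTwistedDer_contractLeft _))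
    (forall_gens (by simp) fun ν => by
      rw [dv_v, sgn_v, map_neg, dv_v, koszul_one_one, map_smul, map_one]
      module)

theorem dlam_isSuperDer : IsSuperDer (sgn (κ := κ)) 0 (dlam α) := by
  refine .of_gen adjoin_gens (isTwistedDer_rTensor fun a b => ?_)
    (forall_gens (by simp [koszul]) (by simp))
  have := (MvPolynomial.pderiv α).leibniz a b
  simp only [smul_eq_mul] at this
  change MvPolynomial.pderiv α (a * b) = MvPolynomial.pderiv α a * b + a * MvPolynomial.pderiv α b
  rw [this]; ring

end Partials

/-! ### The Chevalley–Eilenberg differential and the coadjoint action as superderivations. -/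

variable (n : TwoStep ι κ) {G : Type*} [LieRing G] [LieAlgebra ℂ G] (r : G →ₗ⁅ℂ⁆ n.aut)

@[simp] theorem d_lam (α : ι) : d n (lam α) = 0 := by simp [d, LinearMap.sum_apply]

theorem d_v (μ : κ) : d n (v μ) = ∑ α, ∑ β, n.f μ α β • (lam α * lam β) := by
  simp [d, LinearMap.sum_apply]

theorem d_isSuperDer : IsSuperDer sgn 1 (d n) :=
  .sum _ fun μ => IsSuperDer.mulLeft (q := 0) isSuperComm (dv_isSuperDer μ) (by simp [koszul])

variable {n}

theorem rep_apply (a : G) (c : CE ι κ) : rep r a c =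
    -(∑ α, ∑ β, entryOne r α β a • (lam β * dlam α c)) -
      ∑ μ, ∑ ν, entryTwo r μ ν a • (v ν * dv μ c) := by
  simp [rep, LinearMap.sum_apply]

theorem rep_lam (a : G) (α : ι) :
    rep r a (lam α : CE ι κ) = -∑ β, entryOne r α β a • lam β := by
  simp [rep_apply, Finset.sum_ite_eq', ← Finset.smul_sum, Finset.sum_comm (γ := ι)]

theorem rep_v (a : G) (μ : κ) : rep r a (v μ : CE ι κ) = -∑ ν, entryTwo r μ ν a • v ν := by
  simp [rep_apply]

theorem rep_isSuperDer (a : G) : IsSuperDer sgn 0 (rep r a) := by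
  have h : rep r a = (-1 : ℂ) • ((∑ α, ∑ β, entryOne r α β a •
      (LinearMap.mulLeft ℂ (lam β) ∘ₗ dlam α)) +
      ∑ μ, ∑ ν, entryTwo r μ ν a • (LinearMap.mulLeft ℂ (v ν) ∘ₗ dv μ)) := by
    refine LinearMap.ext fun c => ?_
    simp only [rep, LinearMap.coe_mk, AddHom.coe_mk, LinearMap.sub_apply, LinearMap.neg_apply,
      LinearMap.smul_apply, LinearMap.add_apply, neg_smul, one_smul]
    abel
  rw [h]
  exact .smul (.add
    (.sum _ fun α => .sum _ fun β => .smul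
      (IsSuperDer.mulLeft (q := 0) isSuperComm (dlam_isSuperDer α) (by simp [koszul])) _)
    (.sum _ fun μ => .sum _ fun ν => .smul
      (IsSuperDer.mulLeft (q := 1) isSuperComm (dv_isSuperDer μ) (by
        rw [sgn_v, koszul_one_one]; module)) _)) _

end CE

/-! ## Compatibility of `C^•(𝔫) → Ω^•(N)` with the structures -/

namespace Forms

variable (n : TwoStep ι κ) {G : Type*} [LieRing G] [LieAlgebra ℂ G] (r : G →ₗ⁅ℂ⁆ n.aut)

@[simp] theorem ofCE_lam (α : ι) : ofCE n (CE.lam α) = dθ α := by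
  simp [ofCE, CE.lam, dθ]

@[simp] theorem ofCE_v (μ : κ) : ofCE n (CE.v μ) = shifted n μ := by
  simp [ofCE, CE.v]

theorem dθ_eq (α : ι) : (dθ α : Forms ι κ) = d (linθ (LinearMap.proj α)) := by
  rw [linθ_proj, d_θ]

/-- The forms `dx^μ + λ f^μ θ`, contracted with a linear form. -/
def linShifted : Module.Dual ℂ (κ → ℂ) →ₗ[ℂ] Forms ι κ where
  toFun l := d (linX l) + ∑ α, dθ α * linθ ((1 / 2 : ℂ) • l ∘ₗ n.br (Pi.single α 1))
  map_add' l l' := by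
    simp only [map_add, LinearMap.add_comp, smul_add, mul_add, Finset.sum_add_distrib]; abel
  map_smul' c l := by
    simp only [map_smul, LinearMap.smul_comp, smul_comm _ c, mul_smul_comm, Finset.smul_sum,
      smul_add, RingHom.id_apply]

theorem linShifted_apply (l : Module.Dual ℂ (κ → ℂ)) : linShifted n l =
    d (linX l) + ∑ α, dθ α * linθ ((1 / 2 : ℂ) • l ∘ₗ n.br (Pi.single α 1)) := rfl

theorem linShifted_proj (μ : κ) : linShifted n (LinearMap.proj μ) = shifted n μ := by
  rw [linShifted_apply, linX_proj, d_coord, shifted]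
  congr 1
  refine Finset.sum_congr rfl fun α _ => ?_
  rw [linθ_apply, Finset.mul_sum]
  refine Finset.sum_congr rfl fun β _ => ?_
  rw [mul_smul_comm]
  rfl

theorem linShifted_eq_sum (l : Module.Dual ℂ (κ → ℂ)) :
    linShifted n l = ∑ μ, l (Pi.single μ 1) • shifted n μ := by
  conv_lhs => rw [dual_eq_sum l]
  simp only [map_sum, map_smul, linShifted_proj]

theorem sgn_shifted (μ : κ) : sgn (shifted n μ) = -shifted n μ := by
  simp [shifted, add_comm]

/-- ψ preserves total parity. This makes the twists agree when d is composed with ψ on either side.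
-/
theorem sgn_comp_ofCE : sgn.comp (ofCE n) = (ofCE n).comp CE.sgn := by
  refine AlgHom.ext_of_adjoin_eq_top CE.adjoin_gens (CE.forall_gens ?_ ?_)
  · simp
  · simp [sgn_shifted]

/-- The exact term dx drops out, and dθ is even and closed, so only θ is differentiated. The result
is the image of the Chevalley–Eilenberg differential of v. -/
theorem d_shifted (μ : κ) :
    d (shifted n μ) = ∑ α, ∑ β, n.f μ α β • (dθ α * dθ β) := by
  simp [shifted, d_isSuperDer.leibniz (dθ _) _]

/-- The two composites are derivations with the same twists, so the generators λ and v suffice; the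
latter is `d_shifted`. -/
theorem d_ofCE (c : CE ι κ) : d (ofCE n c) = ofCE n (CE.d n c) := by
  have h1 := d_isSuperDer.leibniz.comp_right (ofCE n)
  have h2 := (CE.d_isSuperDer n).leibniz.comp_left (ofCE n)
  rw [signPow_one] at h1 h2
  rw [sgn_comp_ofCE] at h1
  refine LinearMap.congr_fun (h1.ext h2 CE.adjoin_gens (CE.forall_gens ?_ ?_)) c
  · simp
  · simp [CE.d_v, d_shifted]

variable {n}

theorem IsLie.apply_d {p : ZMod 2} {P : Module.End ℂ (Forms ι κ)} (hP : IsLie p P)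
    (a : Forms ι κ) : P (d a) = koszul 1 p • d (P a) := by
  have h1 := LinearMap.congr_fun hP.comm a
  simp only [Module.End.mul_apply, LinearMap.smul_apply] at h1
  rw [h1, smul_smul, koszul_one_mul_self, one_smul]

theorem d_linθ (l : Module.Dual ℂ (ι → ℂ)) :
    d (linθ l : Forms ι κ) = ∑ α, l (Pi.single α 1) • dθ α := by
  simp [linθ_apply]

/-- Again a comparison of twisted derivations on generators. On λ it is the coadjoint action; on v
it expresses the invariance of the bracket under 𝔤₀. The 𝔫₂-component of `x` plays no role because
the images of the generators have constant coefficients in x. -/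
theorem lieAct_ofCE_even {x : SP G ι κ} (hx : x ∈ SP.par G ι κ 0) (c : CE ι κ) :
    lieAct r x (ofCE n c) = ofCE n (CE.rep r x.1 c) := by
  have hP := lieAct_isLie r hx
  have h1 := hP.der.leibniz.comp_right (ofCE n)
  have h2 := (CE.rep_isSuperDer r x.1).leibniz.comp_left (ofCE n)
  have hd1 := d_isSuperDer.leibniz.map_one (A := Forms ι κ)
  have hθ : ∀ α, lieAct r x (dθ α : Forms ι κ) =
      -∑ β, (actOne r x.1 (Pi.single β 1)) α • dθ β := fun α => by
    rw [dθ_eq, hP.apply_d, lieAct_linθ, par_zero hx, koszul_one_zero, one_smul, map_zero,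
      zero_smul, add_zero, map_neg, d_linθ]
    rfl
  refine LinearMap.congr_fun (h1.ext h2 CE.adjoin_gens (CE.forall_gens (fun α => ?_)
    (fun μ => ?_))) c
  · simp only [LinearMap.comp_apply, AlgHom.toLinearMap_apply, ofCE_lam, CE.rep_lam, hθ, map_neg,
      map_sum, map_smul]
    rfl
  · have hr : ofCE n (CE.rep r x.1 (CE.v μ)) =
        -linShifted n (LinearMap.proj μ ∘ₗ actTwo r x.1) := by
      rw [CE.rep_v, linShifted_eq_sum, map_neg, map_sum]
      simp only [map_smul, ofCE_v]
      rfl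
    simp only [LinearMap.comp_apply, AlgHom.toLinearMap_apply, ofCE_v, hr, ← linShifted_proj]
    generalize (LinearMap.proj μ : Module.Dual ℂ (κ → ℂ)) = l
    have hm : ∀ α, lieAct r x (dθ α * linθ ((1 / 2 : ℂ) • l ∘ₗ n.br (Pi.single α 1))) =
        -((∑ β, (actOne r x.1 (Pi.single β 1)) α • dθ β) *
          linθ ((1 / 2 : ℂ) • l ∘ₗ n.br (Pi.single α 1))) -
        dθ α * linθ ((1 / 2 : ℂ) • (l ∘ₗ n.br (Pi.single α 1)) ∘ₗ actOne r x.1) := fun α => by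
      rw [hP.der.leibniz, hθ, lieAct_linθ, par_zero hx, map_zero, zero_smul, add_zero,
        signPow_zero, AlgHom.id_apply, AlgHom.id_apply, neg_mul, mul_neg, LinearMap.smul_comp,
        sub_eq_add_neg]
    -- Transposition: the matrix acting on dθ is moved onto the first argument of the bracket by
    -- exchanging the two sums.
    have hs : ∑ α, (∑ β, (actOne r x.1 (Pi.single β 1)) α • dθ β) *
          linθ ((1 / 2 : ℂ) • l ∘ₗ n.br (Pi.single α 1)) =
        (∑ β, dθ β * linθ ((1 / 2 : ℂ) • l ∘ₗ n.br (actOne r x.1 (Pi.single β 1))) :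
          Forms ι κ) := by
      simp only [Finset.sum_mul]
      rw [Finset.sum_comm]
      refine Finset.sum_congr rfl fun β _ => ?_
      have hv : actOne r x.1 (Pi.single β 1) =
          ∑ α, (actOne r x.1 (Pi.single β 1)) α • (Pi.single α 1 : ι → ℂ) := by
        ext β; simp [Finset.sum_apply, Pi.single_apply]
      -- Exhibits the expression as a composite of linear maps in `y`, so that it can be expanded
      -- along basis vectors.
      have hl : ∀ y : ι → ℂ, linθ ((1 / 2 : ℂ) • l ∘ₗ n.br y) =
          ((linθ (κ := κ) ∘ₗ ((1 / 2 : ℂ) • LinearMap.llcomp ℂ _ _ _ l)) ∘ₗ n.br) y :=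
        fun y => rfl
      have he : linθ ((1 / 2 : ℂ) • l ∘ₗ n.br (actOne r x.1 (Pi.single β 1))) =
          (∑ α, (actOne r x.1 (Pi.single β 1)) α •
            linθ ((1 / 2 : ℂ) • l ∘ₗ n.br (Pi.single α 1)) : Forms ι κ) := by
        rw [hl]
        conv_lhs => rw [hv]
        rw [map_sum]
        exact Finset.sum_congr rfl fun α _ => map_smul _ _ _
      rw [he]
      simp only [Finset.mul_sum, smul_mul_assoc, mul_smul_comm]
    -- The derivation property of the bracket, which matches the action on the dθ f θ term with that
    -- on dx.
    have hb : ∀ β, (l ∘ₗ actTwo r x.1) ∘ₗ n.br (Pi.single β 1) =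
        l ∘ₗ n.br (actOne r x.1 (Pi.single β 1)) +
          (l ∘ₗ n.br (Pi.single β 1)) ∘ₗ actOne r x.1 := fun β => by
      refine LinearMap.ext fun t => ?_
      simp [actTwo_br]
    rw [linShifted_apply, linShifted_apply, map_add, map_sum, hP.apply_d, lieAct_linX,
      par_zero hx, koszul_one_zero, one_smul, map_zero, LinearMap.comp_zero, smul_zero, map_zero,
      add_zero, map_add, map_neg, map_smul, hd1, smul_zero, add_zero, neg_add]
    simp only [hm, hb, smul_add, map_add, mul_add, Finset.sum_sub_distrib,
      Finset.sum_neg_distrib, hs, Finset.sum_add_distrib]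
    abel

/-- For s = x.2.1, the Lie derivative of dx is minus the differential of a linear function of θ, by
oddness of s, while on dθ f θ only θ is hit and gives dθ f s. By symmetry of the bracket the two
contributions cancel; this is what fixes the shift dθ f θ and its coefficient. -/
theorem lieAct_ofCE_odd {x : SP G ι κ} (hx : x ∈ SP.par G ι κ 1) (c : CE ι κ) :
    lieAct r x (ofCE n c) = 0 := by
  have hP := lieAct_isLie r hx
  have h1 := hP.der.leibniz.comp_right (ofCE n)
  have hd1 := d_isSuperDer.leibniz.map_one (A := Forms ι κ)
  have hθ : ∀ α, lieAct r x (dθ α : Forms ι κ) = 0 := fun α => by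
    rw [dθ_eq, hP.apply_d, lieAct_linθ, (par_one hx).1, map_zero, LinearMap.comp_zero, map_zero,
      neg_zero, zero_add, map_smul, hd1, smul_zero, smul_zero]
  refine LinearMap.congr_fun (h1.ext .zero CE.adjoin_gens (CE.forall_gens (fun α => ?_)
    (fun μ => ?_))) c
  · simp [hθ]
  · simp only [LinearMap.comp_apply, AlgHom.toLinearMap_apply, ofCE_v, ← linShifted_proj]
    generalize (LinearMap.proj μ : Module.Dual ℂ (κ → ℂ)) = l
    have hm : ∀ α, lieAct r x (dθ α * linθ ((1 / 2 : ℂ) • l ∘ₗ n.br (Pi.single α 1))) =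
        ((1 / 2 : ℂ) • l ∘ₗ n.br x.2.1) (Pi.single α 1) • dθ α := fun α => by
      rw [hP.der.leibniz, hθ, lieAct_linθ, (par_one hx).1, map_zero, LinearMap.comp_zero,
        map_zero, neg_zero, zero_add, zero_mul, zero_add, signPow_one, sgn_dθ, mul_smul_comm,
        mul_one]
      simp only [LinearMap.smul_apply, LinearMap.comp_apply, n.symm x.2.1]
    rw [linShifted_apply, map_add, map_sum, hP.apply_d, lieAct_linX, (par_one hx).1,
      (par_one hx).2, koszul_one_one, map_zero, map_zero, LinearMap.comp_zero, map_zero, neg_zero,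
      zero_add, zero_smul, zero_add, d_linθ]
    simp only [hm, neg_smul, one_smul, neg_add_cancel, LinearMap.zero_apply]

theorem evenPart_add_oddPart (x : SP G ι κ) : x = (x.1, 0, x.2.2) + (0, x.2.1, 0) := by simp

theorem evenPart_mem (x : SP G ι κ) : (x.1, 0, x.2.2) ∈ SP.par G ι κ 0 := by
  simp [SP.par, Submodule.mem_prod]

theorem oddPart_mem (x : SP G ι κ) : (0, x.2.1, 0) ∈ SP.par G ι κ 1 := by
  simp [SP.par, Submodule.mem_prod]

end Forms
end PureSpinor

namespace PureSpinor
set_option linter.unusedSectionVars false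
set_option linter.unusedSimpArgs false
variable {ι κ : Type} [Fintype ι] [DecidableEq ι] [Fintype κ] [DecidableEq κ]

/-! ## Gradings by eigenspaces -/

section Eigen

variable {R E J : Type*} [CommRing R] [AddCommGroup E] [Module ℂ E] [Module R E]
  {A : J → Submodule R E} {δ : Module.End ℂ E} {χ : J → ℂ}

/-- The graded pieces are submodules over `R`, while the eigenspaces are only complex subspaces,
since `δ` need not be `R`-linear. The two lattices are therefore compared element by element. -/
theorem mem_iSup_eigenspace (h : ∀ i, ∀ e ∈ A i, δ e = χ i • e) {i : J} {e : E}
    (he : e ∈ ⨆ j, ⨆ (_ : j ≠ i), A j) : e ∈ ⨆ j, ⨆ (_ : j ≠ i), δ.eigenspace (χ j) := by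
  rw [iSup_subtype'] at he
  induction he using Submodule.iSup_induction' with
  | mem j e he =>
    have : δ.eigenspace (χ j) ≤ ⨆ j, ⨆ (_ : j ≠ i), δ.eigenspace (χ j) :=
      le_iSup₂_of_le (f := fun j (_ : j ≠ i) => δ.eigenspace (χ j)) j.1 j.2 le_rfl
    exact this (Module.End.mem_eigenspace_iff.mpr (h _ _ he))
  | zero => exact Submodule.zero_mem _
  | add a b _ _ ha hb => exact Submodule.add_mem _ ha hb

/-- Eigenspaces for distinct eigenvalues are independent. -/
theorem eq_zero_of_eigen (hχ : Function.Injective χ) (h : ∀ i, ∀ e ∈ A i, δ e = χ i • e) {i : J}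
    {e : E} (he : δ e = χ i • e) (he' : e ∈ ⨆ j, ⨆ (_ : j ≠ i), A j) : e = 0 := by
  have hi := δ.eigenspaces_iSupIndep.comp hχ
  exact Submodule.disjoint_def.mp (hi i) e (Module.End.mem_eigenspace_iff.mpr he)
    (mem_iSup_eigenspace h he')

/-- A spanning family of submodules contained in distinct eigenspaces is a grading. -/
theorem isInternal_of_eigen [DecidableEq J] (hχ : Function.Injective χ)
    (h : ∀ i, ∀ e ∈ A i, δ e = χ i • e) (htop : ⨆ i, A i = ⊤) : DirectSum.IsInternal A := by
  rw [DirectSum.isInternal_submodule_iff_iSupIndep_and_iSup_eq_top]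
  refine ⟨fun i => Submodule.disjoint_def.mpr fun e he he' => ?_, htop⟩
  exact eq_zero_of_eigen hχ h (h i e he) he'

/-- The members of such a family are the eigenspaces. -/
theorem mem_iff_eigen (hχ : Function.Injective χ)
    (h : ∀ i, ∀ e ∈ A i, δ e = χ i • e) (htop : ⨆ i, A i = ⊤) {i : J} {e : E} :
    e ∈ A i ↔ δ e = χ i • e := by
  refine ⟨h i e, fun he => ?_⟩
  have : e ∈ A i ⊔ ⨆ j, ⨆ (_ : j ≠ i), A j := by
    rw [← iSup_split_single, htop]; trivial
  obtain ⟨a, ha, b, hb, rfl⟩ := Submodule.mem_sup.mp this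
  have : b = 0 := eq_zero_of_eigen hχ h (by
    rw [map_add, h i a ha, smul_add] at he
    exact add_left_cancel he) hb
  rwa [this, add_zero]

end Eigen

/-- The eigenvalue of the scaling automorphisms on the part of degree `k` and parity `p`. -/
def weight (k : ℤ) (p : ZMod 2) : ℂ := 2 ^ k * koszul 1 p

theorem weight_add (k k' : ℤ) (p p' : ZMod 2) :
    weight (k + k') (p + p') = weight k p * weight k' p' := by
  rw [weight, weight, weight, koszul_one_add, zpow_add₀ two_ne_zero]; ring

/-- The modulus 2^k recovers the degree and the remaining sign recovers the parity. -/
theorem weight_injective : Function.Injective fun d : ℤ × ZMod 2 => weight d.1 d.2 := by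
  rintro ⟨k, p⟩ ⟨k', p'⟩ h
  simp only [weight] at h
  have hn : ∀ q : ZMod 2, ‖koszul 1 q‖ = 1 := fun q => by
    rcases zmodTwo_cases q with rfl | rfl <;> simp [koszul]
  have hk : k = k' := by
    have := congrArg norm h
    simp only [norm_mul, hn, mul_one, norm_zpow, Complex.norm_ofNat] at this
    exact zpow_right_injective₀ (by norm_num : (0 : ℝ) < 2) (by norm_num) this
  subst hk
  have hp : koszul 1 p = koszul 1 p' := mul_left_cancel₀ (zpow_ne_zero k two_ne_zero) h
  have h1 : (1 : ℂ) ≠ -1 := by norm_num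
  rcases zmodTwo_cases p with rfl | rfl <;> rcases zmodTwo_cases p' with rfl | rfl
  · rfl
  · exact absurd hp h1
  · exact absurd hp.symm h1
  · rfl

/-- An element of the j-th power is a sum of products of j elements of `M`, each contributing one
factor `c`. It serves both homogeneous polynomials and exterior powers. -/
theorem algHom_apply_of_mem_pow {A B : Type*} [Ring A] [Algebra ℂ A] [Ring B] [Algebra ℂ B]
    {M : Submodule ℂ A} (g g' : A →ₐ[ℂ] B) {c : ℂ} (h : ∀ m ∈ M, g m = c • g' m) {j : ℕ} {x : A}
    (hx : x ∈ M ^ j) : g x = c ^ j • g' x := by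
  induction hx using Submodule.pow_induction_on_left' with
  | algebraMap r => simp
  | add x y i _ _ hx hy => rw [map_add, map_add, hx, hy, smul_add]
  | mem_mul m hm i x _ hx =>
    rw [map_mul, map_mul, h m hm, hx, smul_mul_smul_comm, pow_succ', mul_comm]

theorem aeval_smul_X_of_homogeneous (c : ℂ) {i : ℕ} {P : MvPolynomial ι ℂ}
    (hP : P ∈ MvPolynomial.homogeneousSubmodule ι ℂ i) :
    MvPolynomial.aeval (fun α => c • (MvPolynomial.X α : MvPolynomial ι ℂ)) P = c ^ i • P := by
  rw [← MvPolynomial.homogeneousSubmodule_one_pow] at hP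
  refine algHom_apply_of_mem_pow _ (AlgHom.id ℂ _) (fun m hm => ?_) hP
  rw [MvPolynomial.homogeneousSubmodule_one_eq_span_X] at hm
  induction hm using Submodule.span_induction with
  | mem m hm => obtain ⟨α, rfl⟩ := hm; simp
  | zero => simp
  | add a b _ _ ha hb => rw [map_add, map_add, ha, hb, smul_add]
  | smul r a _ ha => rw [map_smul, map_smul, ha, smul_comm]

theorem exteriorMap_of_mem_pow {M N : Type*} [AddCommGroup M] [Module ℂ M] [AddCommGroup N]
    [Module ℂ N] (f g : M →ₗ[ℂ] N) {c : ℂ} (h : ∀ m, f m = c • g m) {j : ℕ}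
    {w : ExteriorAlgebra ℂ M} (hw : w ∈ ⋀[ℂ]^j M) :
    ExteriorAlgebra.map f w = c ^ j • ExteriorAlgebra.map g w := by
  refine algHom_apply_of_mem_pow _ _ (fun m hm => ?_) hw
  obtain ⟨m, rfl⟩ := hm
  rw [ExteriorAlgebra.map_apply_ι, ExteriorAlgebra.map_apply_ι, h, map_smul]

theorem involute_of_mem_evenOdd {M : Type*} [AddCommGroup M] [Module ℂ M] {p : ZMod 2}
    {w : ExteriorAlgebra ℂ M} (hw : w ∈ CliffordAlgebra.evenOdd (0 : QuadraticForm ℂ M) p) :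
    CliffordAlgebra.involute w = koszul 1 p • w := by
  rcases zmodTwo_cases p with rfl | rfl
  · rw [CliffordAlgebra.involute_eq_of_mem_even hw, koszul_one_zero, one_smul]
  · rw [CliffordAlgebra.involute_eq_of_mem_odd hw, koszul_one_one, neg_smul, one_smul]

/-! ## The grading of `C^•(𝔫)` -/

namespace CE

/-- The automorphism with eigenvalue `2^k (-1)^p` in degree `k` and parity `p`. -/
def scale : CE ι κ →ₐ[ℂ] CE ι κ :=
  Algebra.TensorProduct.map (MvPolynomial.aeval fun α => (-2 : ℂ) • MvPolynomial.X α)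
    (ExteriorAlgebra.map ((2 : ℂ) • LinearMap.id))

@[simp] theorem scale_lam (α : ι) : scale (lam α : CE ι κ) = (-2 : ℂ) • lam α := by
  rw [scale, lam, Algebra.TensorProduct.map_tmul, MvPolynomial.aeval_X, map_one]; rfl

@[simp] theorem scale_v (μ : κ) : scale (v μ : CE ι κ) = (2 : ℂ) • v μ := by
  rw [scale, v, Algebra.TensorProduct.map_tmul, ExteriorAlgebra.map_apply_ι, map_one]
  simp

/-- λ has degree one and odd intrinsic parity, hence scales by -2; v has degree one and even
intrinsic parity, hence scales by 2. -/
theorem two_pow_mul (i j : ℕ) : (-2 : ℂ) ^ i * 2 ^ j = weight ((i : ℤ) + j) i := by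
  have h : ((-1 : ℂ)) ^ i = koszul 1 i := by
    induction i with
    | zero => simp [koszul]
    | succ i ih => rw [pow_succ, ih, Nat.cast_succ, koszul_one_add, koszul_one_one]
  rw [neg_pow, h, weight, zpow_add₀ two_ne_zero, zpow_natCast, zpow_natCast]; ring

theorem scale_of_mem_gr {k : ℤ} {p : ZMod 2} {c : CE ι κ} (hc : c ∈ gr ι κ k p) :
    scale c = weight k p • c := by
  induction hc using Submodule.span_induction with
  | mem c hc =>
    obtain ⟨i, j, rfl, rfl, P, hP, w, hw, rfl⟩ := hc
    rw [scale, Algebra.TensorProduct.map_tmul, aeval_smul_X_of_homogeneous _ hP,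
      exteriorMap_of_mem_pow _ LinearMap.id (fun m => rfl) hw, ExteriorAlgebra.map_id,
      TensorProduct.smul_tmul_smul, two_pow_mul]
    rfl
  | zero => simp
  | add a b _ _ ha hb => rw [map_add, ha, hb, smul_add]
  | smul r a _ ha => rw [map_smul, ha, smul_comm]

theorem iSup_gr : ⨆ d : ℤ × ZMod 2, gr ι κ d.1 d.2 = ⊤ := by
  rw [eq_top_iff]
  rintro c -
  induction c using TensorProduct.induction_on with
  | zero => exact Submodule.zero_mem _
  | add a b ha hb => exact Submodule.add_mem _ ha hb
  | tmul P w =>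
    rw [← MvPolynomial.sum_homogeneousComponent P, TensorProduct.sum_tmul]
    refine Submodule.sum_mem _ fun i _ => ?_
    have hw : w ∈ ⨆ j : ℕ, LinearMap.range (CliffordAlgebra.ι (0 : QuadraticForm ℂ (κ → ℂ))) ^ j :=
      CliffordAlgebra.iSup_ι_range_eq_top (0 : QuadraticForm ℂ (κ → ℂ)) ▸ Submodule.mem_top
    induction hw using Submodule.iSup_induction' with
    | zero => rw [TensorProduct.tmul_zero]; exact Submodule.zero_mem _
    | add a b _ _ ha hb => rw [TensorProduct.tmul_add]; exact Submodule.add_mem _ ha hb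
    | mem j w hw =>
      refine Submodule.mem_iSup_of_mem ((i : ℤ) + j, (i : ZMod 2)) (Submodule.subset_span ?_)
      exact ⟨i, j, rfl, rfl, _, MvPolynomial.homogeneousComponent_mem i P, w, hw, rfl⟩

theorem isInternal_gr : DirectSum.IsInternal fun d : ℤ × ZMod 2 => gr ι κ d.1 d.2 :=
  isInternal_of_eigen (δ := scale.toLinearMap) weight_injective
    (fun _ _ he => scale_of_mem_gr he) iSup_gr

/-- Turns degree laws into identities: an operator shifts the bidegree as soon as it commutes with
`scale` up to the corresponding factor, which can be checked on generators. -/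
theorem mem_gr_iff {k : ℤ} {p : ZMod 2} {c : CE ι κ} :
    c ∈ gr ι κ k p ↔ scale c = weight k p • c :=
  mem_iff_eigen (A := fun d : ℤ × ZMod 2 => gr ι κ d.1 d.2) (δ := scale.toLinearMap)
    (i := (k, p)) weight_injective (fun _ _ he => scale_of_mem_gr he) iSup_gr

end CE

/-! ## Bijectivity of the comparison map -/

section Bijective

variable (M N : Type*) [AddCommGroup M] [Module ℂ M] [AddCommGroup N] [Module ℂ N]

/-- The exterior algebra of a direct sum. -/
theorem exists_exteriorProdEquiv : ∃ e : ExteriorAlgebra ℂ M ⊗[ℂ] ExteriorAlgebra ℂ N ≃ₗ[ℂ]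
    ExteriorAlgebra ℂ (M × N), ∀ a b, e (a ⊗ₜ b) =
      ExteriorAlgebra.map (LinearMap.inl ℂ M N) a * ExteriorAlgebra.map (LinearMap.inr ℂ M N) b := by
  let QM : QuadraticForm ℂ M := 0
  let QN : QuadraticForm ℂ N := 0
  let Q : QuadraticForm ℂ (M × N) := 0
  -- The orthogonal sum of two zero forms is the zero form, so the Clifford algebra of the sum is
  -- the exterior algebra of M × N.
  let i : (QM.prod QN).IsometryEquiv Q :=
    { LinearEquiv.refl ℂ (M × N) with map_app' := fun m => by simp [QM, QN, Q] }
  -- The graded tensor product differs from the ordinary one only in its multiplication, so as a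
  -- linear equivalence it is available without signs.
  let e := (GradedTensorProduct.of ℂ (CliffordAlgebra.evenOdd QM) (CliffordAlgebra.evenOdd QN)).trans
    ((CliffordAlgebra.prodEquiv QM QN).symm.trans
      (CliffordAlgebra.equivOfIsometry i)).toLinearEquiv
  refine ⟨e, fun a b => ?_⟩
  have h1 : e (a ⊗ₜ b) = CliffordAlgebra.equivOfIsometry i (CliffordAlgebra.toProd QM QN
    (GradedTensorProduct.tmul ℂ a b)) := rfl
  rw [h1, CliffordAlgebra.toProd, GradedTensorProduct.lift_tmul, map_mul]
  congr 1
  · have : ((CliffordAlgebra.equivOfIsometry i).toAlgHom.comp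
        (CliffordAlgebra.map (QuadraticMap.Isometry.inl QM QN))) =
        ExteriorAlgebra.map (LinearMap.inl ℂ M N) := by
      refine ExteriorAlgebra.hom_ext (LinearMap.ext fun m => ?_)
      change CliffordAlgebra.equivOfIsometry i (CliffordAlgebra.map _ (CliffordAlgebra.ι QM m)) =
        ExteriorAlgebra.map _ (ExteriorAlgebra.ι ℂ m)
      rw [CliffordAlgebra.map_apply_ι, ExteriorAlgebra.map_apply_ι]
      exact CliffordAlgebra.map_apply_ι _ _
    exact AlgHom.congr_fun this a
  · have : ((CliffordAlgebra.equivOfIsometry i).toAlgHom.comp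
        (CliffordAlgebra.map (QuadraticMap.Isometry.inr QM QN))) =
        ExteriorAlgebra.map (LinearMap.inr ℂ M N) := by
      refine ExteriorAlgebra.hom_ext (LinearMap.ext fun m => ?_)
      change CliffordAlgebra.equivOfIsometry i (CliffordAlgebra.map _ (CliffordAlgebra.ι QN m)) =
        ExteriorAlgebra.map _ (ExteriorAlgebra.ι ℂ m)
      rw [CliffordAlgebra.map_apply_ι, ExteriorAlgebra.map_apply_ι]
      exact CliffordAlgebra.map_apply_ι _ _
    exact AlgHom.congr_fun this b

end Bijective

end PureSpinor

namespace PureSpinor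
set_option linter.unusedSectionVars false
set_option linter.unusedSimpArgs false
variable {ι κ : Type} [Fintype ι] [DecidableEq ι] [Fintype κ] [DecidableEq κ]

/-! ### Shears of the algebra of forms and the reduction to the zero bracket. -/

namespace TwoStep

/-- The odd abelian algebra, with zero bracket. -/
def abelian (ι κ : Type) : TwoStep ι κ := ⟨0, fun _ _ => rfl⟩

/-- The algebra with the opposite bracket. -/
def neg (n : TwoStep ι κ) : TwoStep ι κ := ⟨-n.br, fun s t => by simp [n.symm s t]⟩

theorem neg_neg_eq (n : TwoStep ι κ) : n.neg.neg = n := by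
  obtain ⟨b, hb⟩ := n
  change TwoStep.mk (- -b) _ = _
  congr 1
  exact _root_.neg_neg b

@[simp] theorem abelian_f (μ : κ) (α β : ι) : (abelian ι κ).f μ α β = 0 := by simp [f, abelian]

@[simp] theorem neg_f (n : TwoStep ι κ) (μ : κ) (α β : ι) : n.neg.f μ α β = -n.f μ α β := by
  simp [f, neg]

end TwoStep

theorem comparison_tmul (n : TwoStep ι κ) (F : SuperFun ι κ) (c : CE ι κ) :
    comparison n (F ⊗ₜ c) = Forms.ofFun F * Forms.ofCE n c := rfl

namespace Forms

theorem ofFun_eq (h : Smooth κ) (w : ExteriorAlgebra ℂ (ι → ℂ)) :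
    (ofFun (h ⊗ₜ w) : Forms ι κ) = ofSmooth h * ofFun (1 ⊗ₜ w) := by
  rw [ofFun_tmul, ofFun_tmul, ofSmooth_apply, Algebra.TensorProduct.tmul_mul_tmul, one_mul, map_one,
    mul_one]

/-- Algebra homomorphisms out of `C^∞(N)` into forms agree if they agree on coordinates. -/
theorem ofFun_hom_ext {A : Type*} [Ring A] [Algebra ℂ A] {g g' : Forms ι κ →ₐ[ℂ] A}
    (h1 : ∀ h, g (ofSmooth h) = g' (ofSmooth h))
    (h2 : ∀ α, g (ofFun (SuperFun.θ α)) = g' (ofFun (SuperFun.θ α))) (F : SuperFun ι κ) :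
    g (ofFun F) = g' (ofFun F) := by
  induction F using TensorProduct.induction_on with
  | zero => simp
  | add a b ha hb => rw [map_add, map_add, map_add, ha, hb]
  | tmul h w =>
    rw [ofFun_eq, map_mul, map_mul, h1]
    congr 1
    induction w using ExteriorAlgebra.induction with
    | algebraMap c =>
      have : (ofFun ((1 : Smooth κ) ⊗ₜ[ℂ] algebraMap ℂ _ c) : Forms ι κ) = algebraMap ℂ _ c := by
        rw [ofFun_tmul, AlgHom.commutes, map_one]
        exact (Algebra.TensorProduct.includeRight : _ →ₐ[ℂ] Forms ι κ).commutes c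
      rw [this, AlgHom.commutes, AlgHom.commutes]
    | ι m =>
      have : (ofFun ((1 : Smooth κ) ⊗ₜ[ℂ] ExteriorAlgebra.ι ℂ m) : Forms ι κ) =
          ∑ α, m α • ofFun (SuperFun.θ α) := by
        rw [ofFun_tmul, ExteriorAlgebra.map_apply_ι, map_one]
        exact (odd_eq_sum _).trans (by simp)
      rw [this]
      simp only [map_sum, map_smul, h2]
    | mul a b ha hb =>
      have : (ofFun ((1 : Smooth κ) ⊗ₜ[ℂ] (a * b)) : Forms ι κ) =
          ofFun (1 ⊗ₜ a) * ofFun (1 ⊗ₜ b) := by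
        rw [← map_mul, Algebra.TensorProduct.tmul_mul_tmul, one_mul]
      rw [this, map_mul, map_mul, ha, hb]
    | add a b ha hb => rw [TensorProduct.tmul_add, map_add, map_add, map_add, ha, hb]

theorem includeLeft_commute (e : EvenForms ι κ) (a : Forms ι κ) :
    Commute ((Algebra.TensorProduct.includeLeft : _ →ₐ[ℂ] Forms ι κ) e) a :=
  Algebra.commutes e a

/-- The automorphism `dx ↦ dx + λ f θ` of the algebra of forms. -/
def shear (n : TwoStep ι κ) : Forms ι κ →ₐ[ℂ] Forms ι κ :=
  Algebra.TensorProduct.lift (Algebra.TensorProduct.includeLeft : _ →ₐ[ℂ] Forms ι κ)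
    (ExteriorAlgebra.lift ℂ ⟨(Fintype.linearCombination ℂ
        fun α => (ofFun (SuperFun.θ α) : Forms ι κ)).coprod
      (Fintype.linearCombination ℂ (shifted n)), fun m => oddSpan_sq (by
        rw [LinearMap.coprod_apply, Fintype.linearCombination_apply,
          Fintype.linearCombination_apply]
        exact Submodule.add_mem _
          (Submodule.sum_mem _ fun α _ => Submodule.smul_of_tower_mem _ _
            (Submodule.subset_span ⟨_, ofFun_θ α⟩))
          (Submodule.sum_mem _ fun μ _ => Submodule.smul_of_tower_mem _ _
            (shifted_mem n μ)))⟩)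
    (fun e _ => includeLeft_commute e _)

variable (n n' : TwoStep ι κ)

@[simp] theorem shear_ofSmooth (h : Smooth κ) : shear n (ofSmooth h : Forms ι κ) = ofSmooth h := by
  rw [ofSmooth_apply, shear, Algebra.TensorProduct.lift_tmul, map_one, mul_one]; rfl

@[simp] theorem shear_ofPoly (P : MvPolynomial ι ℂ) :
    shear n (ofPoly P : Forms ι κ) = ofPoly P := by
  rw [ofPoly_apply, shear, Algebra.TensorProduct.lift_tmul, map_one, mul_one]; rfl

@[simp] theorem shear_dθ (α : ι) : shear n (dθ α : Forms ι κ) = dθ α := shear_ofPoly n _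

@[simp] theorem shear_θ (α : ι) :
    shear n (ofFun (SuperFun.θ α) : Forms ι κ) = ofFun (SuperFun.θ α) := by
  rw [ofFun_θ, odd_apply, shear, Algebra.TensorProduct.lift_tmul, map_one, one_mul,
    ExteriorAlgebra.lift_ι_apply]
  simp [Fintype.linearCombination_apply, Pi.single_apply, ofFun_θ, odd_apply]

@[simp] theorem shear_dx (μ : κ) : shear n (dx μ : Forms ι κ) = shifted n μ := by
  rw [dx_eq, odd_apply, shear, Algebra.TensorProduct.lift_tmul, map_one, one_mul,
    ExteriorAlgebra.lift_ι_apply]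
  simp [Fintype.linearCombination_apply, Pi.single_apply]

@[simp] theorem shear_ofFun (F : SuperFun ι κ) : shear n (ofFun F : Forms ι κ) = ofFun F :=
  ofFun_hom_ext (g := shear n) (g' := AlgHom.id ℂ _) (by simp) (by simp) F

theorem shifted_abelian (μ : κ) : shifted (TwoStep.abelian ι κ) μ = dx μ := by simp [shifted]

/-- The shear moves only dx, and the added term dθ f θ is itself fixed by shears, so the shifts by f
and -f cancel. -/
theorem shear_shear_neg : (shear n).comp (shear n.neg) = AlgHom.id ℂ _ := by
  refine AlgHom.ext_of_adjoin_eq_top adjoin_gens (forall_gens ?_ ?_ ?_ ?_) <;> intro j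
  · simp
  · simp
  · simp
  · simp [shifted]

theorem shear_bijective : Function.Bijective (shear n) :=
  Function.bijective_iff_has_inverse.mpr ⟨shear n.neg,
    fun a => by
      have h := AlgHom.congr_fun (shear_shear_neg n.neg) a
      rwa [TwoStep.neg_neg_eq] at h,
    fun a => AlgHom.congr_fun (shear_shear_neg n) a⟩

theorem shear_comp_ofCE : (shear n).comp (ofCE (TwoStep.abelian ι κ)) = ofCE n := by
  refine AlgHom.ext_of_adjoin_eq_top CE.adjoin_gens (CE.forall_gens ?_ ?_)
  · simp
  · simp [shifted_abelian]

theorem ofCE_abelian_tmul (P : MvPolynomial ι ℂ) (w : ExteriorAlgebra ℂ (κ → ℂ)) :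
    ofCE (TwoStep.abelian ι κ) (P ⊗ₜ w) = ofPoly P * ofExt w := by
  rw [ofCE, Algebra.TensorProduct.lift_tmul]
  congr 1
  refine AlgHom.congr_fun (φ₁ := ExteriorAlgebra.lift ℂ _) (φ₂ := ofExt) ?_ w
  refine ExteriorAlgebra.hom_ext (LinearMap.ext fun m => ?_)
  simp only [LinearMap.comp_apply, AlgHom.toLinearMap_apply, ExteriorAlgebra.lift_ι_apply,
    Fintype.linearCombination_apply, shifted_abelian]
  rw [ofExt_apply, ExteriorAlgebra.map_apply_ι]
  exact (Eq.trans (odd_eq_sum _) (by simp)).symm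

end Forms

-- The shear fixes functions and dθ and carries dx to dx + dθ f θ, so it accounts for the whole
-- dependence of Φ on the bracket.
open Forms in
theorem comparison_eq_shear (n : TwoStep ι κ) :
    comparison n = (shear n).toLinearMap ∘ₗ comparison (TwoStep.abelian ι κ) := by
  refine TensorProduct.ext' fun F c => ?_
  rw [comparison_tmul, LinearMap.comp_apply, comparison_tmul, AlgHom.toLinearMap_apply, map_mul,
    shear_ofFun, ← AlgHom.comp_apply, shear_comp_ofCE]

-- For the zero bracket, v goes to dx and Φ is a permutation of tensor factors followed by the
-- identification of the exterior algebra of a direct sum. No signs occur, because only the even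
-- polynomials in dθ move past functions of θ.
open Forms in
theorem comparison_abelian_bijective : Function.Bijective (comparison (TwoStep.abelian ι κ)) := by
  obtain ⟨e, he⟩ := exists_exteriorProdEquiv (ι → ℂ) (κ → ℂ)
  let E : SuperFun ι κ ⊗[ℂ] CE ι κ ≃ₗ[ℂ]
      (Smooth κ ⊗[ℂ] MvPolynomial ι ℂ) ⊗[ℂ] ExteriorAlgebra ℂ ((ι → ℂ) × (κ → ℂ)) :=
    (TensorProduct.tensorTensorTensorComm ℂ _ _ _ _).trans
      (TensorProduct.congr (LinearEquiv.refl ℂ _) e)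
  have h : ∀ z, comparison (TwoStep.abelian ι κ) z = E z := by
    refine LinearMap.congr_fun (f := comparison (TwoStep.abelian ι κ)) (g := E.toLinearMap) ?_
    refine TensorProduct.ext_fourfold' fun h a P b => ?_
    rw [comparison_tmul, ofCE_abelian_tmul, ofFun_tmul, ofPoly_apply, ofExt_apply,
      Algebra.TensorProduct.tmul_mul_tmul, Algebra.TensorProduct.tmul_mul_tmul, one_mul, mul_one]
    have hE : E ((h ⊗ₜ a) ⊗ₜ (P ⊗ₜ b)) = (h ⊗ₜ P) ⊗ₜ e (a ⊗ₜ b) := rfl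
    refine Eq.trans ?_ hE.symm
    rw [he]
    exact congrArg (fun t : EvenForms ι κ => t ⊗ₜ[ℂ] _) (EvenForms.inclSmooth_mul_inclPoly h P)
  exact (funext h : ⇑(comparison (TwoStep.abelian ι κ)) = E) ▸ E.bijective

theorem comparison_bijective (n : TwoStep ι κ) : Function.Bijective (comparison n) := by
  rw [comparison_eq_shear]
  exact (Forms.shear_bijective n).comp comparison_abelian_bijective

/-- Evaluation at x = 0, θ = 0 is a retraction onto ℂ. -/
theorem algebraMap_superFun_injective : Function.Injective (algebraMap ℂ (SuperFun ι κ)) := by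
  let g : SuperFun ι κ →ₐ[ℂ] ℂ := Algebra.TensorProduct.lift
    (((Pi.evalAlgHom ℂ (fun _ : κ → ℝ => ℂ) 0).comp (smoothSubalgebra κ).val : Smooth κ →ₐ[ℂ] ℂ))
    ExteriorAlgebra.algebraMapInv (fun _ _ => Commute.all _ _)
  exact Function.LeftInverse.injective (g := g) fun c => g.commutes c

/-- ψ is the restriction of the bijective Φ to 1 ⊗ C(𝔫). Injectivity allows laws of C(𝔫) to be
verified after mapping to forms. -/
theorem Forms.ofCE_injective (n : TwoStep ι κ) : Function.Injective (ofCE n) := by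
  intro c c' h
  have h1 : comparison n (1 ⊗ₜ c) = comparison n (1 ⊗ₜ c') := by
    rw [comparison_tmul, comparison_tmul, h]
  have h2 := (comparison_bijective n).1 h1
  have hf : Function.Injective fun c : CE ι κ => (1 : SuperFun ι κ) ⊗ₜ[ℂ] c :=
    Algebra.TensorProduct.includeRight_injective algebraMap_superFun_injective
  exact hf h2

end PureSpinor

namespace PureSpinor
set_option linter.unusedSectionVars false
set_option linter.unusedSimpArgs false
variable {ι κ : Type} [Fintype ι] [DecidableEq ι] [Fintype κ] [DecidableEq κ]

/-! ## Functions as forms of degree zero -/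

section Contract

variable {M N : Type*} [AddCommGroup M] [Module ℂ M] [AddCommGroup N] [Module ℂ N]

theorem involute_comp_exteriorMap (f : M →ₗ[ℂ] N) :
    (CliffordAlgebra.involute (Q := (0 : QuadraticForm ℂ N))).comp (ExteriorAlgebra.map f) =
      (ExteriorAlgebra.map f).comp (CliffordAlgebra.involute (Q := (0 : QuadraticForm ℂ M))) := by
  refine ExteriorAlgebra.hom_ext (LinearMap.ext fun m => ?_)
  change CliffordAlgebra.involute (ExteriorAlgebra.map f (ExteriorAlgebra.ι ℂ m)) =
    ExteriorAlgebra.map f (CliffordAlgebra.involute (ExteriorAlgebra.ι ℂ m))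
  rw [ExteriorAlgebra.map_apply_ι]
  simp only [ExteriorAlgebra.ι, CliffordAlgebra.involute_ι, map_neg]
  exact congrArg _ (ExteriorAlgebra.map_apply_ι f m).symm

/-- Both sides are derivations along `ExteriorAlgebra.map f`, with equal twists by compatibility
with the involution, and agree on vectors. It relates the odd partial derivatives on forms to those
on functions. -/
theorem contractLeft_exteriorMap (f : M →ₗ[ℂ] N) (l : Module.Dual ℂ N)
    (w : ExteriorAlgebra ℂ M) :
    CliffordAlgebra.contractLeft (Q := (0 : QuadraticForm ℂ N)) l (ExteriorAlgebra.map f w) =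
      ExteriorAlgebra.map f
        (CliffordAlgebra.contractLeft (Q := (0 : QuadraticForm ℂ M)) (l ∘ₗ f) w) := by
  have h1 := (isTwistedDer_contractLeft l).comp_right (ExteriorAlgebra.map f)
  have h2 := (isTwistedDer_contractLeft (l ∘ₗ f)).comp_left (ExteriorAlgebra.map f)
  rw [involute_comp_exteriorMap] at h1
  refine LinearMap.congr_fun (h1.ext h2 adjoin_range_exteriorι ?_) w
  rintro _ ⟨m, rfl⟩
  change CliffordAlgebra.contractLeft (Q := (0 : QuadraticForm ℂ N)) l
    (ExteriorAlgebra.map f (ExteriorAlgebra.ι ℂ m)) = ExteriorAlgebra.map f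
      (CliffordAlgebra.contractLeft (Q := (0 : QuadraticForm ℂ M)) (l ∘ₗ f) (ExteriorAlgebra.ι ℂ m))
  rw [ExteriorAlgebra.map_apply_ι, ExteriorAlgebra.ι, ExteriorAlgebra.ι,
    CliffordAlgebra.contractLeft_ι, CliffordAlgebra.contractLeft_ι, AlgHom.commutes]
  rfl

end Contract

namespace Forms

theorem partialX_ofFun (μ : κ) (F : SuperFun ι κ) :
    partialX μ (ofFun F) = ofFun (SuperFun.dx μ F) := by
  induction F using TensorProduct.induction_on with
  | zero => simp
  | add a b ha hb => simp only [map_add, ha, hb]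
  | tmul h w => rfl

theorem partialθ_ofFun (α : ι) (F : SuperFun ι κ) :
    partialθ α (ofFun F) = ofFun (SuperFun.dθ α F) := by
  induction F using TensorProduct.induction_on with
  | zero => simp
  | add a b ha hb => simp only [map_add, ha, hb]
  | tmul h w =>
    rw [ofFun_tmul, partialθ, LinearMap.lTensor_tmul, SuperFun.dθ, LinearMap.lTensor_tmul,
      ofFun_tmul]
    congr 1
    exact contractLeft_exteriorMap _ _ w

theorem partialDx_ofFun (μ : κ) (F : SuperFun ι κ) : partialDx μ (ofFun F) = 0 := by
  induction F using TensorProduct.induction_on with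
  | zero => simp
  | add a b ha hb => simp only [map_add, ha, hb, add_zero]
  | tmul h w =>
    have : (LinearMap.proj μ ∘ₗ LinearMap.snd ℂ (ι → ℂ) (κ → ℂ)) ∘ₗ
        LinearMap.inl ℂ (ι → ℂ) (κ → ℂ) = 0 := LinearMap.ext fun m => rfl
    rw [ofFun_tmul, partialDx, LinearMap.lTensor_tmul, contractLeft_exteriorMap, this, map_zero,
      LinearMap.zero_apply, map_zero, TensorProduct.tmul_zero]

theorem partialDθ_ofFun (α : ι) (F : SuperFun ι κ) : partialDθ α (ofFun F) = 0 := by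
  induction F using TensorProduct.induction_on with
  | zero => simp
  | add a b ha hb => simp only [map_add, ha, hb, add_zero]
  | tmul h w => exact partialDθ_inclSmooth_tmul α h _

theorem sgn_ofFun (F : SuperFun ι κ) : sgn (ofFun F) = ofFun (SuperFun.sign F) := by
  induction F using TensorProduct.induction_on with
  | zero => simp
  | add a b ha hb => simp only [map_add, ha, hb]
  | tmul h w =>
    rw [ofFun_tmul, sgn_tmul, SuperFun.sign, LinearMap.lTensor_tmul, ofFun_tmul]
    congr 1
    exact AlgHom.congr_fun (involute_comp_exteriorMap _) w

theorem _root_.PureSpinor.VField.act_apply (X : VField ι κ) (F : SuperFun ι κ) :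
    VField.act X F = ∑ μ, X.1 μ * SuperFun.dx μ F + ∑ α, X.2 α * SuperFun.dθ α F := by
  simp [VField.act, LinearMap.sum_apply]

theorem lieDeriv_ofFun (σ : ℂ) (X : VField ι κ) (F : SuperFun ι κ) :
    lieDeriv σ X (ofFun F) = ofFun (VField.act X F) := by
  simp only [lieDeriv_apply, VField.act_apply, partialX_ofFun, partialθ_ofFun, partialDx_ofFun,
    partialDθ_ofFun, mul_zero, smul_zero, add_zero, map_add, map_sum, map_mul]

theorem d_ofFun (F : SuperFun ι κ) : d (ofFun F) =
    ∑ α, dθ α * ofFun (SuperFun.dθ α F) + ∑ μ, dx μ * ofFun (SuperFun.dx μ F) := by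
  simp only [d, LinearMap.add_apply, LinearMap.sum_apply, LinearMap.comp_apply,
    LinearMap.mulLeft_apply, partialX_ofFun, partialθ_ofFun]

end Forms

/-! ## The comparison map is compatible with the differentials and the actions -/

section Comparison

open Forms

variable {n : TwoStep ι κ} {G : Type*} [LieRing G] [LieAlgebra ℂ G] (r : G →ₗ⁅ℂ⁆ n.aut)

theorem act_transField (μ : κ) (F : SuperFun ι κ) :
    VField.act (transField ι (Pi.single μ 1)) F = SuperFun.dx μ F := by
  rw [VField.act_apply]
  simp only [transField, LinearMap.coe_mk, AddHom.coe_mk, Pi.zero_apply, zero_mul,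
    Finset.sum_const_zero, add_zero, smul_mul_assoc, one_mul]
  rw [Finset.sum_eq_single μ]
  · rw [Pi.single_eq_same, one_smul]
  · intro ν _ h; rw [Pi.single_eq_of_ne h, zero_smul]
  · simp

theorem ofFun_act_oddField (α : ι) (F : SuperFun ι κ) :
    ofFun (VField.act (oddField n (-1) (Pi.single α 1)) F) = ofFun (SuperFun.dθ α F) -
      ∑ μ, linθ ((1 / 2 : ℂ) • LinearMap.proj μ ∘ₗ n.br (Pi.single α 1)) *
        ofFun (SuperFun.dx μ F) := by
  have h : ∀ l : Module.Dual ℂ (ι → ℂ), (linθ ((-1 / 2 : ℂ) • l) : Forms ι κ) =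
      -linθ ((1 / 2 : ℂ) • l) := fun l => by
    rw [← map_neg, neg_div, neg_smul]
  rw [VField.act_apply]
  simp only [map_add, map_sum, map_mul, ofFun_oddField_fst, ofFun_oddField_snd, h, neg_mul,
    Finset.sum_neg_distrib, smul_mul_assoc, one_mul]
  rw [add_comm, sub_eq_add_neg]
  congr 1
  rw [Finset.sum_eq_single α]
  · rw [Pi.single_eq_same, one_smul]
  · intro ν _ h; rw [Pi.single_eq_of_ne h, zero_smul]
  · simp

theorem pureSpinorD_tmul (F : SuperFun ι κ) (c : CE ι κ) :
    (pureSpinor r (ceSelf r)).D (F ⊗ₜ[ℂ] c : SuperFun ι κ ⊗[ℂ] CE ι κ) =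
      (∑ α, VField.act (oddField n (-1) (Pi.single α 1)) F ⊗ₜ[ℂ] (CE.lam α * c) +
      ∑ μ, SuperFun.sign (SuperFun.dx μ F) ⊗ₜ[ℂ] (CE.v μ * c) +
      SuperFun.sign F ⊗ₜ[ℂ] CE.d n c : SuperFun ι κ ⊗[ℂ] CE ι κ) := by
  -- The differential with the module structure of C(𝔫) over itself made explicit, as multiplication
  -- by λ and v.
  let T : Module.End ℂ (SuperFun ι κ ⊗[ℂ] CE ι κ) :=
    ∑ α, TensorProduct.map (VField.act (oddField n (-1) (Pi.single α 1)))
      (LinearMap.mulLeft ℂ (CE.lam α)) +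
    ∑ μ, TensorProduct.map (SuperFun.sign * VField.act (transField ι (Pi.single μ 1)))
      (LinearMap.mulLeft ℂ (CE.v μ)) + TensorProduct.map SuperFun.sign (CE.d n)
  change T (F ⊗ₜ c) = _
  simp only [T, LinearMap.add_apply, LinearMap.sum_apply, TensorProduct.map_tmul,
    Module.End.mul_apply, act_transField, LinearMap.mulLeft_apply]

theorem pureSpinorρ_tmul (x : SP G ι κ) (F : SuperFun ι κ) (c : CE ι κ) :
    (pureSpinor r (ceSelf r)).ρ x (F ⊗ₜ[ℂ] c : SuperFun ι κ ⊗[ℂ] CE ι κ) =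
      (VField.act (evenLeft r x + oddLeft n G x) F ⊗ₜ[ℂ] c + F ⊗ₜ[ℂ] CE.rep r x.1 c :
        SuperFun ι κ ⊗[ℂ] CE ι κ) := rfl

/-- By Leibniz, d(F ψ(c)) is dF · ψ(c) plus the sign-twisted F times ψ of the Chevalley–Eilenberg
differential of c. Rewriting dF in terms of dθ and ψ(v) replaces ∂_θ by 𝓡(d) and leaves ψ(v) ∂_x. -/
theorem comparison_D :
    comparison n ∘ₗ (pureSpinor r (ceSelf r)).D = (deRham r).D ∘ₗ comparison n := by
  refine TensorProduct.ext' fun F (c : CE ι κ) => ?_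
  -- The sign operator in 𝓓 is the cost of moving the odd form ψ(v) to the left of a function.
  have hs : ∀ μ, ofFun (SuperFun.sign (SuperFun.dx μ F)) * shifted n μ =
      shifted n μ * ofFun (SuperFun.dx μ F) := fun μ => by
    rw [← sgn_ofFun, isSuperComm.odd_mul (sgn_shifted n μ)]
  refine (congrArg (comparison n) (pureSpinorD_tmul r F c)).trans ?_
  change _ = d (ofFun F * ofCE n c)
  simp only [map_add, map_sum, comparison_tmul, map_mul, ofCE_lam, ofCE_v, ← mul_assoc, hs]
  rw [d_isSuperDer.leibniz, signPow_one, sgn_ofFun, d_ofCE, d_ofFun, AlgHom.id_apply]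
  congr 1
  simp only [ofFun_act_oddField, ← linShifted_proj, linShifted_apply, linX_proj, d_coord, add_mul,
    Finset.sum_add_distrib, Finset.sum_mul, sub_mul, Finset.sum_sub_distrib]
  rw [Finset.sum_comm (f := fun μ α => dθ α * linθ _ * ofFun (SuperFun.dx μ F) * ofCE n c)]
  simp only [mul_assoc, (ofPoly_commute (MvPolynomial.X _) _).left_comm, dθ]
  abel

/-- Leibniz is applied to the even and odd parts separately: the odd part acts on functions only,
since ψ(c) is annihilated, and the even part acts on ψ(c) through the coadjoint action. -/
theorem comparison_ρ (x : SP G ι κ) :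
    comparison n ∘ₗ (pureSpinor r (ceSelf r)).ρ x = (deRham r).ρ x ∘ₗ comparison n := by
  refine TensorProduct.ext' fun F (c : CE ι κ) => ?_
  have hF : lieAct r x (ofFun F) = ofFun (VField.act (evenLeft r x + oddLeft n G x) F) := by
    rw [lieAct_apply, LinearMap.add_apply, lieDeriv_ofFun, lieDeriv_ofFun, map_add,
      LinearMap.add_apply, map_add]
  refine (congrArg (comparison n) (pureSpinorρ_tmul r x F c)).trans ?_
  change _ = lieAct r x (ofFun F * ofCE n c)
  rw [map_add]
  simp only [comparison_tmul]
  rw [← hF]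
  have hx : lieAct r x = (lieAct r (x.1, 0, x.2.2) + lieAct r (0, x.2.1, 0) :
      Module.End ℂ (Forms ι κ)) := by
    rw [← map_add, ← evenPart_add_oddPart]
  simp only [hx, LinearMap.add_apply]
  rw [(lieAct_isLie r (evenPart_mem x)).der.leibniz,
    (lieAct_isLie r (oddPart_mem x)).der.leibniz, lieAct_ofCE_odd r (oddPart_mem x),
    lieAct_ofCE_even r (evenPart_mem x), mul_zero, add_zero, signPow_zero]
  simp only [AlgHom.id_apply, add_mul]
  abel

end Comparison

/-! ## `C^•(𝔫)` as a module over itself -/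

theorem finite_exteriorAlgebra (M : Type*) [AddCommGroup M] [Module ℂ M] [Module.Finite ℂ M] :
    Module.Finite ℂ (ExteriorAlgebra ℂ M) :=
  Module.Finite.of_basis (Module.finBasis ℂ M).ExteriorAlgebra

namespace CE

open Forms

variable {n : TwoStep ι κ} {G : Type*} [LieRing G] [LieAlgebra ℂ G] (r : G →ₗ⁅ℂ⁆ n.aut)

theorem finite_gr (k : ℤ) (p : ZMod 2) : FiniteDimensional ℂ (gr ι κ k p) := by
  have := finite_exteriorAlgebra (κ → ℂ)
  -- The polynomial degree is at most k and the exterior factor is finite-dimensional. For negative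
  -- k no spanning element exists, so truncation to a natural number is harmless.
  let N := LinearMap.range (TensorProduct.map
    (MvPolynomial.restrictTotalDegree ι ℂ k.toNat).subtype
    (LinearMap.id : ExteriorAlgebra ℂ (κ → ℂ) →ₗ[ℂ] _))
  have hN : gr ι κ k p ≤ N := by
    rw [gr, Submodule.span_le]
    rintro _ ⟨i, j, hk, -, P, hP, w, -, rfl⟩
    refine ⟨⟨P, ?_⟩ ⊗ₜ w, rfl⟩
    rw [MvPolynomial.mem_restrictTotalDegree]
    exact (((MvPolynomial.mem_homogeneousSubmodule i P).mp hP).totalDegree_le).trans (by omega)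
  exact Submodule.finiteDimensional_of_le hN

theorem scale_comp_sgn : (scale (ι := ι) (κ := κ)).comp sgn = sgn.comp scale := by
  refine AlgHom.ext_of_adjoin_eq_top adjoin_gens (forall_gens ?_ ?_) <;> intro j
  · simp only [AlgHom.comp_apply, sgn_lam, scale_lam, map_smul]
  · simp only [AlgHom.comp_apply, sgn_v, scale_v, map_smul, map_neg]
    module

variable (n) in
theorem scale_d (c : CE ι κ) : scale (d n c) = (2 : ℂ) • d n (scale c) := by
  have h1 := (d_isSuperDer n).leibniz.comp_left scale
  have h2 := ((d_isSuperDer n).leibniz.comp_right scale).smul 2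
  rw [signPow_one, scale_comp_sgn] at h1
  refine LinearMap.congr_fun (h1.ext h2 adjoin_gens (forall_gens (fun α => ?_) fun μ => ?_)) c
  · simp
  · simp only [LinearMap.comp_apply, AlgHom.toLinearMap_apply, LinearMap.smul_apply, scale_v,
      map_smul, d_v, map_sum, map_mul, scale_lam, smul_mul_smul_comm, Finset.smul_sum, smul_smul]
    -- The differential of v is quadratic in λ and scales by (-2)² = 4, which is 2 for the degree
    -- shift times 2 for v.
    refine Finset.sum_congr rfl fun α _ => Finset.sum_congr rfl fun β _ => ?_
    congr 1; ring

theorem scale_rep (a : G) (c : CE ι κ) : scale (rep r a c) = rep r a (scale c) := by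
  have h1 := (rep_isSuperDer r a).leibniz.comp_left scale
  have h2 := (rep_isSuperDer r a).leibniz.comp_right scale
  refine LinearMap.congr_fun (h1.ext h2 adjoin_gens (forall_gens (fun α => ?_) fun μ => ?_)) c
  · simp only [LinearMap.comp_apply, AlgHom.toLinearMap_apply, scale_lam, map_smul, rep_lam,
      map_neg, map_sum, Finset.smul_sum, smul_neg, smul_comm (-2 : ℂ)]
  · simp only [LinearMap.comp_apply, AlgHom.toLinearMap_apply, scale_v, map_smul, rep_v,
      map_neg, map_sum, Finset.smul_sum, smul_neg, smul_comm (2 : ℂ)]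

theorem lieAct_ofCE (a : G) (c : CE ι κ) :
    lieAct r (a, 0, 0) (ofCE n c) = ofCE n (rep r a c) :=
  lieAct_ofCE_even r (x := (a, 0, 0)) (by simp [SP.par, Submodule.mem_prod]) c

-- Deduced from d² = 0 on forms through the injective ψ, as are `rep_lie` and `d_rep` from the
-- relations between Lie derivatives.
variable (n) in
theorem d_d (c : CE ι κ) : d n (d n c) = 0 := ofCE_injective n <| by
  rw [← d_ofCE, ← d_ofCE, Forms.d_d, map_zero]

theorem par_zero_mem (a : G) : (a, 0, 0) ∈ SP.par G ι κ 0 := by simp [SP.par, Submodule.mem_prod]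

theorem rep_lie (a b : G) (c : CE ι κ) :
    rep r ⁅a, b⁆ c = rep r a (rep r b c) - rep r b (rep r a c) := ofCE_injective n <| by
  have h := LinearMap.congr_fun (lieAct_bracket r (par_zero_mem a) (par_zero_mem b)) (ofCE n c)
  have hb : SP.bracket r (a, 0, 0) (b, 0, 0) = (⁅a, b⁆, 0, 0) := by simp [SP.bracket]
  rw [hb, koszul_zero_left, one_smul] at h
  simp only [LinearMap.sub_apply, Module.End.mul_apply, lieAct_ofCE] at h
  rw [h, map_sub]

theorem d_rep (a : G) (c : CE ι κ) : d n (rep r a c) = rep r a (d n c) := ofCE_injective n <| by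
  have h := LinearMap.congr_fun (lieAct_isLie r (par_zero_mem a)).comm (ofCE n c)
  rw [koszul_one_zero, one_smul] at h
  simp only [Module.End.mul_apply, lieAct_ofCE, d_ofCE] at h
  exact h

theorem _root_.PureSpinor.weight_succ (k : ℤ) (p : ZMod 2) :
    weight (k + 1) p = 2 * weight k p := by
  rw [weight, weight, zpow_add_one₀ two_ne_zero]; ring

variable (n) in
theorem d_mem_gr {k : ℤ} {p : ZMod 2} {c : CE ι κ} (hc : c ∈ gr ι κ k p) :
    d n c ∈ gr ι κ (k + 1) p := by
  rw [mem_gr_iff, scale_d, mem_gr_iff.mp hc, map_smul, weight_succ, mul_smul]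

theorem mul_mem_gr {k k' : ℤ} {p p' : ZMod 2} {c c' : CE ι κ} (hc : c ∈ gr ι κ k p)
    (hc' : c' ∈ gr ι κ k' p') : c * c' ∈ gr ι κ (k + k') (p + p') := by
  rw [mem_gr_iff, map_mul, mem_gr_iff.mp hc, mem_gr_iff.mp hc', smul_mul_smul_comm, weight_add]

theorem rep_mem_gr (a : G) {k : ℤ} {p : ZMod 2} {c : CE ι κ} (hc : c ∈ gr ι κ k p) :
    rep r a c ∈ gr ι κ k p := by
  rw [mem_gr_iff, scale_rep, mem_gr_iff.mp hc, map_smul]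

theorem d_mul (c c' : CE ι κ) : d n (c * c') = d n c * c' + sign c * d n c' := by
  rw [(d_isSuperDer n).leibniz, sign_eq]; rfl

theorem rep_mul (a : G) (c c' : CE ι κ) :
    rep r a (c * c') = rep r a c * c' + c * rep r a c' :=
  (rep_isSuperDer r a).leibniz c c'

end CE

open CE in
theorem isCEModule_ceSelf {n : TwoStep ι κ} {G : Type*} [LieRing G] [LieAlgebra ℂ G]
    (r : G →ₗ⁅ℂ⁆ n.aut) : IsCEModule r (ceSelf r) where
  internal := isInternal_gr
  finite := finite_gr
  d_degree _ _ _ hγ := d_mem_gr n hγ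
  d_square := LinearMap.ext (d_d n)
  act_degree _ _ _ _ _ hc _ hγ := mul_mem_gr hc hγ
  act_d c := LinearMap.ext fun γ : CE ι κ => eq_sub_of_add_eq (d_mul c γ).symm
  rep_degree a _ _ _ hγ := rep_mem_gr r a hγ
  rep_bracket a b := LinearMap.ext (rep_lie r a b)
  rep_d a := LinearMap.ext (d_rep r a)
  rep_act a c := LinearMap.ext (rep_mul r a c)

end PureSpinor

namespace PureSpinor
set_option linter.unusedSectionVars false
set_option linter.unusedSimpArgs false
variable {ι κ : Type} [Fintype ι] [DecidableEq ι] [Fintype κ] [DecidableEq κ]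

/-! ## The module structures over smooth functions -/

theorem SuperFun.smul_eq (h : Smooth κ) (F : SuperFun ι κ) : h • F = (h ⊗ₜ 1) * F := by
  induction F using TensorProduct.induction_on with
  | zero => simp
  | add a b ha hb => rw [smul_add, ha, hb, mul_add]
  | tmul a w =>
    rw [TensorProduct.smul_tmul', Algebra.TensorProduct.tmul_mul_tmul, one_mul, smul_eq_mul]

theorem EvenForms.smul_eq (h : Smooth κ) (e : EvenForms ι κ) : h • e = inclSmooth h * e :=
  Algebra.smul_def h e

namespace Forms

theorem smul_eq (h : Smooth κ) (z : Forms ι κ) : h • z = ofSmooth h * z := by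
  induction z using TensorProduct.induction_on with
  | zero => simp
  | add a b ha hb => rw [smul_add, ha, hb, mul_add]
  | tmul e w =>
    rw [TensorProduct.smul_tmul', ofSmooth_apply, Algebra.TensorProduct.tmul_mul_tmul, one_mul,
      EvenForms.smul_eq]

theorem ofFun_smul (h : Smooth κ) (F : SuperFun ι κ) :
    (ofFun (h • F) : Forms ι κ) = h • ofFun F := by
  rw [SuperFun.smul_eq, map_mul, smul_eq, ofFun_tmul, map_one]; rfl

end Forms

theorem comparison_smul (n : TwoStep ι κ) (h : Smooth κ) (z : SuperFun ι κ ⊗[ℂ] CE ι κ) :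
    comparison n (h • z) = h • comparison n z := by
  induction z using TensorProduct.induction_on with
  | zero => simp
  | add a b ha hb => rw [smul_add, map_add, map_add, ha, hb, smul_add]
  | tmul F c =>
    rw [TensorProduct.smul_tmul', comparison_tmul, comparison_tmul, Forms.ofFun_smul,
      Forms.smul_eq, Forms.smul_eq, mul_assoc]

/-! ## The parity of functions -/

namespace SuperFun

theorem sign_smul (h : Smooth κ) (F : SuperFun ι κ) : sign (h • F) = h • sign F := by
  induction F using TensorProduct.induction_on with
  | zero => simp
  | add a b ha hb => rw [smul_add, map_add, map_add, ha, hb, smul_add]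
  | tmul a w => rfl

theorem sign_of_mem_par {q : ZMod 2} {F : SuperFun ι κ} (hF : F ∈ par ι κ q) :
    sign F = koszul 1 q • F := by
  induction hF using Submodule.span_induction with
  | mem F hF =>
    obtain ⟨w, hw, rfl⟩ := hF
    rw [sign, LinearMap.lTensor_tmul, ← TensorProduct.tmul_smul]
    congr 1
    exact involute_of_mem_evenOdd hw
  | zero => simp
  | add a b _ _ ha hb => rw [map_add, ha, hb, smul_add]
  | smul h a _ ha => rw [sign_smul, ha, smul_comm]

theorem iSup_par : ⨆ q, par ι κ q = ⊤ := by
  rw [eq_top_iff]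
  rintro F -
  induction F using TensorProduct.induction_on with
  | zero => exact Submodule.zero_mem _
  | add a b ha hb => exact Submodule.add_mem _ ha hb
  | tmul h w =>
    have hs : (h ⊗ₜ[ℂ] w : SuperFun ι κ) = h • ((1 : Smooth κ) ⊗ₜ[ℂ] w) := by
      rw [TensorProduct.smul_tmul', smul_eq_mul, mul_one]
    rw [hs]
    refine Submodule.smul_mem _ _ ?_
    have hw : w ∈ CliffordAlgebra.evenOdd (0 : QuadraticForm ℂ (ι → ℂ)) 0 ⊔
        CliffordAlgebra.evenOdd (0 : QuadraticForm ℂ (ι → ℂ)) 1 :=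
      (CliffordAlgebra.evenOdd_isCompl (0 : QuadraticForm ℂ (ι → ℂ))).sup_eq_top ▸
        Submodule.mem_top
    obtain ⟨a, ha, b, hb, rfl⟩ := Submodule.mem_sup.mp hw
    rw [TensorProduct.tmul_add]
    exact Submodule.add_mem _
      (Submodule.mem_iSup_of_mem 0 (Submodule.subset_span ⟨a, ha, rfl⟩))
      (Submodule.mem_iSup_of_mem 1 (Submodule.subset_span ⟨b, hb, rfl⟩))

end SuperFun

/-! ## The grading of `C^∞(N) ⊗ C^•(𝔫)` -/

/-- The homogeneous parts of `C^∞(N) ⊗ C^•(𝔫)`. -/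
def tensorGr (ι κ : Type) [Fintype κ] (k : ℤ) (p : ZMod 2) :
    Submodule (Smooth κ) (SuperFun ι κ ⊗[ℂ] CE ι κ) :=
  Submodule.span (Smooth κ) {z | ∃ q q' : ZMod 2, q + q' = p ∧
    ∃ F ∈ SuperFun.par ι κ q, ∃ γ ∈ CE.gr ι κ k q', z = F ⊗ₜ[ℂ] γ}

/-- The automorphism of `C^∞(N) ⊗ C^•(𝔫)` defining its grading. -/
def tensorScale : Module.End ℂ (SuperFun ι κ ⊗[ℂ] CE ι κ) :=
  TensorProduct.map SuperFun.sign CE.scale.toLinearMap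

theorem tensorScale_smul (h : Smooth κ) (z : SuperFun ι κ ⊗[ℂ] CE ι κ) :
    tensorScale (h • z) = h • tensorScale z := by
  induction z using TensorProduct.induction_on with
  | zero => simp
  | add a b ha hb => rw [smul_add, map_add, map_add, ha, hb, smul_add]
  | tmul F c =>
    rw [TensorProduct.smul_tmul', tensorScale, TensorProduct.map_tmul, TensorProduct.map_tmul,
      SuperFun.sign_smul, TensorProduct.smul_tmul']

theorem koszul_mul_weight (k : ℤ) (q q' : ZMod 2) :
    koszul 1 q * weight k q' = weight k (q + q') := by
  rw [weight, weight, koszul_one_add]; ring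

theorem tensorScale_of_mem {k : ℤ} {p : ZMod 2} {z : SuperFun ι κ ⊗[ℂ] CE ι κ}
    (hz : z ∈ tensorGr ι κ k p) : tensorScale z = weight k p • z := by
  induction hz using Submodule.span_induction with
  | mem z hz =>
    obtain ⟨q, q', rfl, F, hF, γ, hγ, rfl⟩ := hz
    rw [tensorScale, TensorProduct.map_tmul, SuperFun.sign_of_mem_par hF,
      AlgHom.toLinearMap_apply, CE.scale_of_mem_gr hγ, TensorProduct.smul_tmul_smul,
      koszul_mul_weight]
  | zero => simp
  | add a b _ _ ha hb => rw [map_add, ha, hb, smul_add]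
  | smul h a _ ha => rw [tensorScale_smul, ha, smul_comm]

/-- Induction on `C^∞(N) ⊗ C^•(𝔫)` over homogeneous tensors. -/
theorem tensor_induction {p : SuperFun ι κ ⊗[ℂ] CE ι κ → Prop} (zero : p 0)
    (add : ∀ a b, p a → p b → p (a + b))
    (tmul : ∀ q, ∀ F ∈ SuperFun.par ι κ q, ∀ k q', ∀ γ ∈ CE.gr ι κ k q', p (F ⊗ₜ γ))
    (z : SuperFun ι κ ⊗[ℂ] CE ι κ) : p z := by
  induction z using TensorProduct.induction_on with
  | zero => exact zero
  | add a b ha hb => exact add a b ha hb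
  | tmul F γ =>
    have hF : F ∈ ⨆ q, SuperFun.par ι κ q := by
      rw [SuperFun.iSup_par]; trivial
    have hγ : γ ∈ ⨆ d : ℤ × ZMod 2, CE.gr ι κ d.1 d.2 := by
      rw [CE.iSup_gr]; trivial
    induction hF using Submodule.iSup_induction' with
    | zero => rwa [TensorProduct.zero_tmul]
    | add a b _ _ ha hb => rw [TensorProduct.add_tmul]; exact add _ _ ha hb
    | mem q F hF =>
      induction hγ using Submodule.iSup_induction' with
      | zero => rwa [TensorProduct.tmul_zero]
      | add a b _ _ ha hb => rw [TensorProduct.tmul_add]; exact add _ _ ha hb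
      | mem d γ hγ => exact tmul q F hF _ _ γ hγ

theorem iSup_tensorGr : ⨆ d : ℤ × ZMod 2, tensorGr ι κ d.1 d.2 = ⊤ := by
  rw [eq_top_iff]
  rintro z -
  induction z using tensor_induction with
  | zero => exact Submodule.zero_mem _
  | add a b ha hb => exact Submodule.add_mem _ ha hb
  | tmul q F hF k q' γ hγ =>
    exact Submodule.mem_iSup_of_mem (k, q + q')
      (Submodule.subset_span ⟨q, q', rfl, F, hF, γ, hγ, rfl⟩)

theorem isInternal_tensorGr :
    DirectSum.IsInternal fun d : ℤ × ZMod 2 => tensorGr ι κ d.1 d.2 :=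
  isInternal_of_eigen (δ := tensorScale) weight_injective
    (fun _ _ he => tensorScale_of_mem he) iSup_tensorGr

theorem mem_tensorGr_iff {k : ℤ} {p : ZMod 2} {z : SuperFun ι κ ⊗[ℂ] CE ι κ} :
    z ∈ tensorGr ι κ k p ↔ tensorScale z = weight k p • z :=
  mem_iff_eigen (A := fun d : ℤ × ZMod 2 => tensorGr ι κ d.1 d.2) (δ := tensorScale)
    (i := (k, p)) weight_injective (fun _ _ he => tensorScale_of_mem he) iSup_tensorGr

/-! ## The grading of the forms -/

namespace Forms

/-- The automorphism with eigenvalue `2^k (-1)^p` in degree `k` and parity `p`. -/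
def scale : Forms ι κ →ₐ[ℂ] Forms ι κ :=
  Algebra.TensorProduct.map (EvenForms.mapAlg (AlgHom.id ℂ _)
      (MvPolynomial.aeval fun α => (-2 : ℂ) • MvPolynomial.X α))
    (ExteriorAlgebra.map ((-LinearMap.id).prodMap ((2 : ℂ) • LinearMap.id)))

@[simp] theorem scale_ofSmooth (h : Smooth κ) : scale (ofSmooth h : Forms ι κ) = ofSmooth h := by
  rw [ofSmooth_apply, scale, Algebra.TensorProduct.map_tmul, map_one]
  congr 1
  refine (Algebra.TensorProduct.map_tmul _ _ h (1 : MvPolynomial ι ℂ)).trans ?_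
  rw [map_one]; rfl

@[simp] theorem scale_dθ (α : ι) : scale (dθ α : Forms ι κ) = (-2 : ℂ) • dθ α := by
  rw [dθ_apply, scale, Algebra.TensorProduct.map_tmul, map_one, TensorProduct.smul_tmul']
  congr 1
  refine (Algebra.TensorProduct.map_tmul _ _ (1 : Smooth κ)
    (MvPolynomial.X α : MvPolynomial ι ℂ)).trans ?_
  rw [MvPolynomial.aeval_X, map_one, TensorProduct.tmul_smul]; rfl

theorem scale_odd (m : (ι → ℂ) × (κ → ℂ)) :
    scale (odd m : Forms ι κ) = odd (-m.1, (2 : ℂ) • m.2) := by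
  rw [odd_apply, scale, Algebra.TensorProduct.map_tmul, map_one, ExteriorAlgebra.map_apply_ι]
  rfl

@[simp] theorem scale_θ (α : ι) :
    scale (ofFun (SuperFun.θ α) : Forms ι κ) = -ofFun (SuperFun.θ α) := by
  rw [ofFun_θ, scale_odd, ← map_neg]; simp

@[simp] theorem scale_dx (μ : κ) : scale (dx μ : Forms ι κ) = (2 : ℂ) • dx μ := by
  rw [dx_eq, scale_odd, ← map_smul]; simp

/-- Functions have degree zero, so the scaling sees only their parity; correspondingly θ scales by
-1. -/
theorem scale_ofFun (F : SuperFun ι κ) : scale (ofFun F) = sgn (ofFun F) :=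
  ofFun_hom_ext (by simp) (by simp) F

/-- The shift is homogeneous: dθ has weight -2 and θ has weight -1, so their product has the weight
2 of dx. -/
theorem scale_shifted (n : TwoStep ι κ) (μ : κ) : scale (shifted n μ) = (2 : ℂ) • shifted n μ := by
  simp only [shifted, map_add, map_sum, map_smul, map_mul, scale_dx, scale_dθ, scale_θ, smul_add,
    Finset.smul_sum, mul_neg, smul_mul_assoc, ← smul_neg, smul_comm (2 : ℂ)]
  congr 1
  refine Finset.sum_congr rfl fun α _ => Finset.sum_congr rfl fun β _ => ?_
  congr 1; module

theorem scale_ofCE (n : TwoStep ι κ) (c : CE ι κ) : scale (ofCE n c) = ofCE n (CE.scale c) := by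
  refine AlgHom.congr_fun (φ₁ := scale.comp (ofCE n)) (φ₂ := (ofCE n).comp CE.scale) ?_ c
  refine AlgHom.ext_of_adjoin_eq_top CE.adjoin_gens (CE.forall_gens ?_ ?_) <;> intro j
  · simp only [AlgHom.comp_apply, ofCE_lam, scale_dθ, CE.scale_lam, map_smul]
  · simp only [AlgHom.comp_apply, ofCE_v, scale_shifted, CE.scale_v, map_smul]

theorem _root_.PureSpinor.scale_comparison (n : TwoStep ι κ) (z : SuperFun ι κ ⊗[ℂ] CE ι κ) :
    scale (comparison n z) = comparison n (tensorScale z) := by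
  induction z using TensorProduct.induction_on with
  | zero => simp
  | add a b ha hb => simp only [map_add, ha, hb]
  | tmul F c =>
    rw [comparison_tmul, tensorScale, TensorProduct.map_tmul, AlgHom.toLinearMap_apply,
      comparison_tmul, map_mul, scale_ofFun, sgn_ofFun, scale_ofCE]

theorem scale_smul (h : Smooth κ) (z : Forms ι κ) : scale (h • z) = h • scale z := by
  rw [smul_eq, smul_eq, map_mul, scale_ofSmooth]

theorem mul_eq_comparison (F : SuperFun ι κ) (P : MvPolynomial ι ℂ)
    (w : ExteriorAlgebra ℂ (κ → ℂ)) :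
    ofFun F * ofPoly P * ofExt w = comparison (TwoStep.abelian ι κ) (F ⊗ₜ (P ⊗ₜ w)) := by
  rw [comparison_tmul, ofCE_abelian_tmul, mul_assoc]

theorem gr_eq (k : ℤ) (p : ZMod 2) : ∀ z : SuperFun ι κ ⊗[ℂ] CE ι κ,
    z ∈ tensorGr ι κ k p → comparison (TwoStep.abelian ι κ) z ∈ gr ι κ k p := by
  intro z hz
  induction hz using Submodule.span_induction with
  | zero => rw [map_zero]; exact Submodule.zero_mem _
  | add a b _ _ ha hb => rw [map_add]; exact Submodule.add_mem _ ha hb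
  | smul h a _ ha => rw [comparison_smul]; exact Submodule.smul_mem _ _ ha
  | mem z hz =>
    obtain ⟨q, q', rfl, F, hF, γ, hγ, rfl⟩ := hz
    induction hγ using Submodule.span_induction with
    | zero => rw [TensorProduct.tmul_zero, map_zero]; exact Submodule.zero_mem _
    | add a b _ _ ha hb =>
      rw [TensorProduct.tmul_add, map_add]; exact Submodule.add_mem _ ha hb
    | smul c a _ ha =>
      rw [TensorProduct.tmul_smul, map_smul]; exact Submodule.smul_of_tower_mem _ _ ha
    | mem γ hγ =>
      obtain ⟨i, j, hk, rfl, P, hP, w, hw, rfl⟩ := hγ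
      rw [← mul_eq_comparison]
      exact Submodule.subset_span ⟨i, j, q, hk, rfl, F, hF, P, hP, w, hw, rfl⟩

/-- The spanning forms are images of homogeneous tensors under the zero-bracket comparison, which
intertwines the scalings. -/
theorem scale_of_mem_gr {k : ℤ} {p : ZMod 2} {z : Forms ι κ} (hz : z ∈ gr ι κ k p) :
    scale z = weight k p • z := by
  induction hz using Submodule.span_induction with
  | mem z hz =>
    obtain ⟨i, j, q, rfl, rfl, F, hF, P, hP, w, hw, rfl⟩ := hz
    have hm : F ⊗ₜ[ℂ] (P ⊗ₜ[ℂ] w) ∈ tensorGr ι κ ((i : ℤ) + j) (q + i) :=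
      Submodule.subset_span ⟨q, i, rfl, F, hF, _,
        Submodule.subset_span ⟨i, j, rfl, rfl, P, hP, w, hw, rfl⟩, rfl⟩
    rw [mul_eq_comparison, scale_comparison, tensorScale_of_mem hm, map_smul]
  | zero => simp
  | add a b _ _ ha hb => rw [map_add, ha, hb, smul_add]
  | smul h a _ ha => rw [scale_smul, ha, smul_comm]

theorem iSup_gr : ⨆ d : ℤ × ZMod 2, gr ι κ d.1 d.2 = ⊤ := by
  rw [eq_top_iff]
  rintro z -
  obtain ⟨z, rfl⟩ := comparison_abelian_bijective.2 z
  have hz : z ∈ ⨆ d : ℤ × ZMod 2, tensorGr ι κ d.1 d.2 := by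
    rw [iSup_tensorGr]; trivial
  induction hz using Submodule.iSup_induction' with
  | zero => rw [map_zero]; exact Submodule.zero_mem _
  | add a b _ _ ha hb => rw [map_add]; exact Submodule.add_mem _ ha hb
  | mem d z hz => exact Submodule.mem_iSup_of_mem d (gr_eq _ _ z hz)

theorem isInternal_gr : DirectSum.IsInternal fun d : ℤ × ZMod 2 => gr ι κ d.1 d.2 :=
  isInternal_of_eigen (δ := scale.toLinearMap) weight_injective
    (fun _ _ he => scale_of_mem_gr he) iSup_gr

theorem mem_gr_iff {k : ℤ} {p : ZMod 2} {z : Forms ι κ} :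
    z ∈ gr ι κ k p ↔ scale z = weight k p • z :=
  mem_iff_eigen (A := fun d : ℤ × ZMod 2 => gr ι κ d.1 d.2) (δ := scale.toLinearMap)
    (i := (k, p)) weight_injective (fun _ _ he => scale_of_mem_gr he) iSup_gr

/-- Both gradings are eigenspace decompositions, and the injective Φ intertwines the scalings, so
degrees are preserved and reflected. -/
theorem _root_.PureSpinor.comparison_mem_gr (n : TwoStep ι κ) {k : ℤ} {p : ZMod 2}
    {z : SuperFun ι κ ⊗[ℂ] CE ι κ} : comparison n z ∈ gr ι κ k p ↔ z ∈ tensorGr ι κ k p := by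
  rw [mem_gr_iff, mem_tensorGr_iff, scale_comparison, ← map_smul]
  exact (comparison_bijective n).1.eq_iff

/-! ## Degrees of the operators on forms -/

theorem scale_comp_sgn : (scale (ι := ι) (κ := κ)).comp sgn = sgn.comp scale := by
  refine AlgHom.ext_of_adjoin_eq_top adjoin_gens (forall_gens ?_ ?_ ?_ ?_) <;> intro j <;> simp

theorem scale_d (a : Forms ι κ) : scale (d a) = (2 : ℂ) • d (scale a) := by
  have h1 := (d_isSuperDer (ι := ι) (κ := κ)).leibniz.comp_left scale
  have h2 := ((d_isSuperDer (ι := ι) (κ := κ)).leibniz.comp_right scale).smul 2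
  rw [signPow_one, scale_comp_sgn] at h1
  refine LinearMap.congr_fun (h1.ext h2 adjoin_gens (forall_gens ?_ ?_ ?_ ?_)) a <;> intro j
  · simp [d_ofSmooth, Finset.smul_sum]
  · simp
  · simp
  · simp

variable {n : TwoStep ι κ} {G : Type*} [LieRing G] [LieAlgebra ℂ G] (r : G →ₗ⁅ℂ⁆ n.aut)

theorem scale_linX (l : Module.Dual ℂ (κ → ℂ)) : scale (linX l : Forms ι κ) = linX l := by
  simp [linX_apply]

theorem scale_linθ (l : Module.Dual ℂ (ι → ℂ)) : scale (linθ l : Forms ι κ) = -linθ l := by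
  simp [linθ_apply]

theorem scale_lieAct {p : ZMod 2} {x : SP G ι κ} (hx : x ∈ SP.par G ι κ p) (a : Forms ι κ) :
    scale (lieAct r x a) = koszul 1 p • lieAct r x (scale a) := by
  have hP := lieAct_isLie r hx
  have h1 := hP.der.leibniz.comp_left scale
  have h2 := (hP.der.leibniz.comp_right scale).smul (koszul 1 p)
  have hc : (scale (ι := ι) (κ := κ)).comp (signPow sgn p) = (signPow sgn p).comp scale := by
    rcases zmodTwo_cases p with rfl | rfl
    · rfl
    · exact scale_comp_sgn
  rw [hc] at h1
  -- On the values taken here, linear functions and constants, the scaling coincides with the sign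
  -- automorphism, so the parity of the operator gives the claim; the case of θ is the same.
  have hX : ∀ l, scale (lieAct r x (linX l : Forms ι κ)) =
      koszul 1 p • lieAct r x (scale (linX l)) := fun l => by
    rw [scale_linX, ← sgn_linX, ← hP.der.sign, sgn_linX, lieAct_linX]
    simp only [map_add, map_neg, map_smul, scale_linX, sgn_linX, scale_linθ, sgn_linθ, map_one]
  have hθ : ∀ l, scale (lieAct r x (linθ l : Forms ι κ)) =
      koszul 1 p • lieAct r x (scale (linθ l)) := fun l => by
    rw [scale_linθ, ← sgn_linθ, ← hP.der.sign, lieAct_linθ]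
    simp only [map_add, map_neg, map_smul, scale_linθ, sgn_linθ, map_one]
  have hd : ∀ a, scale (lieAct r x (a : Forms ι κ)) = koszul 1 p • lieAct r x (scale a) →
      scale (lieAct r x (d a)) = koszul 1 p • lieAct r x (scale (d a)) := fun a ha => by
    rw [hP.apply_d, map_smul, scale_d, ha, scale_d, map_smul, map_smul, hP.apply_d]
  refine LinearMap.congr_fun (h1.ext h2 adjoin_gens (forall_gens ?_ ?_ ?_ ?_)) a <;> intro j
  -- For a general function the chain rule reduces the claim to the coordinates, smooth functions
  -- being fixed by the scaling.
  · have key : ∀ μ, scale (lieAct r x (ofSmooth (Smooth.coord μ) : Forms ι κ)) =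
        koszul 1 p • lieAct r x (ofSmooth (Smooth.coord μ)) := fun μ => by
      rw [← linX_proj, hX, scale_linX]
    simp only [LinearMap.comp_apply, AlgHom.toLinearMap_apply, LinearMap.smul_apply,
      scale_ofSmooth, hP.geom j, map_sum, map_mul, key, Finset.smul_sum, smul_mul_assoc]
  · rw [dθ_eq]; exact hd _ (hθ _)
  · rw [← linθ_proj]; exact hθ _
  · rw [← d_coord, ← linX_proj]; exact hd _ (hX _)

theorem d_mem_gr {k : ℤ} {p : ZMod 2} {z : Forms ι κ} (hz : z ∈ gr ι κ k p) :
    d z ∈ gr ι κ (k + 1) p := by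
  rw [mem_gr_iff, scale_d, mem_gr_iff.mp hz, map_smul, weight_succ, mul_smul]

theorem lieAct_mem_gr {p : ZMod 2} {x : SP G ι κ} (hx : x ∈ SP.par G ι κ p) {k : ℤ} {q : ZMod 2}
    {z : Forms ι κ} (hz : z ∈ gr ι κ k q) : lieAct r x z ∈ gr ι κ k (q + p) := by
  rw [mem_gr_iff, scale_lieAct r hx, mem_gr_iff.mp hz, map_smul, smul_smul, koszul_mul_weight,
    add_comm]

end Forms
end PureSpinor

namespace PureSpinor
set_option linter.unusedSectionVars false
set_option linter.unusedSimpArgs false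
variable {ι κ : Type} [Fintype ι] [DecidableEq ι] [Fintype κ] [DecidableEq κ]

/-! ## Trivialised bundles -/

section Trivialised

variable (κ) (A B : Type*) [AddCommGroup A] [Module ℂ A] [AddCommGroup B] [Module ℂ B]

/-- The constant sections of the trivial bundle with fibre `A ⊗ B`. -/
def constTensor : Submodule ℂ ((Smooth κ ⊗[ℂ] A) ⊗[ℂ] B) :=
  Submodule.span ℂ {z | ∃ (a : A) (b : B), z = ((1 : Smooth κ) ⊗ₜ[ℂ] a) ⊗ₜ[ℂ] b}

/-- The inclusion of the fibre as the constant sections. -/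
def constIncl : A ⊗[ℂ] B →ₗ[ℂ] (Smooth κ ⊗[ℂ] A) ⊗[ℂ] B :=
  (TensorProduct.mk ℂ (Smooth κ) A 1).rTensor B

theorem isBaseChange_constIncl : IsBaseChange (Smooth κ) (constIncl κ A B) :=
  IsBaseChange.of_equiv
    (TensorProduct.AlgebraTensorModule.assoc ℂ ℂ (Smooth κ) (Smooth κ) A B).symm fun z => by
      induction z using TensorProduct.induction_on with
      | zero => simp
      | add a b ha hb => rw [TensorProduct.tmul_add, map_add, ha, hb, map_add]
      | tmul a b => rfl

/-- Evaluation at the origin. -/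
def Smooth.evalZero : Smooth κ →ₗ[ℂ] ℂ where
  toFun h := h.1 0
  map_add' _ _ := rfl
  map_smul' _ _ := rfl

/-- Evaluating the smooth factor at the origin gives a left inverse. -/
theorem constIncl_injective : Function.Injective (constIncl κ A B) := by
  let g : (Smooth κ ⊗[ℂ] A) ⊗[ℂ] B →ₗ[ℂ] A ⊗[ℂ] B :=
    ((TensorProduct.lid ℂ A).toLinearMap ∘ₗ (Smooth.evalZero κ).rTensor A).rTensor B
  have h : g ∘ₗ constIncl κ A B = LinearMap.id := TensorProduct.ext' fun a b => by
    have h1 : Smooth.evalZero κ 1 = 1 := rfl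
    simp [g, constIncl, h1]
  exact Function.LeftInverse.injective (g := g) fun z => LinearMap.congr_fun h z

theorem range_constIncl : LinearMap.range (constIncl κ A B) = constTensor κ A B := by
  refine le_antisymm ?_ (Submodule.span_le.mpr ?_)
  · rintro _ ⟨z, rfl⟩
    induction z using TensorProduct.induction_on with
    | zero => rw [map_zero]; exact Submodule.zero_mem _
    | add a b ha hb => rw [map_add]; exact Submodule.add_mem _ ha hb
    | tmul a b => exact Submodule.subset_span ⟨a, b, rfl⟩
  · rintro _ ⟨a, b, rfl⟩
    exact ⟨a ⊗ₜ b, rfl⟩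

/-- The injective inclusion of the fibre identifies it with the submodule of constant sections, and
the base change property passes along that identification. -/
theorem isBaseChange_constTensor : IsBaseChange (Smooth κ) (constTensor κ A B).subtype := by
  rw [← range_constIncl]
  have h := (isBaseChange_constIncl κ A B).comp_equiv
    (LinearEquiv.ofInjective _ (constIncl_injective κ A B)).symm
  convert h using 1
  refine LinearMap.ext fun z => ?_
  obtain ⟨y, rfl⟩ := (LinearEquiv.ofInjective _ (constIncl_injective κ A B)).surjective z
  simp

end Trivialised

/-! ### Finiteness and projectivity of the homogeneous summands. -/

section Summand

variable {S : Type*} [CommRing S] [Algebra ℂ S] {E : Type*} [AddCommGroup E] [Module ℂ E]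
  [Module S E] [IsScalarTower ℂ S E] {J : Type*} [DecidableEq J] {A : J → Submodule S E}

theorem exists_projection (hA : DirectSum.IsInternal A) (i : J) :
    ∃ π : E →ₗ[S] A i, ∀ e : A i, π e = e := by
  let φ := LinearEquiv.ofBijective (DirectSum.coeLinearMap A) hA
  refine ⟨DirectSum.component S J (fun j => A j) i ∘ₗ φ.symm.toLinearMap, fun e => ?_⟩
  have h : φ.symm e = DirectSum.lof S J (fun j => A j) i e := by
    rw [LinearEquiv.symm_apply_eq]
    exact (DirectSum.coeLinearMap_lof A i e).symm
  rw [LinearMap.comp_apply, LinearEquiv.coe_coe, h, DirectSum.component.lof_self]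

theorem projective_of_isInternal [Module.Projective S E] (hA : DirectSum.IsInternal A) (i : J) :
    Module.Projective S (A i) := by
  obtain ⟨π, hπ⟩ := exists_projection hA i
  exact Module.Projective.of_split (A i).subtype π (LinearMap.ext hπ)

/-- Projecting a finitely generated submodule that contains `A i` onto `A i` yields finitely many
generators. The projection is what replaces a Noetherian hypothesis on `S`. -/
theorem finite_of_isInternal (hA : DirectSum.IsInternal A) (i : J) (T : Submodule ℂ E)
    [Module.Finite ℂ T] (hT : A i ≤ Submodule.span S T) : Module.Finite S (A i) := by
  obtain ⟨π, hπ⟩ := exists_projection hA i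
  obtain ⟨s, hs⟩ := (Module.Finite.iff_fg (N := T)).mp inferInstance
  have hfg : (Submodule.span S (T : Set E)).FG := by
    refine ⟨s, le_antisymm (Submodule.span_mono (hs ▸ Submodule.subset_span)) ?_⟩
    refine Submodule.span_le.mpr ?_
    rw [← hs]
    exact Submodule.span_subset_span ℂ S _
  refine ⟨?_⟩
  have h := hfg.map π
  rwa [show Submodule.map π (Submodule.span S (T : Set E)) = ⊤ from
    eq_top_iff.mpr fun e _ => ⟨e, hT e.2, hπ e⟩] at h

end Summand

instance projective_tensor (A B : Type*) [AddCommGroup A] [Module ℂ A] [AddCommGroup B]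
    [Module ℂ B] : Module.Projective (Smooth κ) ((Smooth κ ⊗[ℂ] A) ⊗[ℂ] B) :=
  Module.Projective.of_equiv (isBaseChange_constIncl κ A B).equiv

/-! ## The bundles -/

/-- The constant sections of `C^∞(N) ⊗ C^•(𝔫)`. -/
abbrev tensorConst (ι κ : Type) [Fintype κ] : Submodule ℂ (SuperFun ι κ ⊗[ℂ] CE ι κ) :=
  constTensor κ (ExteriorAlgebra ℂ (ι → ℂ)) (CE ι κ)

theorem tensorGr_eq_span (k : ℤ) (p : ZMod 2) : tensorGr ι κ k p =
    Submodule.span (Smooth κ) {e | e ∈ tensorConst ι κ ∧ e ∈ tensorGr ι κ k p} := by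
  refine le_antisymm (Submodule.span_le.mpr ?_) (Submodule.span_le.mpr fun e he => he.2)
  rintro _ ⟨q, q', rfl, F, hF, γ, hγ, rfl⟩
  induction hF using Submodule.span_induction with
  | zero => rw [TensorProduct.zero_tmul]; exact Submodule.zero_mem _
  | add a b _ _ ha hb => rw [TensorProduct.add_tmul]; exact Submodule.add_mem _ ha hb
  | smul h a _ ha => rw [← TensorProduct.smul_tmul']; exact Submodule.smul_mem _ _ ha
  | mem F hF =>
    have hF' := hF
    obtain ⟨w, hw, rfl⟩ := hF
    exact Submodule.subset_span ⟨Submodule.subset_span ⟨w, γ, rfl⟩,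
      Submodule.subset_span ⟨q, q', rfl, _, Submodule.subset_span hF', γ, hγ, rfl⟩⟩

theorem exists_finite_tensorGr_le (k : ℤ) (p : ZMod 2) :
    ∃ T : Submodule ℂ (SuperFun ι κ ⊗[ℂ] CE ι κ), Module.Finite ℂ T ∧
      tensorGr ι κ k p ≤ Submodule.span (Smooth κ) T := by
  have := finite_exteriorAlgebra (ι → ℂ)
  have := CE.finite_gr (ι := ι) (κ := κ) k 0
  have := CE.finite_gr (ι := ι) (κ := κ) k 1
  -- Both parities of C(𝔫) in degree k are needed, since a function of either parity may contribute
  -- to the total parity.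
  let W : Submodule ℂ (CE ι κ) := CE.gr ι κ k 0 ⊔ CE.gr ι κ k 1
  refine ⟨LinearMap.range (TensorProduct.map
    (TensorProduct.mk ℂ (Smooth κ) (ExteriorAlgebra ℂ (ι → ℂ)) 1) W.subtype), inferInstance, ?_⟩
  refine Submodule.span_le.mpr ?_
  rintro _ ⟨q, q', rfl, F, hF, γ, hγ, rfl⟩
  have hW : γ ∈ W := by
    rcases zmodTwo_cases q' with rfl | rfl
    · exact Submodule.mem_sup_left hγ
    · exact Submodule.mem_sup_right hγ
  induction hF using Submodule.span_induction with
  | zero => rw [TensorProduct.zero_tmul]; exact Submodule.zero_mem _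
  | add a b _ _ ha hb => rw [TensorProduct.add_tmul]; exact Submodule.add_mem _ ha hb
  | smul h a _ ha => rw [← TensorProduct.smul_tmul']; exact Submodule.smul_mem _ _ ha
  | mem F hF =>
    obtain ⟨w, hw, rfl⟩ := hF
    exact Submodule.subset_span ⟨w ⊗ₜ ⟨γ, hW⟩, rfl⟩

namespace Forms

/-- The constant forms. -/
def const (ι κ : Type) [Fintype κ] : Submodule ℂ (Forms ι κ) :=
  Submodule.span ℂ {z | ∃ (P : MvPolynomial ι ℂ)
    (w : ExteriorAlgebra ℂ ((ι → ℂ) × (κ → ℂ))), z = EvenForms.inclPoly P ⊗ₜ[ℂ] w}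

theorem isBaseChange_const : IsBaseChange (Smooth κ) (const ι κ).subtype :=
  isBaseChange_constTensor κ (MvPolynomial ι ℂ) (ExteriorAlgebra ℂ ((ι → ℂ) × (κ → ℂ)))

instance projective_forms : Module.Projective (Smooth κ) (Forms ι κ) :=
  projective_tensor (MvPolynomial ι ℂ) (ExteriorAlgebra ℂ ((ι → ℂ) × (κ → ℂ)))

/-- The inclusion of the algebra of constant forms. -/
def constHom (ι κ : Type) [Fintype κ] :
    MvPolynomial ι ℂ ⊗[ℂ] ExteriorAlgebra ℂ ((ι → ℂ) × (κ → ℂ)) →ₐ[ℂ] Forms ι κ :=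
  Algebra.TensorProduct.map EvenForms.inclPoly (AlgHom.id ℂ _)

theorem mem_const_iff {z : Forms ι κ} : z ∈ const ι κ ↔ z ∈ (constHom ι κ).range := by
  constructor
  · intro hz
    induction hz using Submodule.span_induction with
    | zero => exact zero_mem _
    | add a b _ _ ha hb => exact add_mem ha hb
    | smul c a _ ha => exact Subalgebra.smul_mem _ ha c
    | mem z hz =>
      obtain ⟨P, w, rfl⟩ := hz
      exact ⟨P ⊗ₜ w, rfl⟩
  · rintro ⟨y, rfl⟩
    induction y using TensorProduct.induction_on with
    | zero => simp
    | add a b ha hb => exact (map_add (constHom ι κ) a b).symm ▸ Submodule.add_mem _ ha hb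
    | tmul P w => exact Submodule.subset_span ⟨P, w, rfl⟩

/-- Without the smooth functions the generators are finite in number, which gives an induction
principle for constant forms compatible with Leibniz rules. -/
theorem mem_const_iff_mem_adjoin {z : Forms ι κ} : z ∈ const ι κ ↔ z ∈ Algebra.adjoin ℂ
    (Set.range dθ ∪ Set.range (fun α => ofFun (SuperFun.θ α)) ∪ Set.range dx) := by
  set T := Algebra.adjoin ℂ (Set.range (dθ (ι := ι) (κ := κ)) ∪
    Set.range (fun α => ofFun (SuperFun.θ α)) ∪ Set.range dx) with hT
  constructor
  · intro hz
    have h1 : ∀ P : MvPolynomial ι ℂ, (ofPoly P : Forms ι κ) ∈ T :=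
      ofPoly_mem fun α => Algebra.subset_adjoin (Or.inl (Or.inl ⟨α, rfl⟩))
    have h2 := one_tmul_mem (T := T) fun m => by
      rw [odd_eq_sum]
      exact add_mem
        (sum_mem fun α _ => T.smul_mem (Algebra.subset_adjoin (Or.inl (Or.inr ⟨α, rfl⟩))) _)
        (sum_mem fun α _ => T.smul_mem (Algebra.subset_adjoin (Or.inr ⟨α, rfl⟩)) _)
    induction hz using Submodule.span_induction with
    | zero => exact zero_mem _
    | add a b _ _ ha hb => exact add_mem ha hb
    | smul c a _ ha => exact Subalgebra.smul_mem _ ha c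
    | mem z hz =>
      obtain ⟨P, w, rfl⟩ := hz
      have := T.mul_mem (h1 P) (h2 w)
      rwa [ofPoly_apply, Algebra.TensorProduct.tmul_mul_tmul, mul_one, one_mul] at this
  · intro hz
    rw [mem_const_iff]
    refine Algebra.adjoin_le ?_ hz
    rintro _ ((⟨α, rfl⟩ | ⟨α, rfl⟩) | ⟨μ, rfl⟩)
    · exact ⟨MvPolynomial.X α ⊗ₜ 1, rfl⟩
    · exact ⟨1 ⊗ₜ ExteriorAlgebra.ι ℂ (Pi.single α 1, 0), by
        refine Eq.trans ?_ (ofFun_θ α).symm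
        change EvenForms.inclPoly 1 ⊗ₜ[ℂ] _ = _
        rw [map_one]; rfl⟩
    · exact ⟨1 ⊗ₜ ExteriorAlgebra.ι ℂ (0, Pi.single μ 1), by
        rw [dx_eq]
        change EvenForms.inclPoly 1 ⊗ₜ[ℂ] _ = _
        rw [map_one]; rfl⟩

theorem mul_mem_const {a b : Forms ι κ} (ha : a ∈ const ι κ) (hb : b ∈ const ι κ) :
    a * b ∈ const ι κ := by
  rw [mem_const_iff] at *
  exact mul_mem ha hb

theorem dθ_mem_const (α : ι) : (dθ α : Forms ι κ) ∈ const ι κ :=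
  mem_const_iff_mem_adjoin.mpr (Algebra.subset_adjoin (Or.inl (Or.inl ⟨α, rfl⟩)))

theorem θ_mem_const (α : ι) : (ofFun (SuperFun.θ α) : Forms ι κ) ∈ const ι κ :=
  mem_const_iff_mem_adjoin.mpr (Algebra.subset_adjoin (Or.inl (Or.inr ⟨α, rfl⟩)))

theorem dx_mem_const (μ : κ) : (dx μ : Forms ι κ) ∈ const ι κ :=
  mem_const_iff_mem_adjoin.mpr (Algebra.subset_adjoin (Or.inr ⟨μ, rfl⟩))

/-- Induction on constant forms. -/
theorem const_induction {p : Forms ι κ → Prop} (algebraMap : ∀ c, p (algebraMap ℂ _ c))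
    (dθ : ∀ α, p (dθ α)) (θ : ∀ α, p (ofFun (SuperFun.θ α))) (dx : ∀ μ, p (dx μ))
    (add : ∀ a ∈ const ι κ, ∀ b ∈ const ι κ, p a → p b → p (a + b))
    (mul : ∀ a ∈ const ι κ, ∀ b ∈ const ι κ, p a → p b → p (a * b))
    {z : Forms ι κ} (hz : z ∈ const ι κ) : p z := by
  rw [mem_const_iff_mem_adjoin] at hz
  induction hz using Algebra.adjoin_induction with
  | mem z hz =>
    obtain ((⟨α, rfl⟩ | ⟨α, rfl⟩) | ⟨μ, rfl⟩) := hz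
    exacts [dθ α, θ α, dx μ]
  | algebraMap c => exact algebraMap c
  | add a b ha hb h1 h2 =>
    exact add a (mem_const_iff_mem_adjoin.mpr ha) b (mem_const_iff_mem_adjoin.mpr hb) h1 h2
  | mul a b ha hb h1 h2 =>
    exact mul a (mem_const_iff_mem_adjoin.mpr ha) b (mem_const_iff_mem_adjoin.mpr hb) h1 h2

theorem gr_eq_span (k : ℤ) (p : ZMod 2) : gr ι κ k p =
    Submodule.span (Smooth κ) {e | e ∈ const ι κ ∧ e ∈ gr ι κ k p} := by
  refine le_antisymm (Submodule.span_le.mpr ?_) (Submodule.span_le.mpr fun e he => he.2)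
  rintro _ ⟨i, j, q, hk, hp, F, hF, P, hP, w, hw, rfl⟩
  induction hF using Submodule.span_induction with
  | zero => rw [map_zero, zero_mul, zero_mul]; exact Submodule.zero_mem _
  | add a b _ _ ha hb => rw [map_add, add_mul, add_mul]; exact Submodule.add_mem _ ha hb
  | smul h a _ ha =>
    have hs : ofFun (h • a) * ofPoly P * ofExt w = h • (ofFun a * ofPoly P * ofExt w) := by
      rw [ofFun_smul, smul_eq, smul_eq, mul_assoc, mul_assoc, mul_assoc]
    rw [hs]; exact Submodule.smul_mem _ _ ha
  | mem F hF =>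
    have hF' := hF
    obtain ⟨u, hu, rfl⟩ := hF
    refine Submodule.subset_span ⟨Submodule.subset_span ⟨P, ExteriorAlgebra.map
        (LinearMap.inl ℂ (ι → ℂ) (κ → ℂ)) u * ExteriorAlgebra.map (LinearMap.inr ℂ _ _) w, ?_⟩,
      Submodule.subset_span ⟨i, j, q, hk, hp, _, Submodule.subset_span hF', P, hP, w, hw, rfl⟩⟩
    rw [ofFun_tmul, ofPoly_apply, ofExt_apply, map_one, Algebra.TensorProduct.tmul_mul_tmul,
      Algebra.TensorProduct.tmul_mul_tmul, one_mul, mul_one, mul_one]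

theorem exists_finite_gr_le (k : ℤ) (p : ZMod 2) :
    ∃ T : Submodule ℂ (Forms ι κ), Module.Finite ℂ T ∧
      gr ι κ k p ≤ Submodule.span (Smooth κ) T := by
  obtain ⟨T, hT, hle⟩ := exists_finite_tensorGr_le (ι := ι) (κ := κ) k p
  refine ⟨T.map (comparison (TwoStep.abelian ι κ)), inferInstance, fun z hz => ?_⟩
  obtain ⟨y, rfl⟩ := comparison_abelian_bijective.2 z
  have hy := hle ((comparison_mem_gr (TwoStep.abelian ι κ)).mp hz)
  clear hz
  induction hy using Submodule.span_induction with
  | zero => rw [map_zero]; exact Submodule.zero_mem _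
  | add a b _ _ ha hb => rw [map_add]; exact Submodule.add_mem _ ha hb
  | smul h a _ ha => rw [comparison_smul]; exact Submodule.smul_mem _ _ ha
  | mem y hy => exact Submodule.subset_span ⟨y, hy, rfl⟩

end Forms
end PureSpinor

namespace PureSpinor
set_option linter.unusedSectionVars false
set_option linter.unusedSimpArgs false
variable {ι κ : Type} [Fintype ι] [DecidableEq ι] [Fintype κ] [DecidableEq κ]

/-! ## The de Rham complex is a strict multiplet -/

namespace Forms

/-- The commutator of `P` with a function h is multiplication by the form P(h), and this commutes
with functions, hence has order zero. -/
theorem isDiffOp_of_smul {P : Module.End ℂ (Forms ι κ)}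
    (hP : ∀ (h : Smooth κ) (z : Forms ι κ), P (h • z) = P (ofSmooth h) * z + h • P z) :
    IsDiffOpOfOrder κ 1 P := by
  intro h h' z
  simp only [LinearMap.sub_apply, LinearMap.comp_apply, DistribSMul.toLinearMap_apply, hP h,
    add_sub_cancel_right]
  rw [smul_eq, smul_eq, ← mul_assoc, ← ofSmooth_central, mul_assoc]

theorem _root_.PureSpinor.IsSuperDer.map_smooth_smul {p : ZMod 2} {P : Module.End ℂ (Forms ι κ)}
    (hP : IsSuperDer sgn p P) (h : Smooth κ) (z : Forms ι κ) :
    P (h • z) = P (ofSmooth h) * z + h • P z := by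
  have hs : signPow sgn p (ofSmooth h : Forms ι κ) = ofSmooth h := by
    rcases zmodTwo_cases p with rfl | rfl
    · rfl
    · exact sgn_ofSmooth h
  rw [smul_eq, hP.leibniz, hs, smul_eq]; rfl

variable {n : TwoStep ι κ} {G : Type*} [LieRing G] [LieAlgebra ℂ G] (r : G →ₗ⁅ℂ⁆ n.aut)

theorem lieAct_smul (x : SP G ι κ) (h : Smooth κ) (z : Forms ι κ) :
    lieAct r x (h • z) = lieAct r x (ofSmooth h) * z + h • lieAct r x z := by
  rw [evenPart_add_oddPart x, map_add]
  simp only [LinearMap.add_apply]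
  rw [(lieAct_isLie r (evenPart_mem x)).der.map_smooth_smul,
    (lieAct_isLie r (oddPart_mem x)).der.map_smooth_smul, add_mul, smul_add]
  abel

theorem d_linX (l : Module.Dual ℂ (κ → ℂ)) :
    d (linX l : Forms ι κ) = ∑ μ, l (Pi.single μ 1) • dx μ := by
  simp [linX_apply, d_coord]

theorem dx_eq_d (μ : κ) : (dx μ : Forms ι κ) = d (linX (LinearMap.proj μ)) := by
  rw [linX_proj, d_coord]

theorem d_one : d (1 : Forms ι κ) = 0 := d_isSuperDer.leibniz.map_one

theorem trans_mem (w : κ → ℂ) : ((0, 0, w) : SP G ι κ) ∈ SP.par G ι κ 0 := by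
  simp [SP.par, Submodule.mem_prod]

theorem linear_mem (a : G) : ((a, 0, 0) : SP G ι κ) ∈ SP.par G ι κ 0 := by
  simp [SP.par, Submodule.mem_prod]

theorem lieAct_trans_ofSmooth (w : κ → ℂ) (h : Smooth κ) :
    lieAct r (0, 0, w) (ofSmooth h : Forms ι κ) =
      ofSmooth (∑ μ, w μ • Smooth.partial μ h) := by
  rw [(lieAct_isLie r (trans_mem w)).geom, map_sum]
  refine Finset.sum_congr rfl fun μ _ => ?_
  rw [← linX_proj, lieAct_linX]
  simp

theorem lieAct_linear_ofSmooth (a : G) (h : Smooth κ) :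
    lieAct r (a, 0, 0) (ofSmooth h : Forms ι κ) =
      ofSmooth (-∑ μ, ∑ ν, entryTwo r μ ν a • (Smooth.coord ν * Smooth.partial μ h)) := by
  rw [(lieAct_isLie r (linear_mem a)).geom, map_neg, map_sum, ← Finset.sum_neg_distrib]
  refine Finset.sum_congr rfl fun μ _ => ?_
  have h1 : lieAct r (a, 0, 0) (ofSmooth (Smooth.coord μ) : Forms ι κ) =
      -∑ ν, entryTwo r μ ν a • ofSmooth (Smooth.coord ν) := by
    rw [← linX_proj, lieAct_linX]
    simp only [map_zero, zero_smul, add_zero, LinearMap.comp_zero, smul_zero]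
    rfl
  rw [h1]
  simp only [map_sum, map_smul, map_mul, neg_mul, Finset.sum_mul, smul_mul_assoc]

/-- On dθ and dx the action is d of its value on a coordinate, which is 0 or a constant; θ is not
moved by translations, and the Leibniz rule covers products. -/
theorem lieAct_trans_const (w : κ → ℂ) {e : Forms ι κ} (he : e ∈ const ι κ) :
    lieAct r (0, 0, w) e = 0 := by
  have hP := lieAct_isLie r (trans_mem (G := G) (ι := ι) w)
  refine const_induction (p := fun e => lieAct r (0, 0, w) e = 0)
    (fun c => ?_) (fun α => ?_) (fun α => ?_) (fun μ => ?_)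
    (fun a ha' b hb' ha hb => ?_) (fun a ha' b hb' ha hb => ?_) he
  · rw [Algebra.algebraMap_eq_smul_one, map_smul, hP.der.leibniz.map_one, smul_zero]
  · rw [dθ_eq, hP.apply_d, lieAct_linθ]; simp
  · rw [← linθ_proj, lieAct_linθ]; simp
  · rw [dx_eq_d, hP.apply_d, lieAct_linX]; simp [d_one]
  · rw [map_add, ha, hb, add_zero]
  · rw [hP.der.leibniz, ha, hb]; simp

/-- A linear field sends each of θ, dθ and dx to a linear combination of generators of the same
kind, and constant forms are closed under products. -/
theorem lieAct_linear_const (a : G) {e : Forms ι κ} (he : e ∈ const ι κ) :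
    lieAct r (a, 0, 0) e ∈ const ι κ := by
  have hP := lieAct_isLie r (linear_mem (ι := ι) (κ := κ) a)
  refine const_induction (p := fun e => lieAct r (a, 0, 0) e ∈ const ι κ)
    (fun c => ?_) (fun α => ?_) (fun α => ?_) (fun μ => ?_)
    (fun a ha' b hb' ha hb => ?_) (fun a ha' b hb' ha hb => ?_) he
  · rw [Algebra.algebraMap_eq_smul_one, map_smul, hP.der.leibniz.map_one, smul_zero]
    exact Submodule.zero_mem _
  · rw [dθ_eq, hP.apply_d, lieAct_linθ]
    simp only [map_zero, zero_smul, add_zero, map_neg, d_linθ]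
    exact Submodule.smul_mem _ _ (Submodule.neg_mem _ (Submodule.sum_mem _ fun β _ =>
      Submodule.smul_mem _ _ (dθ_mem_const β)))
  · rw [← linθ_proj, lieAct_linθ]
    simp only [map_zero, zero_smul, add_zero, linθ_apply]
    exact Submodule.neg_mem _ (Submodule.sum_mem _ fun β _ =>
      Submodule.smul_mem _ _ (θ_mem_const β))
  · rw [dx_eq_d, hP.apply_d, lieAct_linX]
    simp only [map_zero, zero_smul, add_zero, map_neg, d_linX, LinearMap.comp_zero, smul_zero]
    exact Submodule.smul_mem _ _ (Submodule.neg_mem _ (Submodule.sum_mem _ fun β _ =>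
      Submodule.smul_mem _ _ (dx_mem_const β)))
  · rw [map_add]; exact Submodule.add_mem _ ha hb
  · rw [hP.der.leibniz]
    exact Submodule.add_mem _ (mul_mem_const ha hb') (mul_mem_const ha' hb)

theorem lieAct_trans (w : κ → ℂ) (h : Smooth κ) {e : Forms ι κ} (he : e ∈ const ι κ) :
    lieAct r (0, 0, w) (h • e) = (∑ μ, w μ • Smooth.partial μ h) • e := by
  rw [lieAct_smul, lieAct_trans_const r w he, smul_zero, add_zero, lieAct_trans_ofSmooth, smul_eq]

theorem lieAct_linear (a : G) (h : Smooth κ) (e : Forms ι κ) :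
    lieAct r (a, 0, 0) (h • e) =
      (-∑ μ, ∑ ν, entryTwo r μ ν a • (Smooth.coord ν * Smooth.partial μ h)) • e +
        h • lieAct r (a, 0, 0) e := by
  rw [lieAct_smul, lieAct_linear_ofSmooth, smul_eq (-_)]

theorem finite_gr (k : ℤ) (p : ZMod 2) : Module.Finite (Smooth κ) (gr ι κ k p) := by
  obtain ⟨T, hT, hle⟩ := exists_finite_gr_le (ι := ι) (κ := κ) k p
  exact finite_of_isInternal isInternal_gr (k, p) T hle

end Forms

open Forms in
theorem isStrictMultiplet_deRham {n : TwoStep ι κ} {G : Type*} [LieRing G] [LieAlgebra ℂ G]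
    (r : G →ₗ⁅ℂ⁆ n.aut) : IsStrictMultiplet r (deRham r) where
  internal := isInternal_gr
  finite := finite_gr
  projective k p := projective_of_isInternal (isInternal_gr (ι := ι) (κ := κ)) (k, p)
  D_diffOp := ⟨1, isDiffOp_of_smul d_isSuperDer.map_smooth_smul⟩
  D_degree _ _ _ he := d_mem_gr he
  D_square := d_mul_d
  ρ_diffOp x := ⟨1, isDiffOp_of_smul (lieAct_smul r x)⟩
  ρ_degree _ _ hx _ _ _ he := lieAct_mem_gr r hx he
  ρ_bracket _ _ _ hx _ hy := lieAct_bracket r hx hy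
  ρ_D _ _ hx := (lieAct_isLie r hx).comm
  affine := isBaseChange_const
  affine_gr := gr_eq_span
  translations w h _ he := lieAct_trans r w h he
  linear_const a _ he := lieAct_linear_const r a he
  linear a h e _ := lieAct_linear r a h e

end PureSpinor

namespace PureSpinor
set_option linter.unusedSectionVars false
set_option linter.unusedSimpArgs false
variable {ι κ : Type} [Fintype ι] [DecidableEq ι] [Fintype κ] [DecidableEq κ]

/-! ## The pure spinor complex is a strict multiplet -/

section DiffOp

variable {E F : Type*} [AddCommGroup E] [Module ℂ E] [Module (Smooth κ) E]
  [SMulCommClass (Smooth κ) ℂ E] [AddCommGroup F] [Module ℂ F] [Module (Smooth κ) F]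
  [SMulCommClass (Smooth κ) ℂ F]

/-- Differential operators are transported along injective maps linear over functions. -/
theorem IsDiffOpOfOrder.of_injective {Φ : E →ₗ[ℂ] F} (hΦ : Function.Injective Φ)
    (hs : ∀ (h : Smooth κ) e, Φ (h • e) = h • Φ e) (k : ℕ) (P : E →ₗ[ℂ] E) (Q : F →ₗ[ℂ] F)
    (hPQ : Φ ∘ₗ P = Q ∘ₗ Φ) (hQ : IsDiffOpOfOrder κ k Q) : IsDiffOpOfOrder κ k P := by
  have hPQ' : ∀ e, Φ (P e) = Q (Φ e) := LinearMap.congr_fun hPQ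
  induction k generalizing P Q with
  | zero =>
    intro h e
    apply hΦ
    rw [hPQ', hs, hQ, hs, hPQ']
  | succ k ih =>
    intro h
    have hc : ∀ e, Φ ((P ∘ₗ DistribSMul.toLinearMap ℂ E h -
        DistribSMul.toLinearMap ℂ E h ∘ₗ P) e) = (Q ∘ₗ DistribSMul.toLinearMap ℂ F h -
        DistribSMul.toLinearMap ℂ F h ∘ₗ Q) (Φ e) := fun e => by
      simp only [LinearMap.sub_apply, LinearMap.comp_apply, DistribSMul.toLinearMap_apply, map_sub,
        hPQ', hs]
    exact ih _ _ (LinearMap.ext hc) (hQ h) hc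

end DiffOp

open Forms in
theorem ofCE_mem_const (n : TwoStep ι κ) (c : CE ι κ) : ofCE n c ∈ const ι κ := by
  rw [mem_const_iff]
  have hc : c ∈ Algebra.adjoin ℂ (CE.gens ι κ) := by
    rw [CE.adjoin_gens]; trivial
  refine Algebra.adjoin_le (S := (constHom ι κ).range.comap (ofCE n)) ?_ hc
  refine CE.forall_gens (fun α => ?_) (fun μ => ?_)
  · change ofCE n _ ∈ (constHom ι κ).range
    rw [ofCE_lam, ← mem_const_iff]
    exact dθ_mem_const α
  · change ofCE n _ ∈ (constHom ι κ).range
    rw [ofCE_v, ← mem_const_iff]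
    exact Submodule.add_mem _ (dx_mem_const μ) (Submodule.sum_mem _ fun α _ =>
      Submodule.sum_mem _ fun β _ => Submodule.smul_mem _ _
        (mul_mem_const (dθ_mem_const α) (θ_mem_const β)))

-- The translation and linearity laws are formulated on constant sections only, so Φ must respect
-- constants for these laws to be pulled back; the shift dθ f θ has constant coefficients.
open Forms in
theorem comparison_mem_const (n : TwoStep ι κ) {e : SuperFun ι κ ⊗[ℂ] CE ι κ}
    (he : e ∈ tensorConst ι κ) : comparison n e ∈ const ι κ := by
  induction he using Submodule.span_induction with
  | zero => rw [map_zero]; exact Submodule.zero_mem _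
  | add a b _ _ ha hb => rw [map_add]; exact Submodule.add_mem _ ha hb
  | smul c a _ ha => rw [map_smul]; exact Submodule.smul_mem _ _ ha
  | mem z hz =>
    obtain ⟨w, c, rfl⟩ := hz
    rw [comparison_tmul]
    refine mul_mem_const (Submodule.subset_span ⟨1, ExteriorAlgebra.map
      (LinearMap.inl ℂ (ι → ℂ) (κ → ℂ)) w, ?_⟩) (ofCE_mem_const n c)
    rw [ofFun_tmul, map_one, map_one]

variable {n : TwoStep ι κ} {G : Type*} [LieRing G] [LieAlgebra ℂ G] (r : G →ₗ⁅ℂ⁆ n.aut)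

theorem Smooth.partial_one (μ : κ) : Smooth.partial μ (1 : Smooth κ) = 0 := by
  simpa using Smooth.partial_algebraMap μ 1

/-- The ∂_x part vanishes on functions independent of x, and the coefficients of ∂_θ are linear in θ
with constant coefficients. -/
theorem act_linField_one_tmul (a : G) (w : ExteriorAlgebra ℂ (ι → ℂ)) :
    ∃ w', VField.act (linField r a) ((1 : Smooth κ) ⊗ₜ[ℂ] w) = (1 : Smooth κ) ⊗ₜ[ℂ] w' := by
  let t : ExteriorAlgebra ℂ (ι → ℂ) →ₗ[ℂ] SuperFun ι κ := TensorProduct.mk ℂ (Smooth κ) _ 1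
  suffices h : VField.act (linField r a) (t w) ∈ LinearMap.range t by
    obtain ⟨w', hw'⟩ := h
    exact ⟨w', hw'.symm⟩
  have h1 : ∀ μ, SuperFun.dx μ (t w) = 0 := fun μ => by
    change (Smooth.partial μ 1) ⊗ₜ[ℂ] w = 0
    rw [Smooth.partial_one, TensorProduct.zero_tmul]
  rw [VField.act_apply]
  simp only [h1, mul_zero, Finset.sum_const_zero, zero_add]
  refine Submodule.sum_mem _ fun α _ => ?_
  have h2 : (linField r a).2 α = t (-∑ β, entryOne r α β a •
      ExteriorAlgebra.ι ℂ (Pi.single β 1)) := by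
    rw [map_neg, map_sum]
    simp only [map_smul]
    rfl
  rw [h2]
  have h3 : ∀ u, t u * SuperFun.dθ α (t w) = t (u * CliffordAlgebra.contractLeft
      (Q := (0 : QuadraticForm ℂ (ι → ℂ))) (LinearMap.proj α) w) := fun u =>
    (Algebra.TensorProduct.tmul_mul_tmul (1 : Smooth κ) 1 u _).trans (by rw [one_mul]; rfl)
  exact ⟨_, (h3 _).symm⟩

/-- The action of `𝔤` on `C^∞(N) ⊗ C^•(𝔫)`. -/
def tensorAct (x : SP G ι κ) : Module.End ℂ (SuperFun ι κ ⊗[ℂ] CE ι κ) :=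
  (VField.act (evenLeft r x + oddLeft n G x)).rTensor _ + (CE.rep r x.1).lTensor _

theorem tensorAct_mem_const (a : G) {e : SuperFun ι κ ⊗[ℂ] CE ι κ} (he : e ∈ tensorConst ι κ) :
    tensorAct r (a, 0, 0) e ∈ tensorConst ι κ := by
  induction he using Submodule.span_induction with
  | zero => rw [map_zero]; exact Submodule.zero_mem _
  | add a b _ _ ha hb => rw [map_add]; exact Submodule.add_mem _ ha hb
  | smul c a _ ha => rw [map_smul]; exact Submodule.smul_mem _ _ ha
  | mem z hz =>
    obtain ⟨w, c, rfl⟩ := hz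
    obtain ⟨w', hw'⟩ := act_linField_one_tmul r a w
    have hX : evenLeft r (a, 0, 0) + oddLeft n G (a, 0, 0) = linField r a := by
      simp [evenLeft, oddLeft]
    rw [tensorAct, hX, LinearMap.add_apply, LinearMap.rTensor_tmul, LinearMap.lTensor_tmul, hw']
    exact Submodule.add_mem _ (Submodule.subset_span ⟨w', c, rfl⟩)
      (Submodule.subset_span ⟨w, CE.rep r a c, rfl⟩)

theorem finite_tensorGr (k : ℤ) (p : ZMod 2) : Module.Finite (Smooth κ) (tensorGr ι κ k p) := by
  obtain ⟨T, hT, hle⟩ := exists_finite_tensorGr_le (ι := ι) (κ := κ) k p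
  exact finite_of_isInternal isInternal_tensorGr (k, p) T hle

/-- The algebraic laws of strict multiplets are transported along injective morphisms. -/
theorem IsStrictMultiplet.of_injective {r : G →ₗ⁅ℂ⁆ n.aut} {M N : LocalModuleData G ι κ}
    (hN : IsStrictMultiplet r N) {Φ : M.carrier →ₗ[ℂ] N.carrier} (hΦ : Function.Injective Φ)
    (hs : ∀ (h : Smooth κ) e, Φ (h • e) = h • Φ e)
    (hgr : ∀ k p e, Φ e ∈ N.gr k p ↔ e ∈ M.gr k p) (hc : ∀ e ∈ M.const, Φ e ∈ N.const)
    (hD : Φ ∘ₗ M.D = N.D ∘ₗ Φ) (hρ : ∀ x, Φ ∘ₗ M.ρ x = N.ρ x ∘ₗ Φ)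
    (internal : DirectSum.IsInternal fun k : ℤ × ZMod 2 => M.gr k.1 k.2)
    (finite : ∀ k p, Module.Finite (Smooth κ) (M.gr k p))
    (projective : ∀ k p, Module.Projective (Smooth κ) (M.gr k p))
    (affine : IsBaseChange (Smooth κ) M.const.subtype)
    (affine_gr : ∀ k p, M.gr k p =
      Submodule.span (Smooth κ) {e | e ∈ M.const ∧ e ∈ M.gr k p})
    (linear_const : ∀ a : G, ∀ e ∈ M.const, M.ρ (a, 0, 0) e ∈ M.const) :
    IsStrictMultiplet r M := by
  have hD' : ∀ e, Φ (M.D e) = N.D (Φ e) := LinearMap.congr_fun hD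
  have hρ' : ∀ x e, Φ (M.ρ x e) = N.ρ x (Φ e) := fun x => LinearMap.congr_fun (hρ x)
  -- Equations and degree conditions descend through injectivity and reflection of degrees. The
  -- bundle structure and the preservation of constants are not implied by an injection that merely
  -- sends constants to constants, and are supplied as hypotheses.
  exact
  { internal, finite, projective, affine, affine_gr, linear_const
    D_diffOp := hN.D_diffOp.imp fun o ho => .of_injective hΦ hs o _ _ hD ho
    D_degree := fun k p e he => by
      rw [← hgr, hD']
      exact hN.D_degree k p _ ((hgr k p e).mpr he)
    D_square := LinearMap.ext fun e => hΦ <| by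
      rw [Module.End.mul_apply, hD', hD', ← Module.End.mul_apply, hN.D_square]
      simp
    ρ_diffOp := fun x => (hN.ρ_diffOp x).imp fun o ho => .of_injective hΦ hs o _ _ (hρ x) ho
    ρ_degree := fun p x hx k q e he => by
      rw [← hgr, hρ']
      exact hN.ρ_degree p x hx k q _ ((hgr k q e).mpr he)
    ρ_bracket := fun p q x hx y hy => LinearMap.ext fun e => hΦ <| by
      rw [hρ', hN.ρ_bracket p q x hx y hy]
      simp only [LinearMap.sub_apply, LinearMap.smul_apply, Module.End.mul_apply, map_sub, map_smul,
        hρ']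
    ρ_D := fun p x hx => LinearMap.ext fun e => hΦ <| by
      have := LinearMap.congr_fun (hN.ρ_D p x hx) (Φ e)
      simpa only [LinearMap.smul_apply, Module.End.mul_apply, map_smul, hρ', hD'] using this
    translations := fun w h e he => hΦ <| by
      rw [hρ', hs, hs, hN.translations w h _ (hc e he)]
    linear := fun a h e he => hΦ <| by
      rw [hρ', hs, hN.linear a h _ (hc e he), map_add, hs, hs, hρ'] }

theorem isStrictMultiplet_pureSpinor : IsStrictMultiplet r (pureSpinor r (ceSelf r)) :=
  (isStrictMultiplet_deRham r).of_injective (M := pureSpinor r (ceSelf r)) (Φ := comparison n)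
    (comparison_bijective n).1 (comparison_smul n) (fun _ _ _ => comparison_mem_gr n)
    (fun _ he => comparison_mem_const n he) (comparison_D r) (comparison_ρ r)
    isInternal_tensorGr finite_tensorGr
    (fun k p => projective_of_isInternal (isInternal_tensorGr (ι := ι) (κ := κ)) (k, p))
    (isBaseChange_constTensor κ (ExteriorAlgebra ℂ (ι → ℂ)) (CE ι κ)) tensorGr_eq_span
    (fun a _ he => tensorAct_mem_const r a he)

theorem isStrictMorphism_comparison :
    IsStrictMorphism (pureSpinor r (ceSelf r)) (deRham r) (comparison n) where
  diffOp := ⟨0, comparison_smul n⟩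
  degree _ _ _ he := (comparison_mem_gr n).mpr he
  comm_D := comparison_D r
  comm_ρ := comparison_ρ r

/-! ### Bijective cochain maps are quasi-isomorphisms. -/

section Cohomology

variable {E F : Type*} [AddCommGroup E] [Module ℂ E] [AddCommGroup F] [Module ℂ F]

theorem isQuasiIso_of_bijective {D : Module.End ℂ E} {D' : Module.End ℂ F} {Φ : E →ₗ[ℂ] F}
    (h : Φ ∘ₗ D = D' ∘ₗ Φ) (hΦ : Function.Bijective Φ) : IsQuasiIso D D' Φ := by
  have h' : ∀ e, Φ (D e) = D' (Φ e) := LinearMap.congr_fun h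
  refine ⟨h, ?_, fun z => ?_⟩
  · rw [injective_iff_map_eq_zero]
    intro z hz
    obtain ⟨⟨e, he⟩, rfl⟩ := Submodule.Quotient.mk_surjective _ z
    obtain ⟨f, hf⟩ := (Submodule.Quotient.mk_eq_zero _).mp hz
    -- Surjectivity lifts a primitive of the image, and injectivity then makes the lift a primitive
    -- of the original cocycle.
    obtain ⟨u, rfl⟩ := hΦ.2 f
    refine (Submodule.Quotient.mk_eq_zero _).mpr ⟨u, hΦ.1 ?_⟩
    exact (h' u).trans hf
  · obtain ⟨⟨f, hf⟩, rfl⟩ := Submodule.Quotient.mk_surjective _ z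
    obtain ⟨e, rfl⟩ := hΦ.2 f
    refine ⟨Submodule.Quotient.mk ⟨e, hΦ.1 ?_⟩, rfl⟩
    rw [h', map_zero]
    exact hf

end Cohomology

/-! ## Naturality -/

section Naturality

variable {ι' κ' : Type} [Fintype ι'] [DecidableEq ι'] [Fintype κ'] [DecidableEq κ']
  {n' : TwoStep ι' κ'} (m : n.Hom n')

open Forms

theorem exteriorMap_comp_apply {M N P : Type*} [AddCommGroup M] [Module ℂ M] [AddCommGroup N]
    [Module ℂ N] [AddCommGroup P] [Module ℂ P] (f : M →ₗ[ℂ] N) (g : N →ₗ[ℂ] P)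
    (w : ExteriorAlgebra ℂ M) : ExteriorAlgebra.map g (ExteriorAlgebra.map f w) =
      ExteriorAlgebra.map (g ∘ₗ f) w := by
  rw [← ExteriorAlgebra.map_comp_map]; rfl

theorem pullForms_ofFun (F : SuperFun ι' κ') : m.pullForms (ofFun F) = ofFun (m.pullFun F) := by
  induction F using TensorProduct.induction_on with
  | zero => simp
  | add a b ha hb => simp only [map_add, ha, hb]
  | tmul h w =>
    have h1 : EvenForms.mapAlg m.pullSmooth m.pullPoly (EvenForms.inclSmooth h) =
        EvenForms.inclSmooth (m.pullSmooth h) :=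
      (Algebra.TensorProduct.map_tmul _ _ h (1 : MvPolynomial ι' ℂ)).trans
        (by rw [map_one]; rfl)
    rw [ofFun_tmul, TwoStep.Hom.pullForms, Algebra.TensorProduct.map_tmul, h1, TwoStep.Hom.pullFun,
      Algebra.TensorProduct.map_tmul, ofFun_tmul, exteriorMap_comp_apply, exteriorMap_comp_apply]
    congr 3
    ext <;> simp

theorem pullForms_ofPoly (P : MvPolynomial ι' ℂ) :
    m.pullForms (ofPoly P) = ofPoly (m.pullPoly P) := by
  have h1 : EvenForms.mapAlg m.pullSmooth m.pullPoly (EvenForms.inclPoly P) =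
      EvenForms.inclPoly (m.pullPoly P) :=
    (Algebra.TensorProduct.map_tmul _ _ (1 : Smooth κ') P).trans (by rw [map_one]; rfl)
  rw [ofPoly_apply, TwoStep.Hom.pullForms, Algebra.TensorProduct.map_tmul, h1, map_one,
    ofPoly_apply]

theorem pullForms_dθ (α : ι') :
    m.pullForms (dθ α) = ∑ β, m.one (Pi.single β 1) α • (dθ β : Forms ι κ) := by
  rw [dθ, pullForms_ofPoly, TwoStep.Hom.pullPoly, MvPolynomial.aeval_X, map_sum]
  simp only [map_smul]
  rfl

theorem pullForms_odd (a : (ι' → ℂ) × (κ' → ℂ)) :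
    m.pullForms (odd a) = (odd (m.dualOne a.1, m.dualTwo a.2) : Forms ι κ) := by
  rw [odd_apply, TwoStep.Hom.pullForms, Algebra.TensorProduct.map_tmul, map_one,
    ExteriorAlgebra.map_apply_ι]
  rfl

theorem pullForms_θ (α : ι') : m.pullForms (ofFun (SuperFun.θ α)) =
    ∑ β, m.one (Pi.single β 1) α • (ofFun (SuperFun.θ β) : Forms ι κ) := by
  rw [ofFun_θ, pullForms_odd, odd_eq_sum]
  simp [TwoStep.Hom.dualOne]

theorem pullForms_dx (μ : κ') : m.pullForms (dx μ) =
    ∑ ν, (m.two (Pi.single ν 1) μ : ℂ) • (dx ν : Forms ι κ) := by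
  rw [dx_eq, pullForms_odd, odd_eq_sum]
  simp [TwoStep.Hom.dualTwo]

theorem sum_sum_comm {A B E : Type*} [Fintype A] [Fintype B] [AddCommMonoid E]
    (g : A → A → B → B → E) :
    ∑ a, ∑ a', ∑ b, ∑ b', g a a' b b' = ∑ b, ∑ b', ∑ a, ∑ a', g a a' b b' := by
  have h : ∑ p : A × A, ∑ q : B × B, g p.1 p.2 q.1 q.2 =
      ∑ q : B × B, ∑ p : A × A, g p.1 p.2 q.1 q.2 := Finset.sum_comm
  simpa only [Fintype.sum_prod_type] using h

/-- Compatibility with the brackets, written in structure constants on basis vectors; the common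
normalisation 1/2 of `f` drops out. -/
theorem f_hom (μ : κ') (β γ : ι) :
    ∑ α, ∑ α', n'.f μ α α' * (m.one (Pi.single β 1) α * m.one (Pi.single γ 1) α') =
      ∑ ν, (m.two (Pi.single ν 1) μ : ℂ) * n.f ν β γ := by
  have h : ∀ s t : ι' → ℂ, (1 / 2 : ℂ) * n'.br s t μ = ∑ α, ∑ α', n'.f μ α α' * (s α * t α') :=
    fun s t => by
      have h1 := LinearMap.congr_fun (dual_eq_sum (LinearMap.proj μ ∘ₗ n'.br s)) t
      simp only [LinearMap.comp_apply, LinearMap.proj_apply, LinearMap.sum_apply,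
        LinearMap.smul_apply, smul_eq_mul] at h1
      rw [h1, Finset.sum_comm, Finset.mul_sum]
      refine Finset.sum_congr rfl fun α' _ => ?_
      rw [← mul_assoc, ← sum_f, Finset.sum_mul]
      exact Finset.sum_congr rfl fun α _ => by ring
  rw [← h, m.map_br, Finset.mul_sum]
  refine Finset.sum_congr rfl fun ν _ => ?_
  rw [TwoStep.f]; ring

/-- The dx parts match by linearity. For the dθ f θ parts the two substitutions in dθ and θ combine
into the left side of `f_hom`, and this is where naturality needs the bracket. -/
theorem pullForms_shifted (μ : κ') : m.pullForms (shifted n' μ) =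
    ∑ ν, (m.two (Pi.single ν 1) μ : ℂ) • (shifted n ν : Forms ι κ) := by
  simp only [shifted, map_add, map_sum, map_smul, map_mul, pullForms_dx, pullForms_dθ, pullForms_θ,
    smul_add, Finset.sum_add_distrib]
  congr 1
  have hr : ∑ ν, (m.two (Pi.single ν 1) μ : ℂ) • ∑ β, ∑ γ, n.f ν β γ •
      (dθ β * ofFun (SuperFun.θ γ) : Forms ι κ) = ∑ β, ∑ γ, (∑ ν, (m.two (Pi.single ν 1) μ : ℂ) *
        n.f ν β γ) • (dθ β * ofFun (SuperFun.θ γ)) := by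
    simp only [Finset.smul_sum, Finset.sum_smul, smul_smul]
    rw [Finset.sum_comm]
    exact Finset.sum_congr rfl fun β _ => Finset.sum_comm
  rw [hr]
  simp only [← f_hom m, Finset.sum_smul, Finset.sum_mul_sum, smul_mul_smul_comm, Finset.smul_sum,
    smul_smul]
  exact sum_sum_comm _

theorem pullForms_ofCE (c : CE ι' κ') : m.pullForms (ofCE n' c) = ofCE n (m.pullCE c) := by
  refine AlgHom.congr_fun (φ₁ := m.pullForms.comp (ofCE n')) (φ₂ := (ofCE n).comp m.pullCE) ?_ c
  refine AlgHom.ext_of_adjoin_eq_top CE.adjoin_gens (CE.forall_gens (fun α => ?_) fun μ => ?_)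
  · have h : m.pullCE (CE.lam α) = ∑ β, m.one (Pi.single β 1) α • (CE.lam β : CE ι κ) := by
      rw [CE.lam, TwoStep.Hom.pullCE, Algebra.TensorProduct.map_tmul, map_one,
        TwoStep.Hom.pullPoly, MvPolynomial.aeval_X, TensorProduct.sum_tmul]
      rfl
    simp only [AlgHom.comp_apply, ofCE_lam, h, map_sum, map_smul, pullForms_dθ]
  · have h : m.pullCE (CE.v μ) = ∑ ν, (m.two (Pi.single ν 1) μ : ℂ) • (CE.v ν : CE ι κ) := by
      rw [CE.v, TwoStep.Hom.pullCE, Algebra.TensorProduct.map_tmul, map_one,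
        ExteriorAlgebra.map_apply_ι]
      have hd : m.dualTwo (Pi.single μ 1) =
          ∑ ν, (m.two (Pi.single ν 1) μ : ℂ) • Pi.single ν (1 : ℂ) := by
        ext ν
        simp [TwoStep.Hom.dualTwo, Pi.single_apply]
      simp only [hd, map_sum, map_smul, TensorProduct.tmul_sum, TensorProduct.tmul_smul]
      rfl
    simp only [AlgHom.comp_apply, ofCE_v, h, map_sum, map_smul, pullForms_shifted]

theorem comparison_natural :
    comparison n ∘ₗ TensorProduct.map m.pullFun.toLinearMap m.pullCE.toLinearMap =
      m.pullForms.toLinearMap ∘ₗ comparison n' := by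
  refine TensorProduct.ext' fun F c => ?_
  simp only [LinearMap.comp_apply, TensorProduct.map_tmul, AlgHom.toLinearMap_apply,
    comparison_tmul, map_mul, pullForms_ofFun, pullForms_ofCE]

end Naturality

end PureSpinor

theorem mainTheorem7 {ι κ : Type} [Fintype ι] [DecidableEq ι] [Fintype κ] [DecidableEq κ]
    (n : PureSpinor.TwoStep ι κ) {G : Type*} [LieRing G] [LieAlgebra ℂ G]
    (r : G →ₗ⁅ℂ⁆ n.aut) :
    PureSpinor.IsCEModule r (PureSpinor.ceSelf r) ∧
    PureSpinor.IsStrictMultiplet r (PureSpinor.pureSpinor r (PureSpinor.ceSelf r)) ∧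
    PureSpinor.IsStrictMultiplet r (PureSpinor.deRham r) ∧
    PureSpinor.IsStrictMorphism (PureSpinor.pureSpinor r (PureSpinor.ceSelf r))
      (PureSpinor.deRham r) (PureSpinor.comparison n) ∧
    PureSpinor.IsQuasiIso (PureSpinor.pureSpinor r (PureSpinor.ceSelf r)).D
      (PureSpinor.deRham r).D (PureSpinor.comparison n) ∧
    Function.Bijective (PureSpinor.comparison n) ∧
    ∀ {ι' κ' : Type} [Fintype ι'] [DecidableEq ι'] [Fintype κ'] [DecidableEq κ']
      (n' : PureSpinor.TwoStep ι' κ') (m : n.Hom n'),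
      PureSpinor.comparison n ∘ₗ
          TensorProduct.map m.pullFun.toLinearMap m.pullCE.toLinearMap =
        m.pullForms.toLinearMap ∘ₗ PureSpinor.comparison n' :=
  ⟨PureSpinor.isCEModule_ceSelf r, PureSpinor.isStrictMultiplet_pureSpinor r,
    PureSpinor.isStrictMultiplet_deRham r, PureSpinor.isStrictMorphism_comparison r,
    PureSpinor.isQuasiIso_of_bijective (PureSpinor.comparison_D r)
      (PureSpinor.comparison_bijective n),
    PureSpinor.comparison_bijective n, fun _ m => PureSpinor.comparison_natural m⟩
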